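/- **Setting.** Let $\mathcal N\subset\mathcal H\subset\mathcal N'$ be a nuclear triple: $\mathcal H$ is a real separable Hilbert space, $\mathcal N$ is a nuclear Fréchet space densely and continuously embedded in $\mathcal H$, whose topology is given by an increasing sequence of Hilbertian norms $|\cdot|_p$, $p\in\mathbb N$, with $|\cdot|\le|\cdot|_p$; $\mathcal H_p\subset\mathcal H$ is the completion of $\mathcal N$ in $|\cdot|_p$, $\mathcal N=\bigcap_p\mathcal H_p$, and for all $p_1,p_2$ there is $p$ such that $\mathcal H_p\hookrightarrow\mathcal H_{p_1}$ and $\mathcal H_p\hookrightarrow\mathcal H_{p_2}$ are Hilbert–Schmidt. Let $\mathcal H_{-p}$ be the dual of $\mathcal H_p$, with norm $|\cdot|_{-p}$, so that $\mathcal N'=\bigcup_p\mathcal H_{-p}$ (with the inductive limit topology); an index $\mathbb C$ denotes complexification. Let $\mathcal N_{\mathbb C}^{\hat\otimes n}=\operatorname{pr\,lim}_p\mathcal H_{p,\mathbb C}^{\hat\otimes n}$ (symmetric Hilbert tensor powers, norms $|\cdot|_p$). A function is holomorphic if it is analytic along complex lines and locally bounded. Let $\mu$ be a probability measure on $\mathcal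 N'$ (cylinder $\sigma$-algebra) whose Laplace transform $l_\mu(\theta)=\int e^{\langle x,\theta\rangle}\,d\mu(x)$ exists and is holomorphic in a neighbourhood of $0\in\mathcal N_{\mathbb C}$. For $z\in\mathcal N'_{\mathbb C}$ let $P_n^\mu(z)\in(\mathcal N_{\mathbb C}^{\hat\otimes n})'$ be the continuous linear functional for which $\langle P_n^\mu(z),\theta^{\otimes n}\rangle$ is the $n$-th derivative at $t=0$ of $t\mapsto e^{\langle z,t\theta\rangle}/l_\mu(t\theta)$, for all $\theta\in\mathcal N_{\mathbb C}$. The test function space $(\mathcal N)^1_\mu$ is the projective limit over $p,q\in\mathbb N$ of the completions of the polynomials $\varphi=\sum_{n=0}^M\langle P_n^\mu,\varphi^{(n)}\rangle$, $\varphi^{(n)}\in\mathcal N_{\mathbb C}^{\hat\otimes n}$, in the norms $\|\varphi\|_{p,q,\mu}^2=\sum_n(n!)^2\,2^{nq}|\varphi^{(n)}|_p^2$; that is, its elements are the series $\varphi=\sum_{n\ge0}\langle P_n^\mu,\varphi^{(n)}\rangle$ for which all these norms are finite, and on $\mathcal N'$ we have $\varphi(x)=\sum_n\langle P_n^\mu(x),\varphi^{(n)}\rangle$.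 Let $\mathcal E^1_{\min}(\mathcal N'_{\mathbb C})$ be the space of functions $F:\mathcal N'_{\mathbb C}\to\mathbb C$ such that, for all $p,l\in\mathbb N$, $F$ is entire on $\mathcal H_{-p,\mathbb C}$ and $\sup_{z\in\mathcal H_{-p,\mathbb C}}|F(z)|\exp(-2^{-l}|z|_{-p})<\infty$. Call $(p_0,q_0)\in\mathbb N^2$ admissible if $\int\exp(2^{-q_0}|x|_{-p_0})\,d\mu(x)<\infty$ and $\inf\{|l_\mu(\theta)| : \theta\in\mathcal N_{\mathbb C},\ 2^{q_0}|\theta|_{p_0}<1\}>0$. **Proposition.** 1. The functionals $P_n^\mu(z)$ exist and are unique, for all $n$ and all $z\in\mathcal N'_{\mathbb C}$. 2. For every $\varphi\in(\mathcal N)^1_\mu$ there is exactly one $F\in\mathcal E^1_{\min}(\mathcal N'_{\mathbb C})$ that extends $\varphi$, i.e. such that for every $x\in\mathcal N'$ the series $\sum_n\langle P_n^\mu(x),\varphi^{(n)}\rangle$ converges to $F(x)$. 3. This $F$ is entire on $\mathcal N'_{\mathbb C}$ (with the inductive limit topology). For every $z\in\mathcal N'_{\mathbb C}$ the series $\sum_n\langle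 P_n^\mu(z),\varphi^{(n)}\rangle$ converges absolutely, with sum $F(z)$, and the convergence is uniform on every ball $\{|z|_{-p}\le R\}$ of every $\mathcal H_{-p,\mathbb C}$. Moreover $F|_{\mathcal N'}\in L^2(\mu)$, and the series converges to $F|_{\mathcal N'}$ in $L^2(\mu)$. 4. Admissible pairs exist. Let $(p_0,q_0)$ be admissible, let $p>p_0$ be such that the Hilbert–Schmidt norm $\|i_{p,p_0}\|_{HS}$ of $i_{p,p_0}:\mathcal H_p\hookrightarrow\mathcal H_{p_0}$ is finite, and let $\varepsilon>0$ with $\varepsilon\,e\,\|i_{p,p_0}\|_{HS}\le2^{-q_0}$. Then there is a constant $C_{p,\varepsilon}>0$ such that for all $q\in\mathbb N$ with $2^q>\varepsilon^{-2}$, all $\varphi\in(\mathcal N)^1_\mu$ with extension $F$, and all $z\in\mathcal H_{-p,\mathbb C}$, $$|F(z)|\le C_{p,\varepsilon}\,(1-2^{-q}\varepsilon^{-2})^{-1/2}\,\|\varphi\|_{p,q,\mu}\,e^{\varepsilon|z|_{-p}} .$$ -/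

import Mathlib

open MeasureTheory Filter Topology
open scoped ENNReal

noncomputable section

/-! ## Complexification of a real vector space -/

/-- The complexification `V_ℂ` of a real vector space; `(ξ, η)` stands for `ξ + i η`. -/
def Cx (V : Type*) : Type _ := V × V

namespace Cx

variable {V : Type*}

@[ext]
theorem ext {θ ζ : Cx V} (h₁ : θ.1 = ζ.1) (h₂ : θ.2 = ζ.2) : θ = ζ := Prod.ext h₁ h₂

instance [AddCommGroup V] : AddCommGroup (Cx V) := inferInstanceAs (AddCommGroup (V × V))

instance [AddCommGroup V] [Module ℝ V] : SMul ℂ (Cx V) :=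
  ⟨fun c θ => (c.re • θ.1 - c.im • θ.2, c.re • θ.2 + c.im • θ.1)⟩

@[simp] theorem add_fst [AddCommGroup V] (θ ζ : Cx V) : (θ + ζ).1 = θ.1 + ζ.1 := rfl
@[simp] theorem add_snd [AddCommGroup V] (θ ζ : Cx V) : (θ + ζ).2 = θ.2 + ζ.2 := rfl
@[simp] theorem zero_fst [AddCommGroup V] : (0 : Cx V).1 = 0 := rfl
@[simp] theorem zero_snd [AddCommGroup V] : (0 : Cx V).2 = 0 := rfl
@[simp] theorem smul_fst [AddCommGroup V] [Module ℝ V] (c : ℂ) (θ : Cx V) :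
    (c • θ).1 = c.re • θ.1 - c.im • θ.2 := rfl
@[simp] theorem smul_snd [AddCommGroup V] [Module ℝ V] (c : ℂ) (θ : Cx V) :
    (c • θ).2 = c.re • θ.2 + c.im • θ.1 := rfl

instance [AddCommGroup V] [Module ℝ V] : Module ℂ (Cx V) where
  one_smul θ := by ext <;> simp
  mul_smul a b θ := by ext <;> simp <;> module
  smul_zero a := by ext <;> simp
  smul_add a θ ζ := by ext <;> simp <;> module
  add_smul a b θ := by ext <;> simp <;> module
  zero_smul θ := by ext <;> simp

end Cx

/-! ## Nuclear triples -/

/-- A nuclear triple `N ⊂ H ⊂ N'` with a representing family of Hilbertian norms: `N` is a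
nuclear Fréchet space, embedded densely and continuously in the Hilbert space `H`, and its topology
is given by the Hilbertian norms `|ξ|_p = √(ip p ξ ξ)`, `p ∈ ℕ`.  The Hilbert space `H_p` of the
usual description is the completion of `N` with respect to `|·|_p`. -/
structure NuclearTriple (H N : Type*) [NormedAddCommGroup H] [InnerProductSpace ℝ H]
    [AddCommGroup N] [Module ℝ N] [TopologicalSpace N] [IsTopologicalAddGroup N] where
  /-- the embedding of `N` in `H` -/
  incl : N →L[ℝ] H
  incl_injective : Function.Injective incl
  incl_denseRange : DenseRange incl
  /-- the inner product of `H_p`, restricted to `N` -/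
  ip : ℕ → N →ₗ[ℝ] N →ₗ[ℝ] ℝ
  ip_symm : ∀ p ξ η, ip p ξ η = ip p η ξ
  /-- `|ξ| ≤ |ξ|_p` -/
  norm_incl_le : ∀ p ξ, ‖incl ξ‖ ≤ √(ip p ξ ξ)
  /-- `ip p` is positive; it is definite by `norm_incl_le` and `incl_injective` -/
  ip_nonneg : ∀ p ξ, 0 ≤ ip p ξ ξ
  /-- the norms are ordered -/
  ip_mono : ∀ p q, p ≤ q → ∀ ξ, ip p ξ ξ ≤ ip q ξ ξ
  /-- the norms define the topology of `N` -/
  nhds_basis : (𝓝 (0 : N)).HasBasis (fun r : ℕ × ℝ => 0 < r.2)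
    (fun r => {ξ : N | √(ip r.1 ξ ξ) < r.2})
  /-- `N` is complete, i.e. it is the intersection of the spaces `H_p` -/
  complete : ∀ u : ℕ → N,
    (∀ p, ∀ ε > 0, ∃ M, ∀ m ≥ M, ∀ n ≥ M, √(ip p (u m - u n) (u m - u n)) < ε) →
      ∃ ξ, Tendsto u atTop (𝓝 ξ)
  /-- the canonical map from `H_p` to `H` is injective -/
  compatible : ∀ p, ∀ u : ℕ → N,
    (∀ ε > 0, ∃ M, ∀ m ≥ M, ∀ n ≥ M, √(ip p (u m - u n) (u m - u n)) < ε) →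
      Tendsto (fun n => incl (u n)) atTop (𝓝 0) →
        Tendsto (fun n => √(ip p (u n) (u n))) atTop (𝓝 0)
  /-- for all `p₁`, `p₂` there is `p` such that the embeddings of `H_p` in `H_{p₁}` and in `H_{p₂}`
  are Hilbert-Schmidt (the squared Hilbert-Schmidt norm is the supremum, over finite orthonormal
  systems of `H_p`, of the sums of the squared norms; the systems may be taken in the dense
  subspace `N`) -/
  nuclear : ∀ p₁ p₂, ∃ p, ∃ C : ℝ, ∀ (m : ℕ) (e : Fin m → N),
    (∀ i j, ip p (e i) (e j) = if i = j then 1 else 0) →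
      ∑ i, ip p₁ (e i) (e i) ≤ C ∧ ∑ i, ip p₂ (e i) (e i) ≤ C

namespace NuclearTriple

variable {H N : Type*} [NormedAddCommGroup H] [InnerProductSpace ℝ H]
  [AddCommGroup N] [Module ℝ N] [TopologicalSpace N] [IsTopologicalAddGroup N]

/-- The Hilbertian norm `|θ|_p` on the complexification `N_ℂ`. -/
def cnrm (T : NuclearTriple H N) (p : ℕ) (θ : Cx N) : ℝ :=
  √(T.ip p θ.1 θ.1 + T.ip p θ.2 θ.2)

/-- Finite orthonormal systems of `H_p` consisting of elements of `N`. -/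
def Orthon (T : NuclearTriple H N) (p : ℕ) {m : ℕ} (e : Fin m → N) : Prop :=
  ∀ i j, T.ip p (e i) (e j) = if i = j then 1 else 0

/-- The squared Hilbert-Schmidt norm of the embedding `i_{p,p₀}` of `H_p` in `H_{p₀}`. -/
def hsInclSq (T : NuclearTriple H N) (p p₀ : ℕ) : ℝ≥0∞ :=
  ⨆ (m : ℕ) (e : Fin m → N) (_ : T.Orthon p e), ENNReal.ofReal (∑ i, T.ip p₀ (e i) (e i))

/-- The Hilbert-Schmidt norm of `i_{p,p₀}` (used only where `hsInclSq` is finite). -/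
def hsIncl (T : NuclearTriple H N) (p p₀ : ℕ) : ℝ := √((T.hsInclSq p p₀).toReal)

/-! ## The dual space `N'`, its complexification, and the spaces `H_{-p}` -/

/-- The pairing `⟨z, θ⟩` of `z ∈ N'_ℂ` and `θ ∈ N_ℂ`.  The complexified dual `N'_ℂ` is realised as
the space of continuous real-linear maps from `N` to `ℂ`, i.e. `z = x + i y` with `x, y ∈ N'`. -/
def pair (z : N →L[ℝ] ℂ) (θ : Cx N) : ℂ := z θ.1 + Complex.I * z θ.2

/-- The inclusion of the real dual `N'` in `N'_ℂ`. -/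
def ofRealDual (x : N →L[ℝ] ℝ) : N →L[ℝ] ℂ := Complex.ofRealCLM.comp x

/-- The norm `|z|_{-p}` of the dual `H_{-p,ℂ}` of `H_{p,ℂ}`; it is `∞` if `z ∉ H_{-p,ℂ}`. -/
def dualNorm (T : NuclearTriple H N) (p : ℕ) (z : N →L[ℝ] ℂ) : ℝ≥0∞ :=
  ⨆ (θ : Cx N) (_ : T.cnrm p θ ≤ 1), ‖pair z θ‖ₑ

/-- The space `H_{-p,ℂ}` as a subset of `N'_ℂ`. -/
def Hneg (T : NuclearTriple H N) (p : ℕ) : Set (N →L[ℝ] ℂ) := {z | T.dualNorm p z < ∞}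

theorem abs_ip_le (T : NuclearTriple H N) (p : ℕ) (ξ η : N) :
    |T.ip p ξ η| ≤ √(T.ip p ξ ξ) * √(T.ip p η η) := by
  have key : T.ip p ξ η ^ 2 ≤ T.ip p ξ ξ * T.ip p η η := by
    have h : ∀ t : ℝ, 0 ≤ T.ip p η η * (t * t) + (2 * T.ip p ξ η) * t + T.ip p ξ ξ := by
      intro t
      have := T.ip_nonneg p (ξ + t • η)
      simp only [map_add, map_smul, LinearMap.add_apply, LinearMap.smul_apply, smul_eq_mul,
        T.ip_symm p η ξ] at this
      linarith
    have := discrim_le_zero h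
    unfold discrim at this
    linarith
  rw [← Real.sqrt_mul (T.ip_nonneg p ξ)]
  exact Real.abs_le_sqrt key

/-- The element `(ξ, ·)_p` of `H_{-p}` that corresponds to `ξ ∈ N ⊂ H_p` by Riesz' theorem. -/
def riesz (T : NuclearTriple H N) (p : ℕ) (ξ : N) : N →L[ℝ] ℂ :=
  Complex.ofRealCLM.comp
    { toLinearMap := T.ip p ξ
      cont := by
        refine continuous_of_continuousAt_zero (T.ip p ξ) ?_
        rw [ContinuousAt, map_zero, Metric.tendsto_nhds]
        intro ε hε
        have hpos : 0 < √(T.ip p ξ ξ) + 1 := by positivity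
        filter_upwards [T.nhds_basis.mem_of_mem (i := (p, ε / (√(T.ip p ξ ξ) + 1)))
          (by positivity)] with η hη
        rw [Real.dist_eq, sub_zero]
        have h1 := T.abs_ip_le p ξ η
        have h2 : √(T.ip p η η) < ε / (√(T.ip p ξ ξ) + 1) := hη
        rw [lt_div_iff₀ hpos] at h2
        nlinarith [Real.sqrt_nonneg (T.ip p η η), Real.sqrt_nonneg (T.ip p ξ ξ)] }

theorem riesz_apply (T : NuclearTriple H N) (p : ℕ) (ξ η : N) :
    T.riesz p ξ η = (T.ip p ξ η : ℂ) := rfl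

/-! ## Symmetric tensor powers -/

/-- The squared norm `|φ|_p²` on the Hilbert tensor power of `H_{p,ℂ}`.  The `n`-th Hilbert tensor
power is realised as the space of bounded `n`-linear forms on the dual `H_{-p,ℂ}` with finite
Hilbert-Schmidt norm, a tensor `θ₁ ⊗ ⋯ ⊗ θₙ` being the form `(z₁, …, zₙ) ↦ ∏ ⟨zᵢ, θᵢ⟩`.
The squared norm is the supremum of `∑ |φ(v_{k₁}, …, v_{kₙ})|²` over finite orthonormal systems `v`
of `H_{-p}`; it is enough to use the systems `(e_i, ·)_p` with `e` orthonormal in `H_p` and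
contained in the dense subspace `N`. -/
def hsSq (T : NuclearTriple H N) (p : ℕ) {n : ℕ}
    (φ : MultilinearMap ℂ (fun _ : Fin n => N →L[ℝ] ℂ) ℂ) : ℝ≥0∞ :=
  ⨆ (m : ℕ) (e : Fin m → N) (_ : T.Orthon p e),
    ∑ k : Fin n → Fin m, ‖φ (fun i => T.riesz p (e (k i)))‖ₑ ^ 2

/-- `φ` belongs, for every `p`, to the symmetric Hilbert tensor power of `H_{p,ℂ}`: it is symmetric,
and for all `p` its restriction to `H_{-p,ℂ}` is bounded with finite Hilbert-Schmidt norm. -/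
structure IsKernel (T : NuclearTriple H N) {n : ℕ}
    (φ : MultilinearMap ℂ (fun _ : Fin n => N →L[ℝ] ℂ) ℂ) : Prop where
  symm : ∀ (σ : Equiv.Perm (Fin n)) (z : Fin n → (N →L[ℝ] ℂ)), φ (fun i => z (σ i)) = φ z
  bounded : ∀ p, ∃ C : ℝ, ∀ z : Fin n → (N →L[ℝ] ℂ), (∀ i, z i ∈ T.Hneg p) →
    ‖φ z‖ ≤ C * ∏ i, (T.dualNorm p (z i)).toReal
  hs : ∀ p, T.hsSq p φ < ∞

theorem IsKernel.zero (T : NuclearTriple H N) (n : ℕ) :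
    T.IsKernel (0 : MultilinearMap ℂ (fun _ : Fin n => N →L[ℝ] ℂ) ℂ) where
  symm _ _ := rfl
  bounded _ := ⟨0, fun _ _ => by simp⟩
  hs p := by simp [hsSq]

theorem IsKernel.smul {T : NuclearTriple H N} {n : ℕ} (c : ℂ)
    {φ : MultilinearMap ℂ (fun _ : Fin n => N →L[ℝ] ℂ) ℂ} (h : T.IsKernel φ) :
    T.IsKernel (c • φ) where
  symm σ z := by simp [h.symm σ z]
  bounded p := by
    obtain ⟨C, hC⟩ := h.bounded p
    refine ⟨‖c‖ * C, fun z hz => ?_⟩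
    rw [smul_apply, norm_smul, mul_assoc]
    exact mul_le_mul_of_nonneg_left (hC z hz) (norm_nonneg c)
  hs p := by
    refine lt_of_le_of_lt (b := ‖c‖ₑ ^ 2 * T.hsSq p φ) ?_
      (ENNReal.mul_lt_top (ENNReal.pow_lt_top enorm_lt_top) (h.hs p))
    refine iSup_le fun m => iSup_le fun e => iSup_le fun he => ?_
    simp only [smul_apply, enorm_smul, mul_pow, ← Finset.mul_sum]
    gcongr
    exact le_iSup_of_le m (le_iSup_of_le e (le_iSup_of_le he le_rfl))

theorem IsKernel.add {T : NuclearTriple H N} {n : ℕ}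
    {φ ψ : MultilinearMap ℂ (fun _ : Fin n => N →L[ℝ] ℂ) ℂ} (h : T.IsKernel φ)
    (h' : T.IsKernel ψ) : T.IsKernel (φ + ψ) where
  symm σ z := by simp [h.symm σ z, h'.symm σ z]
  bounded p := by
    obtain ⟨C, hC⟩ := h.bounded p
    obtain ⟨C', hC'⟩ := h'.bounded p
    refine ⟨C + C', fun z hz => ?_⟩
    rw [add_apply, add_mul]
    exact (norm_add_le _ _).trans (add_le_add (hC z hz) (hC' z hz))
  hs p := by
    refine lt_of_le_of_lt (b := 2 * T.hsSq p φ + 2 * T.hsSq p ψ) ?_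
      (ENNReal.add_lt_top.2 ⟨ENNReal.mul_lt_top (by simp) (h.hs p),
        ENNReal.mul_lt_top (by simp) (h'.hs p)⟩)
    refine iSup_le fun m => iSup_le fun e => iSup_le fun he => ?_
    have hk : ∀ k : Fin n → Fin m, ‖(φ + ψ) (fun i => T.riesz p (e (k i)))‖ₑ ^ 2 ≤
        2 * ‖φ (fun i => T.riesz p (e (k i)))‖ₑ ^ 2 +
          2 * ‖ψ (fun i => T.riesz p (e (k i)))‖ₑ ^ 2 := by
      intro k
      rw [add_apply]
      generalize φ _ = a
      generalize ψ _ = b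
      rw [← ofReal_norm, ← ofReal_norm, ← ofReal_norm,
        ← ENNReal.ofReal_pow (norm_nonneg _), ← ENNReal.ofReal_pow (norm_nonneg _),
        ← ENNReal.ofReal_pow (norm_nonneg _)]
      rw [show (2 : ℝ≥0∞) = ENNReal.ofReal 2 by simp,
        ← ENNReal.ofReal_mul (by norm_num), ← ENNReal.ofReal_mul (by norm_num),
        ← ENNReal.ofReal_add (by positivity) (by positivity)]
      apply ENNReal.ofReal_le_ofReal
      have := norm_add_le a b
      nlinarith [sq_nonneg (‖a‖ - ‖b‖), norm_nonneg (a + b), norm_nonneg a, norm_nonneg b]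
    refine (Finset.sum_le_sum fun k _ => hk k).trans ?_
    rw [Finset.sum_add_distrib, ← Finset.mul_sum, ← Finset.mul_sum]
    gcongr
    · exact le_iSup_of_le m (le_iSup_of_le e (le_iSup_of_le he le_rfl))
    · exact le_iSup_of_le m (le_iSup_of_le e (le_iSup_of_le he le_rfl))

/-- The `n`-th symmetric tensor power of `N_ℂ`, the projective limit over `p` of the symmetric
Hilbert tensor powers of `H_{p,ℂ}`. -/
def SymPow (T : NuclearTriple H N) (n : ℕ) :
    Submodule ℂ (MultilinearMap ℂ (fun _ : Fin n => N →L[ℝ] ℂ) ℂ) where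
  carrier := {φ | T.IsKernel φ}
  zero_mem' := IsKernel.zero T n
  add_mem' h h' := h.add h'
  smul_mem' c _ h := h.smul c

/-- The norm `|φ|_p` on the symmetric tensor power. -/
def kerNorm (T : NuclearTriple H N) (p : ℕ) {n : ℕ} (φ : T.SymPow n) : ℝ :=
  √((T.hsSq p (φ : MultilinearMap ℂ (fun _ : Fin n => N →L[ℝ] ℂ) ℂ)).toReal)

/-- `z ↦ ⟨z, θ⟩` as a complex linear form on `N'_ℂ`. -/
def pairL (θ : Cx N) : (N →L[ℝ] ℂ) →ₗ[ℂ] ℂ where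
  toFun z := pair z θ
  map_add' z w := by simp [pair]; ring
  map_smul' c z := by simp [pair]; ring

/-- The form `(z₁, …, zₙ) ↦ ∏ ⟨zᵢ, θ⟩` that represents `θ^{⊗ n}`. -/
def tensorPow (n : ℕ) (θ : Cx N) : MultilinearMap ℂ (fun _ : Fin n => N →L[ℝ] ℂ) ℂ :=
  (MultilinearMap.mkPiAlgebra ℂ (Fin n) ℂ).compLinearMap (fun _ => pairL θ)

theorem tensorPow_apply (n : ℕ) (θ : Cx N) (z : Fin n → (N →L[ℝ] ℂ)) :
    tensorPow n θ z = ∏ i, pair (z i) θ := rfl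

theorem cnrm_nonneg (T : NuclearTriple H N) (p : ℕ) (θ : Cx N) : 0 ≤ T.cnrm p θ :=
  Real.sqrt_nonneg _

theorem cnrm_smul (T : NuclearTriple H N) (p : ℕ) (c : ℝ) (θ : Cx N) :
    T.cnrm p ((c : ℂ) • θ) = |c| * T.cnrm p θ := by
  unfold cnrm
  rw [← Real.sqrt_sq_eq_abs, ← Real.sqrt_mul (sq_nonneg c)]
  congr 1
  simp only [Cx.smul_fst, Cx.smul_snd, Complex.ofReal_re, Complex.ofReal_im, zero_smul, sub_zero,
    add_zero, map_smul, LinearMap.smul_apply, smul_eq_mul]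
  ring

theorem pair_smul (z : N →L[ℝ] ℂ) (c : ℂ) (θ : Cx N) : pair z (c • θ) = c * pair z θ := by
  simp only [pair, Cx.smul_fst, Cx.smul_snd, map_sub, map_add, map_smul, Complex.real_smul]
  conv_rhs => rw [← Complex.re_add_im c]
  linear_combination (-(c.im : ℂ) * z θ.2) * Complex.I_mul_I

theorem norm_pair_le (T : NuclearTriple H N) (p : ℕ) {z : N →L[ℝ] ℂ} (hz : z ∈ T.Hneg p)
    (θ : Cx N) : ‖pair z θ‖ ≤ (T.cnrm p θ + 1) * (T.dualNorm p z).toReal := by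
  have hpos : 0 < T.cnrm p θ + 1 := by linarith [T.cnrm_nonneg p θ]
  set c : ℝ := (T.cnrm p θ + 1)⁻¹ with hc
  have hcpos : 0 < c := inv_pos.2 hpos
  have h1 : T.cnrm p ((c : ℂ) • θ) ≤ 1 := by
    rw [cnrm_smul, abs_of_pos hcpos, hc, inv_mul_le_iff₀ hpos]
    linarith
  have h2 : ‖pair z ((c : ℂ) • θ)‖ₑ ≤ T.dualNorm p z :=
    le_iSup_of_le ((c : ℂ) • θ) (le_iSup_of_le h1 le_rfl)
  have h3 : ‖pair z ((c : ℂ) • θ)‖ ≤ (T.dualNorm p z).toReal := by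
    rw [← toReal_enorm]
    exact ENNReal.toReal_mono (ne_of_lt hz) h2
  rw [pair_smul, norm_mul, Complex.norm_real, Real.norm_eq_abs, abs_of_pos hcpos, hc,
    inv_mul_le_iff₀ hpos] at h3
  exact h3

theorem bessel (T : NuclearTriple H N) (p : ℕ) {m : ℕ} {e : Fin m → N} (he : T.Orthon p e)
    (ξ : N) : ∑ i, T.ip p (e i) ξ ^ 2 ≤ T.ip p ξ ξ := by
  have h := T.ip_nonneg p (ξ - ∑ i, T.ip p (e i) ξ • e i)
  simp only [map_sub, LinearMap.sub_apply, map_sum, LinearMap.sum_apply, map_smul,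
    LinearMap.smul_apply, smul_eq_mul, he _ _, T.ip_symm p ξ (e _)] at h
  simp only [mul_ite, mul_one, mul_zero, Finset.sum_ite_eq',
    Finset.mem_univ, if_true, sub_self, Finset.sum_const_zero, ← pow_two] at h
  linarith

theorem tensorPow_mem (T : NuclearTriple H N) (n : ℕ) (θ : Cx N) :
    tensorPow n θ ∈ T.SymPow n where
  symm σ z := by
    simp only [tensorPow_apply]
    exact Equiv.prod_comp σ (fun i => pair (z i) θ)
  bounded p := by
    refine ⟨(T.cnrm p θ + 1) ^ n, fun z hz => ?_⟩
    rw [tensorPow_apply, norm_prod]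
    calc ∏ i, ‖pair (z i) θ‖
        ≤ ∏ i, ((T.cnrm p θ + 1) * (T.dualNorm p (z i)).toReal) :=
          Finset.prod_le_prod (fun _ _ => norm_nonneg _) fun i _ => T.norm_pair_le p (hz i) θ
      _ = _ := by simp [Finset.prod_mul_distrib]
  hs p := by
    refine lt_of_le_of_lt (b := ENNReal.ofReal ((T.ip p θ.1 θ.1 + T.ip p θ.2 θ.2) ^ n)) ?_
      ENNReal.ofReal_lt_top
    refine iSup_le fun m => iSup_le fun e => iSup_le fun he => ?_
    have hn : ∀ i, ‖pair (T.riesz p (e i)) θ‖ ^ 2 =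
        T.ip p (e i) θ.1 ^ 2 + T.ip p (e i) θ.2 ^ 2 := by
      intro i
      rw [pair, riesz_apply, riesz_apply, ← Complex.normSq_eq_norm_sq, mul_comm Complex.I,
        Complex.normSq_add_mul_I]
    have hs : ∑ i, ‖pair (T.riesz p (e i)) θ‖ ^ 2 ≤ T.ip p θ.1 θ.1 + T.ip p θ.2 θ.2 := by
      simp only [hn, Finset.sum_add_distrib]
      exact add_le_add (T.bessel p he _) (T.bessel p he _)
    have hsum : ∑ k : Fin n → Fin m, ‖tensorPow n θ (fun i => T.riesz p (e (k i)))‖ₑ ^ 2 =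
        ENNReal.ofReal ((∑ i, ‖pair (T.riesz p (e i)) θ‖ ^ 2) ^ n) := by
      rw [Finset.sum_pow', ENNReal.ofReal_sum_of_nonneg fun _ _ => by positivity]
      rw [Fintype.piFinset_univ]
      refine Finset.sum_congr rfl fun k _ => ?_
      rw [← ofReal_norm, ← ENNReal.ofReal_pow (norm_nonneg _), tensorPow_apply,
        norm_prod, Finset.prod_pow]
    rw [hsum]
    exact ENNReal.ofReal_le_ofReal
      (pow_le_pow_left₀ (Finset.sum_nonneg fun _ _ => by positivity) hs n)

/-- The tensor power `θ^{⊗ n}` as an element of the symmetric tensor power of `N_ℂ`. -/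
def symTensor (T : NuclearTriple H N) (n : ℕ) (θ : Cx N) : T.SymPow n :=
  ⟨tensorPow n θ, T.tensorPow_mem n θ⟩

/-! ## Analytic measures and Appell polynomials -/

/-- The σ-algebra on `N'` generated by the cylinder sets. -/
@[reducible]
def cylinder (N : Type*) [AddCommGroup N] [Module ℝ N] [TopologicalSpace N] :
    MeasurableSpace (N →L[ℝ] ℝ) :=
  ⨆ ξ : N, MeasurableSpace.comap (fun x : N →L[ℝ] ℝ => x ξ) (borel ℝ)

/-- Measures on `N'` with its cylinder σ-algebra. -/
abbrev DualMeasure (N : Type*) [AddCommGroup N] [Module ℝ N] [TopologicalSpace N] :=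
  @Measure (N →L[ℝ] ℝ) (cylinder N)

/-- The Laplace transform `l_μ(θ) = ∫ exp ⟨x, θ⟩ dμ(x)`. -/
def laplace (μ : DualMeasure N) (θ : Cx N) : ℂ :=
  ∫ x, Complex.exp (pair (ofRealDual x) θ) ∂μ

/-- `μ` is analytic: its Laplace transform exists and is holomorphic on a
neighbourhood of zero of `N_ℂ` (holomorphic means: analytic along complex lines and locally
bounded). -/
def IsAnalytic (T : NuclearTriple H N) (μ : DualMeasure N) : Prop :=
  ∃ (p : ℕ) (r : ℝ), 0 < r ∧ ∀ θ : Cx N, T.cnrm p θ < r →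
    Integrable (fun x => Complex.exp (pair (ofRealDual x) θ)) μ ∧
    (∀ ζ : Cx N, AnalyticAt ℂ (fun t : ℂ => laplace μ (θ + t • ζ)) 0) ∧
    ∃ (p' : ℕ) (δ C : ℝ), 0 < δ ∧ ∀ ζ : Cx N, T.cnrm p' ζ < δ → ‖laplace μ (θ + ζ)‖ ≤ C

/-- The normalized exponential `e_μ(θ; z) = exp ⟨z, θ⟩ / l_μ(θ)`. -/
def muExp (μ : DualMeasure N) (θ : Cx N) (z : N →L[ℝ] ℂ) : ℂ :=
  Complex.exp (pair z θ) / laplace μ θ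

/-- `L` is the Appell kernel `P_n^μ(z)`, an element of the dual of the symmetric tensor power of
`N_ℂ`: it is continuous, and `⟨L, θ^{⊗ n}⟩` is the `n`-th derivative of `e_μ(·; z)` at zero in
direction `θ`, i.e. `e_μ(θ; z) = ∑ ⟨P_n^μ(z), θ^{⊗ n}⟩ / n!`. -/
def IsAppell (T : NuclearTriple H N) (μ : DualMeasure N) (n : ℕ) (z : N →L[ℝ] ℂ)
    (L : T.SymPow n →ₗ[ℂ] ℂ) : Prop :=
  (∃ (p : ℕ) (C : ℝ), ∀ φ, ‖L φ‖ ≤ C * T.kerNorm p φ) ∧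
  ∀ θ : Cx N, L (T.symTensor n θ) = iteratedDeriv n (fun t : ℂ => muExp μ (t • θ) z) 0

open Classical in
/-- The Appell kernel `P_n^μ(z)`; its existence and uniqueness are part of the theorem. -/
def appell (T : NuclearTriple H N) (μ : DualMeasure N) (n : ℕ) (z : N →L[ℝ] ℂ) :
    T.SymPow n →ₗ[ℂ] ℂ :=
  if h : ∃ L, T.IsAppell μ n z L then h.choose else 0

/-! ## Test functions -/

/-- The squared norm `‖φ‖²_{p,q,μ} = ∑ (n!)² 2^{nq} |φ^{(n)}|_p²` of `φ = ∑ ⟨P_n^μ, φ^{(n)}⟩`. -/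
def testNormSq (T : NuclearTriple H N) (p q : ℕ) (φ : ∀ n, T.SymPow n) : ℝ≥0∞ :=
  ∑' n, (n.factorial : ℝ≥0∞) ^ 2 * 2 ^ (n * q) * ENNReal.ofReal (T.kerNorm p (φ n) ^ 2)

/-- The norm `‖φ‖_{p,q,μ}`. -/
def testNorm (T : NuclearTriple H N) (p q : ℕ) (φ : ∀ n, T.SymPow n) : ℝ :=
  √((T.testNormSq p q φ).toReal)

/-- The test function space `(N)¹_μ`, the projective limit of the completions of the space of
polynomials `∑_{n ≤ M} ⟨P_n^μ, φ^{(n)}⟩` in the norms `‖·‖_{p,q,μ}`: its elements are the formal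
series `∑ ⟨P_n^μ, φ^{(n)}⟩` all of whose norms are finite, given by their coefficients. -/
def IsTest (T : NuclearTriple H N) (φ : ∀ n, T.SymPow n) : Prop :=
  ∀ p q, T.testNormSq p q φ < ∞

/-- `F` extends the test function `φ`, whose values on `N'` are given by the series
`∑ ⟨P_n^μ(x), φ^{(n)}⟩`, `x ∈ N'`. -/
def Extends (T : NuclearTriple H N) (μ : DualMeasure N) (φ : ∀ n, T.SymPow n)
    (F : (N →L[ℝ] ℂ) → ℂ) : Prop :=
  ∀ x : N →L[ℝ] ℝ,
    HasSum (fun n => T.appell μ n (ofRealDual x) (φ n)) (F (ofRealDual x))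

/-- The `M`-th partial sum of the series `∑ ⟨P_n^μ(z), φ^{(n)}⟩`. -/
def partialSum (T : NuclearTriple H N) (μ : DualMeasure N) (φ : ∀ n, T.SymPow n) (M : ℕ)
    (z : N →L[ℝ] ℂ) : ℂ :=
  ∑ n ∈ Finset.range M, T.appell μ n z (φ n)

/-! ## Entire functions of order one and minimal type -/

/-- `F` is entire on the Hilbert space `H_{-p,ℂ}`: entire along all complex lines and locally
bounded. -/
def EntireOnHneg (T : NuclearTriple H N) (p : ℕ) (F : (N →L[ℝ] ℂ) → ℂ) : Prop :=
  ∀ z ∈ T.Hneg p,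
    (∀ w ∈ T.Hneg p, Differentiable ℂ (fun t : ℂ => F (z + t • w))) ∧
    ∃ δ C : ℝ, 0 < δ ∧ ∀ w, T.dualNorm p w < ENNReal.ofReal δ → ‖F (z + w)‖ ≤ C

/-- The norm `n_{p,l,1}(F) = sup |F(z)| exp(-2^{-l} |z|_{-p})`, `z ∈ H_{-p,ℂ}`. -/
def growthNorm (T : NuclearTriple H N) (p l : ℕ) (F : (N →L[ℝ] ℂ) → ℂ) : ℝ≥0∞ :=
  ⨆ z ∈ T.Hneg p,
    ENNReal.ofReal (‖F z‖ * Real.exp (-((2 : ℝ) ^ l)⁻¹ * (T.dualNorm p z).toReal))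

/-- The space `E¹_min(N'_ℂ)`, the projective limit over `p`, `l` of the spaces of entire functions
on `H_{-p,ℂ}` of growth one and type `2^{-l}`. -/
def IsEmin (T : NuclearTriple H N) (F : (N →L[ℝ] ℂ) → ℂ) : Prop :=
  ∀ p l, T.EntireOnHneg p F ∧ T.growthNorm p l F < ∞

/-- `F` is entire on `N'_ℂ` with the inductive limit topology: entire along all complex lines and
locally bounded.  Neighbourhoods of zero of this locally convex topology contain an absolutely
convex set that contains a ball of every `H_{-p,ℂ}`. -/
def EntireOnDual (T : NuclearTriple H N) (F : (N →L[ℝ] ℂ) → ℂ) : Prop :=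
  ∀ z, (∀ w, Differentiable ℂ (fun t : ℂ => F (z + t • w))) ∧
    ∃ (W : Set (N →L[ℝ] ℂ)) (C : ℝ),
      (∀ u ∈ W, ∀ v ∈ W, ∀ a b : ℂ, ‖a‖ + ‖b‖ ≤ 1 → a • u + b • v ∈ W) ∧
      (∀ p, ∃ δ : ℝ, 0 < δ ∧ ∀ w, T.dualNorm p w < ENNReal.ofReal δ → w ∈ W) ∧
      ∀ w ∈ W, ‖F (z + w)‖ ≤ C

/-- `p₀`, `q₀` describe a neighbourhood `{θ | 2^{q₀} |θ|_{p₀} < 1}` of zero in `N_ℂ` on which `l_μ`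
exists and stays away from zero, so that `e_μ(θ; z)` is well defined there. -/
def IsAdmissible (T : NuclearTriple H N) (μ : DualMeasure N) (p₀ q₀ : ℕ) : Prop :=
  (∀ᵐ x ∂μ, ofRealDual x ∈ T.Hneg p₀) ∧
  Integrable (fun x => Real.exp (((2 : ℝ) ^ q₀)⁻¹ * (T.dualNorm p₀ (ofRealDual x)).toReal)) μ ∧
  ∃ c : ℝ, 0 < c ∧ ∀ θ : Cx N, 2 ^ q₀ * T.cnrm p₀ θ < 1 → c ≤ ‖laplace μ θ‖

end NuclearTriple

end

set_option linter.unusedSectionVars false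

noncomputable section

/-! ## Polarization -/

/-! Everything rests on one estimate for the Appell kernels. By Leibniz' rule the n-th derivative of
`t ↦ e_μ(tθ; z)` at zero is a binomial sum of products of powers of `⟨z, θ⟩` and derivatives of `1 /
l_μ`. The latter are homogeneous polynomials in θ, because `l_μ · (1 / l_μ) = 1` expresses them
recursively through the moments of μ. If c bounds `|l_μ|` from below on the admissible
neighbourhood, Cauchy's estimate bounds them by `n! c⁻¹ (2^{q₀} |θ|_{p₀})^n`. Polarization costs
`n^n / n! ≤ e^n`, and the embedding of `H_p` in `H_{p₀}` turns the supremum bound into a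
Hilbert-Schmidt bound at the cost of the n-th power of its Hilbert-Schmidt norm (`HSPoly.of_bound`).
If `ε e ‖i_{p,p₀}‖_HS ≤ 2^{-q₀}`, this gives `‖P_n^μ(z)‖ ≤ n! c⁻¹ ε^{-n} exp(ε |z|_{-p})`
(`IsAdmissible.hsPoly_appellPoly`).

Hilbert-Schmidt bounds are tested on finite orthonormal systems; a compactness argument builds the
functional from them (`HSPoly.exists_functional`), and density of the tensor powers makes it unique
(`exists_span_kerNorm_sub_le`).

Cauchy-Schwarz against the weights `(n!)² 2^{nq}` makes the Appell series converge with the stated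
constant (`IsTest.sum_le`). Given any p, a further embedding allows ε so small that the growth in
`|z|_{-p}` has arbitrarily small type; this yields minimal type, uniform convergence on balls and
convergence in `L²(μ)`. The extension is unique by the identity theorem along the lines `x + t y`,
and it is entire on the inductive limit because it is uniformly continuous on bounded sets of each
`H_{-p}` (`IsEmin.entireOnDual`).

Admissible pairs come from an argument in the style of Minlos' theorem: local boundedness of `l_μ`
bounds the integrals of `cosh ⟨x, ξ⟩`, Jensen's inequality and a Hilbert-Schmidt embedding bound the
integrals of `cosh (ε |x|)` over finite-dimensional restrictions independently of the dimension, and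
monotone convergence finishes (`IsAnalytic.exists_integrable_exp_norm`). -/

theorem sum_sign_prod_of_surjective {n : ℕ} (r : Fin n → Fin n) (hr : Function.Surjective r) :
    ∑ ε : Fin n → ℤˣ, (∏ i, ((ε i : ℤ) : ℂ)) * ∏ j, ((ε (r j) : ℤ) : ℂ) = 2 ^ n := by
  have hb : Function.Bijective r := Finite.surjective_iff_bijective.1 hr
  have h : ∀ ε : Fin n → ℤˣ, (∏ i, ((ε i : ℤ) : ℂ)) * ∏ j, ((ε (r j) : ℤ) : ℂ) = 1 := by
    intro ε
    rw [hb.prod_comp (fun i => ((ε i : ℤ) : ℂ)), ← Finset.prod_mul_distrib]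
    refine Finset.prod_eq_one fun i _ => ?_
    rcases Int.units_eq_one_or (ε i) with h | h <;> simp [h]
  simp [h]

/-- Flipping the sign at an index missed by `r` changes the first product only by a factor `-1` and
leaves the second alone, so the terms cancel in pairs. -/
theorem sum_sign_prod_of_not_surjective {n : ℕ} (r : Fin n → Fin n)
    (hr : ¬ Function.Surjective r) :
    ∑ ε : Fin n → ℤˣ, (∏ i, ((ε i : ℤ) : ℂ)) * ∏ j, ((ε (r j) : ℤ) : ℂ) = 0 := by
  classical
  simp only [Function.Surjective, not_forall, not_exists] at hr
  obtain ⟨i₀, hi₀⟩ := hr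
  refine Finset.sum_involution (fun ε _ => Function.update ε i₀ (-ε i₀)) ?_ ?_ ?_ ?_
  · intro ε _
    have h1 : ∀ j, Function.update ε i₀ (-ε i₀) (r j) = ε (r j) := fun j =>
      Function.update_of_ne (hi₀ j) _ _
    simp only [h1, ← add_mul]
    rw [← Finset.mul_prod_erase _ _ (Finset.mem_univ i₀),
      ← Finset.mul_prod_erase _ (fun i => ((Function.update ε i₀ (-ε i₀) i : ℤ) : ℂ))
        (Finset.mem_univ i₀)]
    have h2 : ∏ i ∈ Finset.univ.erase i₀, ((Function.update ε i₀ (-ε i₀) i : ℤ) : ℂ) =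
        ∏ i ∈ Finset.univ.erase i₀, ((ε i : ℤ) : ℂ) := by
      refine Finset.prod_congr rfl fun i hi => ?_
      rw [Function.update_of_ne (Finset.ne_of_mem_erase hi)]
    rw [h2]
    simp
  · intro ε _ _ h
    have := congrFun h i₀
    simp only [Function.update_self] at this
    rcases Int.units_eq_one_or (ε i₀) with h | h <;> simp [h] at this
  · intro ε _; simp
  · intro ε _; simp

/-- The polarization identity. -/
theorem MultilinearMap.polarization {V : Type*} [AddCommGroup V] [Module ℂ V] {n : ℕ}
    (f : MultilinearMap ℂ (fun _ : Fin n => V) ℂ) (x : Fin n → V) :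
    ∑ ε : Fin n → ℤˣ, (∏ i, ((ε i : ℤ) : ℂ)) * f (fun _ => ∑ i, ((ε i : ℤ) : ℂ) • x i) =
      2 ^ n * ∑ σ : Equiv.Perm (Fin n), f (fun i => x (σ i)) := by
  classical
  have h1 : ∀ ε : Fin n → ℤˣ, f (fun _ => ∑ i, ((ε i : ℤ) : ℂ) • x i) =
      ∑ r : Fin n → Fin n, (∏ j, ((ε (r j) : ℤ) : ℂ)) * f (fun j => x (r j)) := by
    intro ε
    rw [f.map_sum (fun _ i => ((ε i : ℤ) : ℂ) • x i)]
    refine Finset.sum_congr rfl fun r _ => ?_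
    rw [f.map_smul_univ, smul_eq_mul]
  simp only [h1, Finset.mul_sum]
  rw [Finset.sum_comm]
  simp only [← mul_assoc, ← Finset.sum_mul]
  -- Averaging over signs kills every index map except the permutations.
  have h2 : ∀ r : Fin n → Fin n,
      (∑ ε : Fin n → ℤˣ, (∏ i, ((ε i : ℤ) : ℂ)) * ∏ j, ((ε (r j) : ℤ) : ℂ)) * f (fun j => x (r j))
        = if Function.Bijective r then 2 ^ n * f (fun j => x (r j)) else 0 := by
    intro r
    split_ifs with h
    · rw [sum_sign_prod_of_surjective r h.2]
    · rw [sum_sign_prod_of_not_surjective r fun h' => h (Finite.surjective_iff_bijective.1 h'),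
        zero_mul]
  simp only [h2]
  rw [← Finset.sum_filter]
  symm
  refine Finset.sum_bij (fun σ _ => ⇑σ) ?_ ?_ ?_ ?_
  · intro σ _; exact Finset.mem_filter.2 ⟨Finset.mem_univ _, σ.bijective⟩
  · intro σ _ τ _ h; exact DFunLike.coe_injective h
  · intro r hr
    exact ⟨Equiv.ofBijective r (Finset.mem_filter.1 hr).2, Finset.mem_univ _, rfl⟩
  · intro σ _; rfl

/-! ## Orthonormal systems -/

/-- The form makes `E` an inner product space, and the span of a finite set has a standard
orthonormal basis; no completion is needed. -/
theorem exists_orthonormal_of_posDef {E : Type*} [AddCommGroup E] [Module ℝ E]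
    (b : E →ₗ[ℝ] E →ₗ[ℝ] ℝ) (hsymm : ∀ x y, b x y = b y x) (hpos : ∀ x, 0 ≤ b x x)
    (hdef : ∀ x, b x x = 0 → x = 0) (s : Finset E) :
    ∃ (m : ℕ) (e : Fin m → E), (∀ i j, b (e i) (e j) = if i = j then 1 else 0) ∧
      (∀ i, e i ∈ Submodule.span ℝ (s : Set E)) ∧
      ∀ x ∈ Submodule.span ℝ (s : Set E), ∑ i, b (e i) x • e i = x := by
  let c : InnerProductSpace.Core ℝ E :=
    { inner := fun x y => b x y
      conj_inner_symm := fun x y => by simp [hsymm x y]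
      re_inner_nonneg := fun x => by simpa using hpos x
      add_left := fun x y z => by simp
      smul_left := fun x y r => by simp
      definite := fun x h => hdef x h }
  let _ : NormedAddCommGroup E := c.toNormedAddCommGroup
  let _ : InnerProductSpace ℝ E := InnerProductSpace.ofCore c.toCore
  have hin : ∀ x y : E, inner ℝ x y = b x y := fun _ _ => rfl
  let V := Submodule.span ℝ (s : Set E)
  let B := stdOrthonormalBasis ℝ V
  refine ⟨_, fun i => (B i : E), ?_, fun i => (B i).2, ?_⟩
  · intro i j
    have := (orthonormal_iff_ite.1 B.orthonormal) i j
    rw [Submodule.coe_inner, hin] at this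
    exact this
  · intro x hx
    have h := B.sum_repr ⟨x, hx⟩
    have h' := congrArg (Submodule.subtype V) h
    rw [map_sum] at h'
    simp only [map_smul, B.repr_apply_apply, Submodule.coe_inner, Submodule.coe_subtype,
      hin] at h'
    exact h'

namespace NuclearTriple

variable {H N : Type*} [NormedAddCommGroup H] [InnerProductSpace ℝ H]
  [AddCommGroup N] [Module ℝ N] [TopologicalSpace N] [IsTopologicalAddGroup N]

theorem eq_zero_of_ip_self (T : NuclearTriple H N) {p : ℕ} {ξ : N} (h : T.ip p ξ ξ = 0) :
    ξ = 0 := by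
  have := T.norm_incl_le p ξ
  rw [h, Real.sqrt_zero, norm_le_zero_iff] at this
  exact T.incl_injective (by simpa using this)

theorem exists_orthon (T : NuclearTriple H N) (p : ℕ) (s : Finset N) :
    ∃ (m : ℕ) (e : Fin m → N), T.Orthon p e ∧ (∀ i, e i ∈ Submodule.span ℝ (s : Set N)) ∧
      ∀ ξ ∈ Submodule.span ℝ (s : Set N), ∑ i, T.ip p (e i) ξ • e i = ξ :=
  exists_orthonormal_of_posDef (T.ip p) (T.ip_symm p) (T.ip_nonneg p)
    (fun _ => T.eq_zero_of_ip_self) s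

/-- The Hilbertian norm `|ξ|_p` on `N`. -/
def nrm (T : NuclearTriple H N) (p : ℕ) (ξ : N) : ℝ := √(T.ip p ξ ξ)

theorem nrm_nonneg (T : NuclearTriple H N) (p : ℕ) (ξ : N) : 0 ≤ T.nrm p ξ := Real.sqrt_nonneg _

theorem sq_nrm (T : NuclearTriple H N) (p : ℕ) (ξ : N) : T.nrm p ξ ^ 2 = T.ip p ξ ξ :=
  Real.sq_sqrt (T.ip_nonneg p ξ)

theorem nrm_smul (T : NuclearTriple H N) (p : ℕ) (c : ℝ) (ξ : N) :
    T.nrm p (c • ξ) = |c| * T.nrm p ξ := by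
  unfold nrm
  rw [← Real.sqrt_sq_eq_abs, ← Real.sqrt_mul (sq_nonneg c)]
  congr 1
  simp only [map_smul, LinearMap.smul_apply, smul_eq_mul]
  ring

theorem nrm_add_le (T : NuclearTriple H N) (p : ℕ) (ξ η : N) :
    T.nrm p (ξ + η) ≤ T.nrm p ξ + T.nrm p η := by
  apply Real.sqrt_le_iff.2
  refine ⟨add_nonneg (T.nrm_nonneg _ _) (T.nrm_nonneg _ _), ?_⟩
  have h := (abs_le.1 (T.abs_ip_le p ξ η)).2
  have h1 := T.sq_nrm p ξ
  have h2 := T.sq_nrm p η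
  simp only [map_add, LinearMap.add_apply, T.ip_symm p η ξ]
  unfold nrm at *
  nlinarith

theorem nrm_neg (T : NuclearTriple H N) (p : ℕ) (ξ : N) : T.nrm p (-ξ) = T.nrm p ξ := by
  simp [nrm]

theorem nrm_eq_zero (T : NuclearTriple H N) {p : ℕ} {ξ : N} (h : T.nrm p ξ = 0) : ξ = 0 := by
  apply T.eq_zero_of_ip_self (p := p)
  rw [← T.sq_nrm, h]; simp

theorem nrm_mono (T : NuclearTriple H N) {p q : ℕ} (h : p ≤ q) (ξ : N) :
    T.nrm p ξ ≤ T.nrm q ξ := Real.sqrt_le_sqrt (T.ip_mono p q h ξ)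

theorem Orthon.nrm_eq_one {T : NuclearTriple H N} {p m : ℕ} {e : Fin m → N} (he : T.Orthon p e)
    (i : Fin m) : T.nrm p (e i) = 1 := by
  simp [nrm, he i i]

theorem cnrm_eq (T : NuclearTriple H N) (p : ℕ) (θ : Cx N) :
    T.cnrm p θ = √(T.nrm p θ.1 ^ 2 + T.nrm p θ.2 ^ 2) := by
  rw [cnrm, sq_nrm, sq_nrm]

theorem sq_cnrm (T : NuclearTriple H N) (p : ℕ) (θ : Cx N) :
    T.cnrm p θ ^ 2 = T.nrm p θ.1 ^ 2 + T.nrm p θ.2 ^ 2 := by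
  rw [cnrm_eq, Real.sq_sqrt (by positivity)]

/-- The projection of `ξ` on the span of the orthonormal system `e`. -/
def proj (T : NuclearTriple H N) (p : ℕ) {m : ℕ} (e : Fin m → N) (ξ : N) : N :=
  ∑ i, T.ip p (e i) ξ • e i

theorem Orthon.ip_proj {T : NuclearTriple H N} {p m : ℕ} {e : Fin m → N} (he : T.Orthon p e)
    (ξ : N) (j : Fin m) : T.ip p (e j) (T.proj p e ξ) = T.ip p (e j) ξ := by
  simp [proj, he _ _]

theorem Orthon.ip_sub_proj {T : NuclearTriple H N} {p m : ℕ} {e : Fin m → N} (he : T.Orthon p e)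
    (ξ : N) (j : Fin m) : T.ip p (e j) (ξ - T.proj p e ξ) = 0 := by
  rw [map_sub, he.ip_proj, sub_self]

theorem Orthon.ip_sum_smul {T : NuclearTriple H N} {p m : ℕ} {e : Fin m → N} (he : T.Orthon p e)
    (w : Fin m → ℝ) : T.ip p (∑ i, w i • e i) (∑ i, w i • e i) = ∑ i, w i ^ 2 := by
  simp [he _ _, pow_two]

/-- Pythagoras: the residual is orthogonal to the projection. -/
theorem Orthon.nrm_sub_proj_sq {T : NuclearTriple H N} {p m : ℕ} {e : Fin m → N}
    (he : T.Orthon p e) (ξ : N) :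
    T.nrm p (ξ - T.proj p e ξ) ^ 2 = T.nrm p ξ ^ 2 - ∑ i, T.ip p (e i) ξ ^ 2 := by
  rw [sq_nrm, sq_nrm]
  have h : T.ip p (T.proj p e ξ) (ξ - T.proj p e ξ) = 0 := by
    generalize hη : ξ - T.proj p e ξ = η
    have : ∀ i, T.ip p (e i) η = 0 := fun i => hη ▸ he.ip_sub_proj ξ i
    simp [proj, this]
  have h2 : T.ip p ξ (T.proj p e ξ) = ∑ i, T.ip p (e i) ξ ^ 2 := by
    simp [proj, T.ip_symm p ξ, pow_two]
  rw [show T.ip p (ξ - T.proj p e ξ) (ξ - T.proj p e ξ) =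
    T.ip p ξ (ξ - T.proj p e ξ) - T.ip p (T.proj p e ξ) (ξ - T.proj p e ξ) by simp, h,
    map_sub, h2, sub_zero]

theorem Orthon.nrm_sub_proj_le {T : NuclearTriple H N} {p m : ℕ} {e : Fin m → N}
    (he : T.Orthon p e) (ξ : N) : T.nrm p (ξ - T.proj p e ξ) ≤ T.nrm p ξ := by
  refine le_of_sq_le_sq ?_ (T.nrm_nonneg _ _)
  rw [he.nrm_sub_proj_sq]
  have : 0 ≤ ∑ i, T.ip p (e i) ξ ^ 2 := Finset.sum_nonneg fun _ _ => sq_nonneg _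
  linarith

/-- Appending a normalized vector that is orthogonal to an orthonormal system. -/
theorem Orthon.snoc {T : NuclearTriple H N} {p m : ℕ} {e : Fin m → N} (he : T.Orthon p e)
    {η : N} (hη : T.ip p η η = 1) (h : ∀ i, T.ip p (e i) η = 0) :
    T.Orthon p (Fin.snoc e η : Fin (m + 1) → N) := by
  intro i j
  refine Fin.lastCases ?_ (fun i => ?_) i <;> refine Fin.lastCases ?_ (fun j => ?_) j
  · simp [hη]
  · simp [T.ip_symm p η, h, Fin.ext_iff, j.2.ne']
  · simp [h, Fin.ext_iff, i.2.ne]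
  · simp [he i j, Fin.ext_iff]

/-- `C` bounds the squared Hilbert-Schmidt norm of the embedding of `H_p` in `H_{p₀}`. -/
def HSBound (T : NuclearTriple H N) (p p₀ : ℕ) (C : ℝ) : Prop :=
  ∀ (m : ℕ) (e : Fin m → N), T.Orthon p e → ∑ i, T.nrm p₀ (e i) ^ 2 ≤ C

theorem exists_HSBound (T : NuclearTriple H N) (p₁ p₂ : ℕ) :
    ∃ p C, 1 ≤ C ∧ T.HSBound p p₁ C ∧ T.HSBound p p₂ C := by
  obtain ⟨p, C, h⟩ := T.nuclear p₁ p₂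
  refine ⟨p, max C 1, le_max_right _ _, fun m e he => ?_, fun m e he => ?_⟩ <;>
  simp only [sq_nrm]
  · exact (h m e he).1.trans (le_max_left _ _)
  · exact (h m e he).2.trans (le_max_left _ _)

theorem HSBound.nonneg {T : NuclearTriple H N} {p p₀ : ℕ} {C : ℝ} (h : T.HSBound p p₀ C) :
    0 ≤ C := by
  simpa using h 0 Fin.elim0 (fun i => i.elim0)

/-- A one-element orthonormal system shows that the operator norm is at most the Hilbert-Schmidt
norm. -/
theorem HSBound.nrm_le {T : NuclearTriple H N} {p p₀ : ℕ} {C : ℝ} (h : T.HSBound p p₀ C)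
    (ξ : N) : T.nrm p₀ ξ ≤ √C * T.nrm p ξ := by
  by_cases h0 : T.nrm p ξ = 0
  · rw [T.nrm_eq_zero h0]; simp [nrm]
  have hpos : 0 < T.nrm p ξ := lt_of_le_of_ne (T.nrm_nonneg _ _) (Ne.symm h0)
  have h1 := h 1 (fun _ => (T.nrm p ξ)⁻¹ • ξ) (by
    intro i j
    simp only [map_smul, LinearMap.smul_apply, smul_eq_mul, ← T.sq_nrm, Subsingleton.elim i j,
      if_true]
    field_simp)
  simp only [Finset.univ_unique, Finset.sum_singleton, nrm_smul, abs_inv, abs_of_pos hpos] at h1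
  have h2 := Real.le_sqrt_of_sq_le h1
  rwa [inv_mul_le_iff₀ hpos, mul_comm] at h2

theorem hsBound_hsIncl (T : NuclearTriple H N) {p p₀ : ℕ} (h : T.hsInclSq p p₀ < ∞) :
    T.HSBound p p₀ (T.hsIncl p p₀ ^ 2) := by
  intro m e he
  rw [hsIncl, Real.sq_sqrt ENNReal.toReal_nonneg]
  have h1 : ENNReal.ofReal (∑ i, T.ip p₀ (e i) (e i)) ≤ T.hsInclSq p p₀ :=
    le_iSup_of_le m (le_iSup_of_le e (le_iSup_of_le he le_rfl))
  have h2 := ENNReal.toReal_mono h.ne h1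
  rw [ENNReal.toReal_ofReal (Finset.sum_nonneg fun _ _ => T.ip_nonneg _ _)] at h2
  simpa only [sq_nrm] using h2

/-- A Hilbert-Schmidt embedding is approximated by projections of finite rank. -/
theorem HSBound.exists_proj {T : NuclearTriple H N} {p p₀ : ℕ} {C : ℝ} (h : T.HSBound p p₀ C)
    {δ : ℝ} (hδ : 0 < δ) : ∃ (m : ℕ) (e : Fin m → N), T.Orthon p e ∧
      ∀ ξ, T.nrm p₀ (ξ - T.proj p e ξ) ≤ δ * T.nrm p ξ := by
  -- The system is chosen with its sum within `δ²` of the supremum. Appending the normalized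
  -- residual of any `ξ` gives another orthonormal system, so the residual can contribute at most
  -- `δ²`.
  let S : Set ℝ := {s | ∃ (m : ℕ) (e : Fin m → N), T.Orthon p e ∧ s = ∑ i, T.nrm p₀ (e i) ^ 2}
  have hne : S.Nonempty := ⟨_, 0, Fin.elim0, fun i => i.elim0, rfl⟩
  have hbdd : BddAbove S := ⟨C, by rintro s ⟨m, e, he, rfl⟩; exact h m e he⟩
  obtain ⟨s, ⟨m, e, he, rfl⟩, hs⟩ := exists_lt_of_lt_csSup hne
    (sub_lt_self (sSup S) (pow_pos hδ 2))
  refine ⟨m, e, he, fun ξ => ?_⟩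
  set η := ξ - T.proj p e ξ with hη
  refine le_trans ?_ (mul_le_mul_of_nonneg_left (he.nrm_sub_proj_le ξ) hδ.le)
  rw [← hη]
  by_cases h0 : T.nrm p η = 0
  · rw [T.nrm_eq_zero h0]; simp [nrm]
  have hpos : 0 < T.nrm p η := lt_of_le_of_ne (T.nrm_nonneg _ _) (Ne.symm h0)
  have ho : T.Orthon p (Fin.snoc e ((T.nrm p η)⁻¹ • η) : Fin (m + 1) → N) := by
    refine he.snoc ?_ fun i => ?_
    · simp only [map_smul, LinearMap.smul_apply, smul_eq_mul, ← T.sq_nrm]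
      field_simp
    · rw [map_smul, hη, he.ip_sub_proj, smul_zero]
  have h1 : _ ≤ sSup S := le_csSup hbdd ⟨_, _, ho, rfl⟩
  simp only [Fin.sum_univ_castSucc, Fin.snoc_castSucc, Fin.snoc_last, nrm_smul, abs_inv,
    abs_of_pos hpos] at h1
  have h2 : ((T.nrm p η)⁻¹ * T.nrm p₀ η) ^ 2 ≤ δ ^ 2 := by linarith
  have h3 := le_of_sq_le_sq h2 hδ.le
  rwa [inv_mul_le_iff₀ hpos, mul_comm] at h3

end NuclearTriple

namespace Cx

variable {V : Type*}

/-- The element `ξ + i η` of the complexification. -/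
def mk (ξ η : V) : Cx V := (ξ, η)

@[simp] theorem mk_fst (ξ η : V) : (mk ξ η).1 = ξ := rfl
@[simp] theorem mk_snd (ξ η : V) : (mk ξ η).2 = η := rfl

end Cx

namespace NuclearTriple

variable {H N : Type*} [NormedAddCommGroup H] [InnerProductSpace ℝ H]
  [AddCommGroup N] [Module ℝ N] [TopologicalSpace N] [IsTopologicalAddGroup N]

/-! ## The complex norms and the dual norms -/

theorem pair_add_left (z w : N →L[ℝ] ℂ) (θ : Cx N) : pair (z + w) θ = pair z θ + pair w θ :=
  map_add (pairL θ) z w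

theorem pair_smul_left (c : ℂ) (z : N →L[ℝ] ℂ) (θ : Cx N) : pair (c • z) θ = c * pair z θ :=
  map_smul (pairL θ) c z

theorem pair_add_right (z : N →L[ℝ] ℂ) (θ ζ : Cx N) : pair z (θ + ζ) = pair z θ + pair z ζ := by
  simp [pair]; ring

/-- `θ ↦ ⟨z, θ⟩` as a complex linear form on `N_ℂ`. -/
def pairR (z : N →L[ℝ] ℂ) : Cx N →ₗ[ℂ] ℂ where
  toFun θ := pair z θ
  map_add' θ ζ := pair_add_right z θ ζ
  map_smul' c θ := pair_smul z c θ

theorem pairR_apply (z : N →L[ℝ] ℂ) (θ : Cx N) : pairR z θ = pair z θ := rfl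

theorem cnrm_csmul (T : NuclearTriple H N) (p : ℕ) (c : ℂ) (θ : Cx N) :
    T.cnrm p (c • θ) = ‖c‖ * T.cnrm p θ := by
  unfold cnrm
  rw [← Real.sqrt_sq (norm_nonneg c), ← Real.sqrt_mul (sq_nonneg _)]
  congr 1
  rw [← Complex.normSq_eq_norm_sq, Complex.normSq_apply]
  simp only [Cx.smul_fst, Cx.smul_snd, map_sub, map_add, map_smul, LinearMap.smul_apply,
    LinearMap.sub_apply, LinearMap.add_apply, smul_eq_mul, T.ip_symm p θ.2 θ.1]
  ring

theorem cnrm_eq_zero (T : NuclearTriple H N) {p : ℕ} {θ : Cx N} (h : T.cnrm p θ = 0) :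
    θ = 0 := by
  have := T.sq_cnrm p θ
  rw [h] at this
  have h1 : T.nrm p θ.1 = 0 := by
    nlinarith [sq_nonneg (T.nrm p θ.1), sq_nonneg (T.nrm p θ.2)]
  have h2 : T.nrm p θ.2 = 0 := by
    nlinarith [sq_nonneg (T.nrm p θ.1), sq_nonneg (T.nrm p θ.2)]
  exact Cx.ext (T.nrm_eq_zero h1) (T.nrm_eq_zero h2)

theorem cnrm_zero (T : NuclearTriple H N) (p : ℕ) : T.cnrm p (0 : Cx N) = 0 := by
  simp [cnrm]

theorem cnrm_le_of_nrm_le (T : NuclearTriple H N) {p q : ℕ} {C : ℝ} (hC : 0 ≤ C)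
    (h : ∀ ξ, T.nrm p ξ ≤ C * T.nrm q ξ) (θ : Cx N) : T.cnrm p θ ≤ C * T.cnrm q θ := by
  refine le_of_sq_le_sq ?_ (mul_nonneg hC (T.cnrm_nonneg _ _))
  rw [mul_pow, sq_cnrm, sq_cnrm, mul_add, ← mul_pow, ← mul_pow]
  have h1 := pow_le_pow_left₀ (T.nrm_nonneg _ _) (h θ.1) 2
  have h2 := pow_le_pow_left₀ (T.nrm_nonneg _ _) (h θ.2) 2
  linarith

/-- Sharp form of `norm_pair_le`: rescaling by the norm itself is possible because `|·|_p` is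
definite. -/
theorem norm_pair_le_mul (T : NuclearTriple H N) {p : ℕ} {z : N →L[ℝ] ℂ} (hz : z ∈ T.Hneg p)
    (θ : Cx N) : ‖pair z θ‖ ≤ (T.dualNorm p z).toReal * T.cnrm p θ := by
  by_cases h0 : T.cnrm p θ = 0
  · rw [T.cnrm_eq_zero h0, cnrm_zero, ← pairR_apply, map_zero]; simp
  have hpos : 0 < T.cnrm p θ := lt_of_le_of_ne (T.cnrm_nonneg _ _) (Ne.symm h0)
  have h1 : T.cnrm p ((((T.cnrm p θ)⁻¹ : ℝ) : ℂ) • θ) ≤ 1 := by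
    rw [cnrm_smul, abs_of_pos (inv_pos.2 hpos), inv_mul_cancel₀ h0]
  have h2 : ‖pair z ((((T.cnrm p θ)⁻¹ : ℝ) : ℂ) • θ)‖ ≤ (T.dualNorm p z).toReal := by
    rw [← toReal_enorm]
    exact ENNReal.toReal_mono (ne_of_lt hz) (le_iSup_of_le _ (le_iSup_of_le h1 le_rfl))
  rw [pair_smul, norm_mul, Complex.norm_real, Real.norm_eq_abs, abs_of_pos (inv_pos.2 hpos),
    inv_mul_le_iff₀ hpos] at h2
  rwa [mul_comm]

theorem dualNorm_le (T : NuclearTriple H N) {p : ℕ} {z : N →L[ℝ] ℂ} {K : ℝ} (hK : 0 ≤ K)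
    (h : ∀ θ, ‖pair z θ‖ ≤ K * T.cnrm p θ) : T.dualNorm p z ≤ ENNReal.ofReal K := by
  refine iSup_le fun θ => iSup_le fun hθ => ?_
  rw [← ofReal_norm]
  exact ENNReal.ofReal_le_ofReal ((h θ).trans (mul_le_of_le_one_right hK hθ))

theorem mem_Hneg (T : NuclearTriple H N) {p : ℕ} {z : N →L[ℝ] ℂ} {K : ℝ} (hK : 0 ≤ K)
    (h : ∀ θ, ‖pair z θ‖ ≤ K * T.cnrm p θ) : z ∈ T.Hneg p :=
  (T.dualNorm_le hK h).trans_lt ENNReal.ofReal_lt_top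

theorem toReal_dualNorm_le (T : NuclearTriple H N) {p : ℕ} {z : N →L[ℝ] ℂ} {K : ℝ} (hK : 0 ≤ K)
    (h : ∀ θ, ‖pair z θ‖ ≤ K * T.cnrm p θ) : (T.dualNorm p z).toReal ≤ K :=
  ENNReal.toReal_le_of_le_ofReal hK (T.dualNorm_le hK h)

theorem dualNorm_add_le (T : NuclearTriple H N) (p : ℕ) (z w : N →L[ℝ] ℂ) :
    T.dualNorm p (z + w) ≤ T.dualNorm p z + T.dualNorm p w := by
  refine iSup_le fun θ => iSup_le fun hθ => ?_
  rw [pair_add_left]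
  exact (enorm_add_le _ _).trans (add_le_add (le_iSup_of_le θ (le_iSup_of_le hθ le_rfl))
    (le_iSup_of_le θ (le_iSup_of_le hθ le_rfl)))

theorem dualNorm_smul_le (T : NuclearTriple H N) (p : ℕ) (c : ℂ) (z : N →L[ℝ] ℂ) :
    T.dualNorm p (c • z) ≤ ‖c‖ₑ * T.dualNorm p z := by
  refine iSup_le fun θ => iSup_le fun hθ => ?_
  rw [pair_smul_left, enorm_mul]
  gcongr
  exact le_iSup_of_le θ (le_iSup_of_le hθ le_rfl)

theorem dualNorm_zero (T : NuclearTriple H N) (p : ℕ) :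
    T.dualNorm p (0 : N →L[ℝ] ℂ) = 0 := by
  simpa using T.dualNorm_le (p := p) (z := (0 : N →L[ℝ] ℂ)) le_rfl fun θ => by simp [pair]

theorem add_mem_Hneg (T : NuclearTriple H N) {p : ℕ} {z w : N →L[ℝ] ℂ} (hz : z ∈ T.Hneg p)
    (hw : w ∈ T.Hneg p) : z + w ∈ T.Hneg p :=
  (T.dualNorm_add_le p z w).trans_lt (ENNReal.add_lt_top.2 ⟨hz, hw⟩)

theorem smul_mem_Hneg (T : NuclearTriple H N) {p : ℕ} (c : ℂ) {z : N →L[ℝ] ℂ}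
    (hz : z ∈ T.Hneg p) : c • z ∈ T.Hneg p :=
  (T.dualNorm_smul_le p c z).trans_lt (ENNReal.mul_lt_top enorm_lt_top hz)

theorem toReal_dualNorm_add_le (T : NuclearTriple H N) {p : ℕ} {z w : N →L[ℝ] ℂ}
    (hz : z ∈ T.Hneg p) (hw : w ∈ T.Hneg p) : (T.dualNorm p (z + w)).toReal ≤
      (T.dualNorm p z).toReal + (T.dualNorm p w).toReal := by
  rw [← ENNReal.toReal_add hz.ne hw.ne]
  exact ENNReal.toReal_mono (ENNReal.add_lt_top.2 ⟨hz, hw⟩).ne (T.dualNorm_add_le p z w)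

theorem toReal_dualNorm_smul_le (T : NuclearTriple H N) {p : ℕ} (c : ℂ) {z : N →L[ℝ] ℂ}
    (hz : z ∈ T.Hneg p) : (T.dualNorm p (c • z)).toReal ≤ ‖c‖ * (T.dualNorm p z).toReal := by
  rw [← toReal_enorm, ← ENNReal.toReal_mul]
  exact ENNReal.toReal_mono (ENNReal.mul_lt_top enorm_lt_top hz).ne (T.dualNorm_smul_le p c z)

/-- Dual form of a norm comparison: a stronger norm on `N` gives a larger dual, with the same
constant. -/
theorem mem_Hneg_of_nrm_le (T : NuclearTriple H N) {p q : ℕ} {C : ℝ} (hC : 0 ≤ C)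
    (h : ∀ ξ, T.nrm p ξ ≤ C * T.nrm q ξ) {z : N →L[ℝ] ℂ} (hz : z ∈ T.Hneg p) :
    z ∈ T.Hneg q ∧ (T.dualNorm q z).toReal ≤ C * (T.dualNorm p z).toReal := by
  have h1 : ∀ θ, ‖pair z θ‖ ≤ (C * (T.dualNorm p z).toReal) * T.cnrm q θ := fun θ =>
    (T.norm_pair_le_mul hz θ).trans (by
      rw [mul_comm C, mul_assoc]
      exact mul_le_mul_of_nonneg_left (T.cnrm_le_of_nrm_le hC h θ) ENNReal.toReal_nonneg)
  exact ⟨T.mem_Hneg (by positivity) h1, T.toReal_dualNorm_le (by positivity) h1⟩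

theorem Hneg_mono (T : NuclearTriple H N) {p q : ℕ} (h : p ≤ q) : T.Hneg p ⊆ T.Hneg q :=
  fun _ hz => (T.mem_Hneg_of_nrm_le zero_le_one (fun ξ => by simpa using T.nrm_mono h ξ) hz).1

/-- This is `N' = ⋃ H_{-p}`: continuity at zero controls `z` on a ball of one of the norms. Real and
imaginary parts are estimated separately, since only finiteness matters. -/
theorem exists_mem_Hneg (T : NuclearTriple H N) (z : N →L[ℝ] ℂ) : ∃ p, z ∈ T.Hneg p := by
  have h0 : {ξ : N | ‖z ξ‖ < 1} ∈ 𝓝 (0 : N) := by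
    have : Tendsto (fun ξ => ‖z ξ‖) (𝓝 0) (𝓝 ‖z 0‖) := (z.continuous.norm).tendsto 0
    rw [map_zero, norm_zero] at this
    exact this.eventually (gt_mem_nhds one_pos)
  obtain ⟨⟨p, r⟩, hr, hsub⟩ := T.nhds_basis.mem_iff.1 h0
  simp only at hr hsub
  have key : ∀ ξ, ‖z ξ‖ ≤ (2 / r) * T.nrm p ξ := by
    intro ξ
    by_cases hn : T.nrm p ξ = 0
    · rw [T.nrm_eq_zero hn]; simp [nrm]
    have hpos : 0 < T.nrm p ξ := lt_of_le_of_ne (T.nrm_nonneg _ _) (Ne.symm hn)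
    have h1 : T.nrm p ((r / (2 * T.nrm p ξ)) • ξ) < r := by
      rw [nrm_smul, abs_of_pos (by positivity)]
      field_simp
      linarith
    have h2 : ‖z ((r / (2 * T.nrm p ξ)) • ξ)‖ < 1 := hsub h1
    rw [map_smul, norm_smul, Real.norm_eq_abs, abs_of_pos (by positivity)] at h2
    rw [div_mul_eq_mul_div, div_lt_one (by positivity)] at h2
    rw [div_mul_eq_mul_div, le_div_iff₀ hr]
    linarith
  refine ⟨p, T.mem_Hneg (K := 2 / r + 2 / r) (by positivity) fun θ => ?_⟩
  have hle : ∀ a b : ℝ, a ≤ √(a ^ 2 + b ^ 2) := fun a b =>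
    Real.le_sqrt_of_sq_le (by nlinarith [sq_nonneg b])
  have h1 : T.nrm p θ.1 ≤ T.cnrm p θ := by rw [cnrm_eq]; exact hle _ _
  have h2 : T.nrm p θ.2 ≤ T.cnrm p θ := by rw [cnrm_eq, add_comm]; exact hle _ _
  calc ‖pair z θ‖ ≤ ‖z θ.1‖ + ‖z θ.2‖ := by
        refine (norm_add_le _ _).trans_eq ?_
        rw [norm_mul, Complex.norm_I, one_mul]
    _ ≤ 2 / r * T.nrm p θ.1 + 2 / r * T.nrm p θ.2 := add_le_add (key _) (key _)
    _ ≤ _ := by rw [add_mul]; gcongr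

/-! ## Coordinates with respect to an orthonormal system -/

/-- The element of `N_ℂ` with coordinates `w` with respect to `e`. -/
def lin {m : ℕ} (e : Fin m → N) (w : Fin m → ℂ) : Cx N :=
  Cx.mk (∑ i, (w i).re • e i) (∑ i, (w i).im • e i)

@[simp] theorem lin_fst {m : ℕ} (e : Fin m → N) (w : Fin m → ℂ) :
    (lin e w).1 = ∑ i, (w i).re • e i := rfl

@[simp] theorem lin_snd {m : ℕ} (e : Fin m → N) (w : Fin m → ℂ) :
    (lin e w).2 = ∑ i, (w i).im • e i := rfl

theorem lin_add {m : ℕ} (e : Fin m → N) (w w' : Fin m → ℂ) :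
    lin e (w + w') = lin e w + lin e w' := by
  apply Cx.ext <;> simp [add_smul, Finset.sum_add_distrib]

theorem lin_smul {m : ℕ} (e : Fin m → N) (c : ℂ) (w : Fin m → ℂ) :
    lin e (c • w) = c • lin e w := by
  apply Cx.ext <;>
  simp [sub_smul, add_smul, Finset.sum_sub_distrib, Finset.sum_add_distrib,
    Finset.smul_sum, mul_smul]

theorem pair_lin {m : ℕ} (e : Fin m → N) (w : Fin m → ℂ) (z : N →L[ℝ] ℂ) :
    pair z (lin e w) = ∑ i, w i * z (e i) := by
  simp only [pair, lin_fst, lin_snd, map_sum, map_smul, Complex.real_smul, Finset.mul_sum,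
    ← Finset.sum_add_distrib]
  refine Finset.sum_congr rfl fun i _ => ?_
  conv_rhs => rw [← Complex.re_add_im (w i)]
  ring

theorem Orthon.sq_cnrm_lin {T : NuclearTriple H N} {p m : ℕ} {e : Fin m → N}
    (he : T.Orthon p e) (w : Fin m → ℂ) : T.cnrm p (lin e w) ^ 2 = ∑ i, ‖w i‖ ^ 2 := by
  rw [sq_cnrm, sq_nrm, sq_nrm]
  simp only [lin_fst, lin_snd]
  rw [he.ip_sum_smul, he.ip_sum_smul, ← Finset.sum_add_distrib]
  refine Finset.sum_congr rfl fun i _ => ?_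
  rw [← Complex.normSq_eq_norm_sq, Complex.normSq_apply]
  ring

/-- Test `z` on the vector whose coordinates are the conjugates of `z (e i)`. -/
theorem Orthon.sum_norm_sq_le {T : NuclearTriple H N} {p m : ℕ} {e : Fin m → N}
    (he : T.Orthon p e) {z : N →L[ℝ] ℂ} (hz : z ∈ T.Hneg p) :
    √(∑ i, ‖z (e i)‖ ^ 2) ≤ (T.dualNorm p z).toReal := by
  set S := ∑ i, ‖z (e i)‖ ^ 2 with hS
  have hS0 : 0 ≤ S := Finset.sum_nonneg fun _ _ => by positivity
  have h1 := T.norm_pair_le_mul hz (lin e fun i => (starRingEnd ℂ) (z (e i)))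
  rw [pair_lin] at h1
  have h2 : ∑ i, (starRingEnd ℂ) (z (e i)) * z (e i) = (S : ℂ) := by
    rw [hS]; push_cast
    exact Finset.sum_congr rfl fun i _ => Complex.conj_mul' _
  have h3 : T.cnrm p (lin e fun i => (starRingEnd ℂ) (z (e i))) = √S := by
    rw [← Real.sqrt_sq (T.cnrm_nonneg _ _), he.sq_cnrm_lin]
    simp [hS]
  rw [h2, h3, Complex.norm_real, Real.norm_of_nonneg hS0] at h1
  by_cases h0 : √S = 0
  · rw [h0]; exact ENNReal.toReal_nonneg
  have hpos : 0 < √S := lt_of_le_of_ne (Real.sqrt_nonneg _) (Ne.symm h0)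
  have h4 : √S * √S ≤ (T.dualNorm p z).toReal * √S := by rwa [Real.mul_self_sqrt hS0]
  exact le_of_mul_le_mul_right h4 hpos

/-! ## Homogeneous polynomials with finite Hilbert-Schmidt norm -/

/-- `a` is a homogeneous polynomial of degree `n` on `N_ℂ` whose coefficients with respect to every
finite orthonormal system of `H_p` can be chosen with `ℓ²`-norm at most `K`. -/
def HSPoly (T : NuclearTriple H N) (p n : ℕ) (a : Cx N → ℂ) (K : ℝ) : Prop :=
  ∀ (m : ℕ) (e : Fin m → N), T.Orthon p e → ∃ c : (Fin n → Fin m) → ℂ,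
    (∀ w : Fin m → ℂ, a (lin e w) = ∑ κ, c κ * ∏ i, w (κ i)) ∧ √(∑ κ, ‖c κ‖ ^ 2) ≤ K

theorem sqrt_sum_eq_norm {ι : Type*} [Fintype ι] (c : ι → ℂ) :
    √(∑ i, ‖c i‖ ^ 2) = ‖(WithLp.toLp 2 c : EuclideanSpace ℂ ι)‖ := by
  rw [EuclideanSpace.norm_eq]

namespace HSPoly

variable {T : NuclearTriple H N} {p n : ℕ} {a b : Cx N → ℂ} {K K' : ℝ}

theorem nonneg (h : T.HSPoly p n a K) : 0 ≤ K := by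
  obtain ⟨c, -, h⟩ := h 0 Fin.elim0 (fun i => i.elim0)
  exact (Real.sqrt_nonneg _).trans h

theorem mono (h : T.HSPoly p n a K) (hK : K ≤ K') : T.HSPoly p n a K' := fun m e he => by
  obtain ⟨c, h1, h2⟩ := h m e he
  exact ⟨c, h1, h2.trans hK⟩

theorem add (h : T.HSPoly p n a K) (h' : T.HSPoly p n b K') :
    T.HSPoly p n (fun θ => a θ + b θ) (K + K') := fun m e he => by
  obtain ⟨c, h1, h2⟩ := h m e he
  obtain ⟨c', h1', h2'⟩ := h' m e he
  refine ⟨c + c', fun w => ?_, ?_⟩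
  · simp only [h1, h1', Pi.add_apply, add_mul, Finset.sum_add_distrib]
  · rw [sqrt_sum_eq_norm, WithLp.toLp_add] at *
    exact (norm_add_le _ _).trans (add_le_add h2 h2')

theorem const_mul (h : T.HSPoly p n a K) (r : ℂ) :
    T.HSPoly p n (fun θ => r * a θ) (‖r‖ * K) := fun m e he => by
  obtain ⟨c, h1, h2⟩ := h m e he
  refine ⟨r • c, fun w => ?_, ?_⟩
  · simp only [h1, Pi.smul_apply, smul_eq_mul, Finset.mul_sum, mul_assoc]
  · rw [sqrt_sum_eq_norm, WithLp.toLp_smul, norm_smul] at *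
    gcongr

theorem zero : T.HSPoly p n (fun _ => 0) 0 := fun m e _ => ⟨0, fun w => by simp, by simp⟩

theorem sum {ι : Type*} (s : Finset ι) {a : ι → Cx N → ℂ} {K : ι → ℝ}
    (h : ∀ i ∈ s, T.HSPoly p n (a i) (K i)) :
    T.HSPoly p n (fun θ => ∑ i ∈ s, a i θ) (∑ i ∈ s, K i) := by
  classical
  induction s using Finset.induction_on with
  | empty => simpa using zero
  | insert i s hi ih =>
    simp only [Finset.sum_insert hi]
    exact (h i (Finset.mem_insert_self _ _)).add
      (ih fun j hj => h j (Finset.mem_insert_of_mem hj))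

/-- The coefficients of the product are the tensor product of the coefficients, indexed through
`Fin.append`, and the `ℓ²` norm of a tensor product is the product of the norms. -/
theorem mul {n' : ℕ} (h : T.HSPoly p n a K) (h' : T.HSPoly p n' b K') :
    T.HSPoly p (n + n') (fun θ => a θ * b θ) (K * K') := fun m e he => by
  obtain ⟨c, h1, h2⟩ := h m e he
  obtain ⟨c', h1', h2'⟩ := h' m e he
  refine ⟨fun κ => c (fun i => κ (Fin.castAdd n' i)) * c' (fun i => κ (Fin.natAdd n i)),
    fun w => ?_, ?_⟩
  · simp only [h1, h1']
    rw [Finset.sum_mul_sum, ← Fintype.sum_prod_type',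
      ← (Fin.appendEquiv n n').sum_comp]
    refine Finset.sum_congr rfl fun κ _ => ?_
    simp [Fin.appendEquiv, Fin.prod_univ_add]
    ring
  · rw [← (Fin.appendEquiv n n').sum_comp]
    simp only [Fin.appendEquiv, Equiv.coe_fn_mk, Fin.append_left, Fin.append_right, norm_mul,
      mul_pow]
    rw [Fintype.sum_prod_type' (f := fun x y => ‖c x‖ ^ 2 * ‖c' y‖ ^ 2), ← Finset.sum_mul_sum,
      Real.sqrt_mul (Finset.sum_nonneg fun _ _ => by positivity)]
    exact mul_le_mul h2 h2' (Real.sqrt_nonneg _) h.nonneg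

theorem one : T.HSPoly p 0 (fun _ => 1) 1 := fun m e _ => ⟨fun _ => 1, fun w => by simp, by simp⟩

theorem pair {z : N →L[ℝ] ℂ} (hz : z ∈ T.Hneg p) :
    T.HSPoly p 1 (fun θ => NuclearTriple.pair z θ) (T.dualNorm p z).toReal := fun m e he => by
  refine ⟨fun κ => z (e (κ 0)), fun w => ?_, ?_⟩
  · simp only [pair_lin]
    rw [← (Equiv.funUnique (Fin 1) (Fin m)).sum_comp]
    refine Finset.sum_congr rfl fun κ _ => ?_
    simp [mul_comm]
  · rw [← (Equiv.funUnique (Fin 1) (Fin m)).symm.sum_comp]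
    simpa using he.sum_norm_sq_le hz

theorem pair_pow {z : N →L[ℝ] ℂ} (hz : z ∈ T.Hneg p) (k : ℕ) :
    T.HSPoly p k (fun θ => NuclearTriple.pair z θ ^ k) ((T.dualNorm p z).toReal ^ k) := by
  induction k with
  | zero => simpa using one
  | succ k ih => simpa only [pow_succ] using ih.mul (pair hz)

end HSPoly

/-! ## Functionals on the symmetric tensor powers -/

theorem kerNorm_nonneg (T : NuclearTriple H N) (p : ℕ) {n : ℕ} (φ : T.SymPow n) :
    0 ≤ T.kerNorm p φ := Real.sqrt_nonneg _

theorem Orthon.sqrt_sum_le_kerNorm {T : NuclearTriple H N} {p m n : ℕ} {e : Fin m → N}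
    (he : T.Orthon p e) (φ : T.SymPow n) :
    √(∑ κ : Fin n → Fin m, ‖φ.1 (fun i => T.riesz p (e (κ i)))‖ ^ 2) ≤ T.kerNorm p φ := by
  apply Real.sqrt_le_sqrt
  have h : ∑ κ : Fin n → Fin m, ‖φ.1 (fun i => T.riesz p (e (κ i)))‖ₑ ^ 2 ≤ T.hsSq p φ.1 :=
    le_iSup_of_le m (le_iSup_of_le e (le_iSup_of_le he le_rfl))
  have h2 := ENNReal.toReal_mono (φ.2.hs p).ne h
  rw [ENNReal.toReal_sum fun _ _ => ENNReal.pow_ne_top enorm_ne_top] at h2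
  simpa using h2

theorem kerNorm_le (T : NuclearTriple H N) {p n : ℕ} {φ : T.SymPow n} {K : ℝ} (hK : 0 ≤ K)
    (h : ∀ (m : ℕ) (e : Fin m → N), T.Orthon p e →
      ∑ κ : Fin n → Fin m, ‖φ.1 (fun i => T.riesz p (e (κ i)))‖ ^ 2 ≤ K ^ 2) :
    T.kerNorm p φ ≤ K := by
  apply Real.sqrt_le_iff.2
  refine ⟨hK, ENNReal.toReal_le_of_le_ofReal (sq_nonneg _) ?_⟩
  refine iSup_le fun m => iSup_le fun e => iSup_le fun he => ?_
  refine le_trans (le_of_eq ?_) (ENNReal.ofReal_le_ofReal (h m e he))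
  rw [ENNReal.ofReal_sum_of_nonneg fun _ _ => by positivity]
  refine Finset.sum_congr rfl fun κ _ => ?_
  rw [← ofReal_norm, ENNReal.ofReal_pow (norm_nonneg _)]

theorem pair_riesz (T : NuclearTriple H N) (p : ℕ) (ξ : N) (θ : Cx N) :
    pair (T.riesz p ξ) θ = T.ip p ξ θ.1 + Complex.I * T.ip p ξ θ.2 := rfl

/-- A homogeneous polynomial with finite Hilbert-Schmidt norm is represented by a continuous linear
functional on the symmetric tensor power. -/
theorem HSPoly.exists_functional {T : NuclearTriple H N} {p n : ℕ} {a : Cx N → ℂ} {K : ℝ}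
    (h : T.HSPoly p n a K) : ∃ L : T.SymPow n →ₗ[ℂ] ℂ,
      (∀ φ, ‖L φ‖ ≤ K * T.kerNorm p φ) ∧ ∀ θ, L (T.symTensor n θ) = a θ := by
  choose m e he _ hspan using T.exists_orthon p
  choose c hc hcK using fun s => h (m s) (e s) (he s)
  -- In finitely many directions the functional is the pairing of the coefficients of `a` with those
  -- of `φ`; Cauchy-Schwarz bounds it by `K` uniformly in `s`.
  let f : Finset N → T.SymPow n → ℂ := fun s φ =>
    ∑ κ, c s κ * φ.1 (fun i => T.riesz p (e s (κ i)))
  have hbound : ∀ s φ, ‖f s φ‖ ≤ K * T.kerNorm p φ := by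
    intro s φ
    calc ‖f s φ‖ ≤ ∑ κ, ‖c s κ‖ * ‖φ.1 (fun i => T.riesz p (e s (κ i)))‖ := by
          refine (norm_sum_le _ _).trans_eq (Finset.sum_congr rfl fun κ _ => norm_mul _ _)
      _ ≤ _ := Real.sum_mul_le_sqrt_mul_sqrt _ _ _
      _ ≤ _ := mul_le_mul (hcK s) ((he s).sqrt_sum_le_kerNorm φ) (Real.sqrt_nonneg _) h.nonneg
  -- The coefficients chosen for different `s` are unrelated, so ordinary convergence is not
  -- available. Along an ultrafilter every bounded family converges, and linearity passes to the
  -- limit.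
  let U : Ultrafilter (Finset N) := Ultrafilter.of atTop
  have hU : (U : Filter (Finset N)) ≤ atTop := Ultrafilter.of_le _
  have hlim : ∀ φ, ∃ l, Tendsto (fun s => f s φ) U (𝓝 l) := by
    intro φ
    obtain ⟨l, -, hl⟩ := (isCompact_closedBall (0 : ℂ) (K * T.kerNorm p φ)).ultrafilter_le_nhds
      (U.map fun s => f s φ) (by
        rw [le_principal_iff]
        exact Filter.mem_map.2 (Filter.univ_mem' fun s => by simpa using hbound s φ))
    exact ⟨l, hl⟩
  choose L hL using hlim
  refine ⟨{ toFun := L, map_add' := fun φ ψ => ?_, map_smul' := fun r φ => ?_ },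
    fun φ => ?_, fun θ => ?_⟩
  · refine tendsto_nhds_unique (hL (φ + ψ)) (((hL φ).add (hL ψ)).congr fun s => ?_)
    simp [f, mul_add, Finset.sum_add_distrib]
  · refine tendsto_nhds_unique (hL (r • φ)) (((hL φ).const_mul r).congr fun s => ?_)
    simp only [f, Finset.mul_sum]
    refine Finset.sum_congr rfl fun κ _ => ?_
    simp only [SetLike.val_smul, smul_apply, smul_eq_mul]
    ring
  · exact le_of_tendsto (hL φ).norm (Eventually.of_forall fun s => hbound s φ)
  · refine tendsto_nhds_unique (hL (T.symTensor n θ)) (tendsto_const_nhds.congr' ?_)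
    classical
    filter_upwards [hU (Ici_mem_atTop ({θ.1, θ.2} : Finset N))] with s hs
    -- As soon as `s` contains both components of `θ`, the value of `f s` at the tensor power is
    -- exactly `a θ`, so the limit is too.
    have h1 : θ = lin (e s) fun i => NuclearTriple.pair (T.riesz p (e s i)) θ := by
      have hmem : θ.1 ∈ s ∧ θ.2 ∈ s := ⟨hs (by simp), hs (by simp)⟩
      apply Cx.ext
      · rw [lin_fst]
        conv_lhs => rw [← hspan s θ.1 (Submodule.subset_span hmem.1)]
        simp [pair_riesz]
      · rw [lin_snd]
        conv_lhs => rw [← hspan s θ.2 (Submodule.subset_span hmem.2)]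
        simp [pair_riesz]
    conv_lhs => rw [h1]
    rw [hc]
    rfl

/-! ## Density of the tensor powers -/

/-- For a real functional `|⟨z, θ⟩|² = x(θ₁)² + x(θ₂)²`, so complexification does not increase the
norm. -/
theorem norm_pair_le_of_real (T : NuclearTriple H N) {p : ℕ} {z : N →L[ℝ] ℂ} {x : N → ℝ}
    (hz : ∀ ξ, z ξ = x ξ) {K : ℝ} (hK : 0 ≤ K) (h : ∀ ξ, |x ξ| ≤ K * T.nrm p ξ) (θ : Cx N) :
    ‖pair z θ‖ ≤ K * T.cnrm p θ := by
  refine le_of_sq_le_sq ?_ (mul_nonneg hK (T.cnrm_nonneg _ _))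
  rw [pair, hz, hz, mul_comm Complex.I, ← Complex.normSq_eq_norm_sq, Complex.normSq_add_mul_I,
    mul_pow, sq_cnrm, ← sq_abs (x θ.1), ← sq_abs (x θ.2), mul_add, ← mul_pow, ← mul_pow]
  exact add_le_add (pow_le_pow_left₀ (abs_nonneg _) (h _) 2)
    (pow_le_pow_left₀ (abs_nonneg _) (h _) 2)

theorem riesz_mem_Hneg (T : NuclearTriple H N) (p : ℕ) (ξ : N) : T.riesz p ξ ∈ T.Hneg p :=
  T.mem_Hneg (T.nrm_nonneg p ξ) (T.norm_pair_le_of_real (T.riesz_apply p ξ) (T.nrm_nonneg p ξ)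
    (T.abs_ip_le p ξ))

/-- The adjoint of a Hilbert-Schmidt embedding is Hilbert-Schmidt. -/
theorem HSBound.sum_sq_dualNorm_le {T : NuclearTriple H N} {p p₁ : ℕ} {C : ℝ}
    (h : T.HSBound p₁ p C) {m : ℕ} {f : Fin m → N} (hf : T.Orthon p f) :
    ∑ k, (T.dualNorm p₁ (T.riesz p (f k))).toReal ^ 2 ≤ C := by
  set D : Fin m → ℝ := fun k => (T.dualNorm p₁ (T.riesz p (f k))).toReal with hD
  have hD0 : ∀ k, 0 ≤ D k := fun k => ENNReal.toReal_nonneg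
  -- The dual norms need not be attained on `N`; vectors that reach a fraction `t` of them are used,
  -- and `t → 1` at the end.
  have key : ∀ t : ℝ, 0 < t → t < 1 → t ^ 2 * ∑ k, D k ^ 2 ≤ C := by
    intro t ht0 ht
    have hex : ∀ k, ∃ ξ : N, T.nrm p₁ ξ ≤ 1 ∧ t * D k ≤ |T.ip p (f k) ξ| := by
      intro k
      by_contra! hcon
      have hpos : 0 < D k := by
        have := hcon 0 (by simp [nrm])
        simp only [map_zero, abs_zero] at this
        exact pos_of_mul_pos_right this ht0.le
      have hle : ∀ ξ, |T.ip p (f k) ξ| ≤ t * D k * T.nrm p₁ ξ := by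
        intro ξ
        by_cases h0 : T.nrm p₁ ξ = 0
        · rw [T.nrm_eq_zero h0]; simp [nrm]
        have hn : 0 < T.nrm p₁ ξ := lt_of_le_of_ne (T.nrm_nonneg _ _) (Ne.symm h0)
        have := hcon ((T.nrm p₁ ξ)⁻¹ • ξ) (by
          rw [nrm_smul, abs_of_pos (inv_pos.2 hn), inv_mul_cancel₀ h0])
        rw [map_smul, smul_eq_mul, abs_mul, abs_of_pos (inv_pos.2 hn), inv_mul_lt_iff₀ hn] at this
        linarith
      have h1 : D k ≤ t * D k := T.toReal_dualNorm_le (by positivity)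
        (T.norm_pair_le_of_real (T.riesz_apply p (f k)) (by positivity) hle)
      nlinarith
    choose ξ hξ1 hξ2 using hex
    classical
    -- Expanding the chosen vectors in a system `e` of `H_{p₁}` gives a double sum over `(f k, e
    -- j)_p`. Exchanging the sums and applying Bessel in `H_p` leaves the Hilbert-Schmidt sum of
    -- `e`.
    obtain ⟨M, e, he, -, hspan⟩ := T.exists_orthon p₁ (Finset.univ.image ξ)
    have h1 : ∀ k, T.ip p (f k) (ξ k) ^ 2 ≤ ∑ j, T.ip p (f k) (e j) ^ 2 := by
      intro k
      have h2 : T.ip p (f k) (ξ k) = ∑ j, T.ip p₁ (e j) (ξ k) * T.ip p (f k) (e j) := by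
        conv_lhs => rw [← hspan (ξ k) (Submodule.subset_span (by simp))]
        simp
      rw [h2]
      refine (Finset.sum_mul_sq_le_sq_mul_sq _ _ _).trans ?_
      refine mul_le_of_le_one_left (Finset.sum_nonneg fun _ _ => sq_nonneg _) ?_
      refine (T.bessel p₁ he _).trans ?_
      rw [← sq_nrm]
      exact pow_le_one₀ (T.nrm_nonneg _ _) (hξ1 k)
    calc t ^ 2 * ∑ k, D k ^ 2 = ∑ k, (t * D k) ^ 2 := by simp only [mul_pow, Finset.mul_sum]
      _ ≤ ∑ k, T.ip p (f k) (ξ k) ^ 2 := Finset.sum_le_sum fun k _ => by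
          rw [← sq_abs (T.ip p (f k) (ξ k))]
          exact pow_le_pow_left₀ (mul_nonneg ht0.le (hD0 k)) (hξ2 k) 2
      _ ≤ ∑ k, ∑ j, T.ip p (f k) (e j) ^ 2 := Finset.sum_le_sum fun k _ => h1 k
      _ = ∑ j, ∑ k, T.ip p (f k) (e j) ^ 2 := Finset.sum_comm
      _ ≤ ∑ j, T.nrm p (e j) ^ 2 := Finset.sum_le_sum fun j _ => by
          rw [sq_nrm]; exact T.bessel p hf _
      _ ≤ C := h M e he
  have hlim : Tendsto (fun t : ℝ => t ^ 2 * ∑ k, D k ^ 2) (𝓝[<] 1) (𝓝 (1 ^ 2 * ∑ k, D k ^ 2)) :=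
    ((continuous_id.pow 2).mul continuous_const).continuousWithinAt
  rw [one_pow, one_mul] at hlim
  refine le_of_tendsto hlim ?_
  filter_upwards [Ioo_mem_nhdsLT (zero_lt_one' ℝ)] with t ht using key t ht.1 ht.2

/-- A bounded form on the larger dual `H_{-p₁}` is Hilbert-Schmidt on `H_{-p}`: its squared values
on an orthonormal system are dominated by a product, whose sum factors into the n-th power of the
Hilbert-Schmidt sum of the adjoint. -/
theorem HSBound.kerNorm_le {T : NuclearTriple H N} {p p₁ n : ℕ} {C b : ℝ}
    (h : T.HSBound p₁ p C) (hb : 0 ≤ b) {φ : T.SymPow n}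
    (hφ : ∀ z : Fin n → (N →L[ℝ] ℂ), (∀ i, z i ∈ T.Hneg p₁) →
      ‖φ.1 z‖ ≤ b * ∏ i, (T.dualNorm p₁ (z i)).toReal) :
    T.kerNorm p φ ≤ b * √C ^ n := by
  refine T.kerNorm_le (by positivity) fun m e he => ?_
  have hmem : ∀ ξ, T.riesz p ξ ∈ T.Hneg p₁ := fun ξ =>
    (T.mem_Hneg_of_nrm_le (Real.sqrt_nonneg C) h.nrm_le (T.riesz_mem_Hneg p ξ)).1
  calc ∑ κ : Fin n → Fin m, ‖φ.1 (fun i => T.riesz p (e (κ i)))‖ ^ 2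
      ≤ ∑ κ : Fin n → Fin m, b ^ 2 * ∏ i, (T.dualNorm p₁ (T.riesz p (e (κ i)))).toReal ^ 2 := by
        refine Finset.sum_le_sum fun κ _ => ?_
        rw [Finset.prod_pow, ← mul_pow]
        exact pow_le_pow_left₀ (norm_nonneg _) (hφ _ fun i => hmem _) 2
    _ = b ^ 2 * (∑ k, (T.dualNorm p₁ (T.riesz p (e k))).toReal ^ 2) ^ n := by
        rw [← Finset.mul_sum, Finset.sum_pow', Fintype.piFinset_univ]
    _ ≤ b ^ 2 * C ^ n := by
        gcongr
        exact h.sum_sq_dualNorm_le he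
    _ = (b * √C ^ n) ^ 2 := by
        rw [mul_pow, ← pow_mul, mul_comm n 2, pow_mul, Real.sq_sqrt h.nonneg]

/-- The adjoint of the projection `proj T p e`, acting on `N'_ℂ`. -/
def adjProj (T : NuclearTriple H N) (p : ℕ) {m : ℕ} (e : Fin m → N) (z : N →L[ℝ] ℂ) :
    N →L[ℝ] ℂ := ∑ i, z (e i) • T.riesz p (e i)

theorem pair_adjProj (T : NuclearTriple H N) (p : ℕ) {m : ℕ} (e : Fin m → N) (z : N →L[ℝ] ℂ)
    (θ : Cx N) : pair (T.adjProj p e z) θ =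
      pair z (Cx.mk (T.proj p e θ.1) (T.proj p e θ.2)) := by
  have h : pair (T.adjProj p e z) θ = ∑ i, z (e i) * pair (T.riesz p (e i)) θ := by
    change pairL θ _ = _
    simp only [adjProj, map_sum, map_smul]
    rfl
  rw [h]
  simp only [pair, Cx.mk_fst, Cx.mk_snd, proj, map_sum, map_smul, riesz_apply, Complex.real_smul, Finset.mul_sum,
    ← Finset.sum_add_distrib]
  exact Finset.sum_congr rfl fun i _ => by ring

/-- The finite-rank approximation `z ↦ φ(P' z₁, …, P' zₙ)` of `φ` is a combination of tensor
powers. -/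
theorem exists_span_eq_adjProj (T : NuclearTriple H N) (p : ℕ) {m n : ℕ} (e : Fin m → N)
    (φ : T.SymPow n) : ∃ ψ ∈ Submodule.span ℂ (Set.range (T.symTensor n)),
      ∀ z, ψ.1 z = φ.1 (fun i => T.adjProj p e (z i)) := by
  let X : (Fin n → Fin m) → Fin n → Cx N := fun κ i => Cx.mk (e (κ i)) 0
  let c : (Fin n → Fin m) → ℂ := fun κ => φ.1 (fun i => T.riesz p (e (κ i)))
  -- Polarization writes the symmetrization of `e_{κ₁} ⊗ ⋯ ⊗ e_{κₙ}` as a signed sum of tensor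
  -- powers, with factor `1 / (2^n n!)`.
  refine ⟨∑ κ, (c κ * (2 ^ n * (n.factorial : ℂ))⁻¹) • ∑ ε : Fin n → ℤˣ,
    (∏ i, ((ε i : ℤ) : ℂ)) • T.symTensor n (∑ i, ((ε i : ℤ) : ℂ) • X κ i), ?_, fun z => ?_⟩
  · exact Submodule.sum_mem _ fun κ _ => Submodule.smul_mem _ _ (Submodule.sum_mem _ fun ε _ =>
      Submodule.smul_mem _ _ (Submodule.subset_span ⟨_, rfl⟩))
  let f : MultilinearMap ℂ (fun _ : Fin n => Cx N) ℂ :=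
    (MultilinearMap.mkPiAlgebra ℂ (Fin n) ℂ).compLinearMap (fun i => pairR (z i))
  have hf : ∀ x, f x = ∏ i, pair (z i) (x i) := fun x => rfl
  have hfX : ∀ κ : Fin n → Fin m, f (X κ) = ∏ i, z i (e (κ i)) := fun κ => by
    rw [hf]
    refine Finset.prod_congr rfl fun i _ => ?_
    simp [X, pair]
  -- The symmetry of `φ` makes its coefficients symmetric, so symmetrizing the basis tensors does
  -- not change the sum.
  have hsymm : ∀ (σ : Equiv.Perm (Fin n)),
      ∑ κ, c κ * f (fun i => X κ (σ i)) = ∑ κ, c κ * f (X κ) := by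
    intro σ
    rw [← (Equiv.arrowCongr σ (Equiv.refl (Fin m))).sum_comp]
    refine Finset.sum_congr rfl fun κ _ => ?_
    congr 1
    · have := φ.2.symm σ.symm (fun i => T.riesz p (e (κ i)))
      simpa [c] using this
    · congr 1
      funext i
      simp [X]
  have hev : ∀ ε : Fin n → ℤˣ, ∀ κ, (T.symTensor n (∑ i, ((ε i : ℤ) : ℂ) • X κ i)).1 z =
      f (fun _ => ∑ i, ((ε i : ℤ) : ℂ) • X κ i) := fun ε κ => rfl
  have h1 : ∀ κ, ∑ ε : Fin n → ℤˣ, (∏ i, ((ε i : ℤ) : ℂ)) *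
      (T.symTensor n (∑ i, ((ε i : ℤ) : ℂ) • X κ i)).1 z =
        2 ^ n * ∑ σ : Equiv.Perm (Fin n), f (fun i => X κ (σ i)) := fun κ => by
    simp only [hev]
    exact f.polarization (X κ)
  have h2 : φ.1 (fun i => T.adjProj p e (z i)) = ∑ κ, c κ * f (X κ) := by
    simp only [adjProj]
    rw [φ.1.map_sum (fun i j => z i (e j) • T.riesz p (e j))]
    refine Finset.sum_congr rfl fun κ _ => ?_
    rw [φ.1.map_smul_univ, hfX, smul_eq_mul, mul_comm]
  rw [h2]
  have h3 : ∀ (s : Finset (Fin n → Fin m)) (g : (Fin n → Fin m) → T.SymPow n),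
      (∑ κ ∈ s, g κ).1 z = ∑ κ ∈ s, (g κ).1 z := fun s g => by
    rw [AddSubmonoidClass.coe_finsetSum, sum_apply]
  have h4 : ∀ (s : Finset (Fin n → ℤˣ)) (g : (Fin n → ℤˣ) → T.SymPow n),
      (∑ κ ∈ s, g κ).1 z = ∑ κ ∈ s, (g κ).1 z := fun s g => by
    rw [AddSubmonoidClass.coe_finsetSum, sum_apply]
  have h5 : ∀ (r : ℂ) (g : T.SymPow n), (r • g).1 z = r * g.1 z := fun r g => rfl
  simp only [h3, h5, h4, h1]
  have hfac : (n.factorial : ℂ) ≠ 0 := by exact_mod_cast n.factorial_ne_zero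
  calc ∑ κ, c κ * (2 ^ n * (n.factorial : ℂ))⁻¹ * (2 ^ n * ∑ σ : Equiv.Perm (Fin n),
        f (fun i => X κ (σ i)))
      = (n.factorial : ℂ)⁻¹ * ∑ σ : Equiv.Perm (Fin n), ∑ κ, c κ * f (fun i => X κ (σ i)) := by
        rw [Finset.sum_comm, Finset.mul_sum]
        refine Finset.sum_congr rfl fun κ _ => ?_
        rw [← Finset.mul_sum]
        field_simp
    _ = _ := by
        simp only [hsymm, Finset.sum_const, Finset.card_univ, Fintype.card_perm, Fintype.card_fin,
          nsmul_eq_mul]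
        rw [inv_mul_cancel_left₀ hfac]

/-- At least one factor is the small one; the others are at most `c`. -/
theorem prod_ite_le {n : ℕ} {s : Finset (Fin n)} (hs : s ≠ Finset.univ) {c δ : ℝ} (hc : 1 ≤ c)
    (hδ0 : 0 ≤ δ) (hδ : δ ≤ 1) : ∏ i, (if i ∈ s then c else δ) ≤ δ * c ^ n := by
  obtain ⟨i, hi⟩ : ∃ i, i ∉ s := by
    by_contra! h
    exact hs (Finset.eq_univ_of_forall h)
  rw [← Finset.mul_prod_erase _ _ (Finset.mem_univ i), if_neg hi]
  gcongr
  calc ∏ j ∈ Finset.univ.erase i, (if j ∈ s then c else δ) ≤ ∏ j ∈ Finset.univ.erase i, c := by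
        refine Finset.prod_le_prod (fun j _ => by split_ifs <;> linarith) fun j _ => by
          split_ifs <;> linarith
    _ = c ^ (Finset.univ.erase i).card := by simp
    _ ≤ c ^ n := pow_le_pow_right₀ hc ((Finset.card_le_univ _).trans_eq (by simp))

/-- Linear combinations of tensor powers are dense in the symmetric tensor power. -/
theorem exists_span_kerNorm_sub_le (T : NuclearTriple H N) (p p' : ℕ) {n : ℕ} (φ : T.SymPow n)
    {δ : ℝ} (hδ : 0 < δ) : ∃ ψ ∈ Submodule.span ℂ (Set.range (T.symTensor n)),
      T.kerNorm p (φ - ψ) ≤ δ ∧ T.kerNorm p' (φ - ψ) ≤ δ := by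
  -- Two Hilbert-Schmidt embeddings are needed: the one of `H_{p₂}` in `H_{p₁}` makes the projection
  -- error small, and those of `H_{p₁}` in `H_p` and `H_{p'}` turn a supremum bound into
  -- Hilbert-Schmidt bounds.
  obtain ⟨p₁, C₁, -, hC₁, hC₁'⟩ := T.exists_HSBound p p'
  obtain ⟨p₂, C₂, -, hC₂, -⟩ := T.exists_HSBound p₁ p₁
  obtain ⟨B, hB⟩ := φ.2.bounded p₂
  set c := √C₂ + 1 with hc
  have hc1 : 1 ≤ c := by rw [hc]; linarith [Real.sqrt_nonneg C₂]
  set A := 2 ^ n * (|B| * c ^ n) * √C₁ ^ n + 1 with hA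
  have hA0 : 0 < A := by positivity
  set δ' := min 1 (δ / A) with hδ'
  have hδ'0 : 0 < δ' := by positivity
  have hδ'1 : δ' ≤ 1 := min_le_left _ _
  obtain ⟨m, e, he, hproj⟩ := hC₂.exists_proj hδ'0
  obtain ⟨ψ, hψ, hψz⟩ := T.exists_span_eq_adjProj p₂ e φ
  refine ⟨ψ, hψ, ?_⟩
  have hsub : ∀ z ∈ T.Hneg p₁, z - T.adjProj p₂ e z ∈ T.Hneg p₂ ∧
      (T.dualNorm p₂ (z - T.adjProj p₂ e z)).toReal ≤ δ' * (T.dualNorm p₁ z).toReal := by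
    intro z hz
    have h1 : ∀ θ, ‖pair (z - T.adjProj p₂ e z) θ‖ ≤
        (δ' * (T.dualNorm p₁ z).toReal) * T.cnrm p₂ θ := by
      intro θ
      have h2 : pair (z - T.adjProj p₂ e z) θ =
          pair z (Cx.mk (θ.1 - T.proj p₂ e θ.1) (θ.2 - T.proj p₂ e θ.2)) := by
        have : pair (z - T.adjProj p₂ e z) θ = pair z θ - pair (T.adjProj p₂ e z) θ :=
          map_sub (pairL θ) _ _
        rw [this, pair_adjProj]
        simp only [pair, Cx.mk_fst, Cx.mk_snd, map_sub]
        ring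
      rw [h2]
      refine (T.norm_pair_le_mul hz _).trans ?_
      rw [mul_comm δ', mul_assoc]
      gcongr
      refine le_of_sq_le_sq ?_ (mul_nonneg hδ'0.le (T.cnrm_nonneg _ _))
      rw [mul_pow, sq_cnrm, sq_cnrm, mul_add, ← mul_pow, ← mul_pow]
      exact add_le_add (pow_le_pow_left₀ (T.nrm_nonneg _ _) (hproj _) 2)
        (pow_le_pow_left₀ (T.nrm_nonneg _ _) (hproj _) 2)
    exact ⟨T.mem_Hneg (by positivity) h1, T.toReal_dualNorm_le (by positivity) h1⟩
  have hadj : ∀ z ∈ T.Hneg p₁, T.adjProj p₂ e z ∈ T.Hneg p₂ ∧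
      (T.dualNorm p₂ (T.adjProj p₂ e z)).toReal ≤ c * (T.dualNorm p₁ z).toReal := by
    intro z hz
    have h1 := T.mem_Hneg_of_nrm_le (Real.sqrt_nonneg C₂) hC₂.nrm_le hz
    have h2 := hsub z hz
    have h3 := T.smul_mem_Hneg (-1) h2.1
    have h4 : T.adjProj p₂ e z = z + (-1 : ℂ) • (z - T.adjProj p₂ e z) := by
      ext ξ; simp
    have h5 := T.toReal_dualNorm_smul_le (-1) h2.1
    rw [norm_neg, norm_one, one_mul] at h5
    refine ⟨by rw [h4]; exact T.add_mem_Hneg h1.1 h3, ?_⟩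
    have h6 := T.toReal_dualNorm_add_le h1.1 h3
    rw [← h4] at h6
    have h7 : (0 : ℝ) ≤ (T.dualNorm p₁ z).toReal := ENNReal.toReal_nonneg
    have h8 := mul_le_mul_of_nonneg_right hδ'1 h7
    rw [hc, add_mul]
    linarith [h1.2, h2.2]
  have hdiff : ∀ z : Fin n → (N →L[ℝ] ℂ), (∀ i, z i ∈ T.Hneg p₁) →
      ‖(φ - ψ).1 z‖ ≤ (2 ^ n * (|B| * (δ' * c ^ n))) * ∏ i, (T.dualNorm p₁ (z i)).toReal := by
    intro z hz
    have h1 : (φ - ψ).1 z = φ.1 z - φ.1 (fun i => T.adjProj p₂ e (z i)) := by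
      rw [← hψz]; rfl
    have h2 : φ.1 z = φ.1 ((fun i => T.adjProj p₂ e (z i)) +
        fun i => z i - T.adjProj p₂ e (z i)) := by
      congr 1; funext i; simp
    -- Expanding `φ` at `z = P'z + (z - P'z)` gives one term for each subset of slots. The full
    -- subset is `φ(P'z, …, P'z)` and cancels; each other term has at least one small slot.
    rw [h1, h2, φ.1.map_add_univ, ← Finset.sum_erase_add _ _ (Finset.mem_univ Finset.univ),
      Finset.piecewise_univ, add_sub_cancel_right]
    have hP : (0 : ℝ) ≤ ∏ i, (T.dualNorm p₁ (z i)).toReal :=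
      Finset.prod_nonneg fun _ _ => ENNReal.toReal_nonneg
    have hterm : ∀ s ∈ Finset.univ.erase (Finset.univ : Finset (Fin n)),
        ‖φ.1 (s.piecewise (fun i => T.adjProj p₂ e (z i)) fun i => z i - T.adjProj p₂ e (z i))‖ ≤
          |B| * (δ' * c ^ n) * ∏ i, (T.dualNorm p₁ (z i)).toReal := by
      intro s hs
      have hmem : ∀ i, (s.piecewise (fun i => T.adjProj p₂ e (z i))
          fun i => z i - T.adjProj p₂ e (z i)) i ∈ T.Hneg p₂ := by
        intro i
        by_cases hi : i ∈ s
        · rw [Finset.piecewise_eq_of_mem _ _ _ hi]; exact (hadj _ (hz i)).1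
        · rw [Finset.piecewise_eq_of_notMem _ _ _ hi]; exact (hsub _ (hz i)).1
      refine (hB _ hmem).trans ?_
      rw [mul_assoc]
      refine (mul_le_mul_of_nonneg_right (le_abs_self B)
        (Finset.prod_nonneg fun _ _ => ENNReal.toReal_nonneg)).trans ?_
      refine mul_le_mul_of_nonneg_left ?_ (abs_nonneg B)
      refine (Finset.prod_le_prod (fun _ _ => ENNReal.toReal_nonneg) (g := fun i =>
        (if i ∈ s then c else δ') * (T.dualNorm p₁ (z i)).toReal) fun i _ => ?_).trans ?_
      · split_ifs with hi
        · rw [Finset.piecewise_eq_of_mem _ _ _ hi]; exact (hadj _ (hz i)).2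
        · rw [Finset.piecewise_eq_of_notMem _ _ _ hi]; exact (hsub _ (hz i)).2
      · rw [Finset.prod_mul_distrib]
        exact mul_le_mul_of_nonneg_right
          (prod_ite_le (Finset.ne_of_mem_erase hs) hc1 hδ'0.le hδ'1) hP
    refine (norm_sum_le _ _).trans ((Finset.sum_le_sum hterm).trans ?_)
    rw [Finset.sum_const, nsmul_eq_mul, mul_assoc (2 ^ n)]
    refine mul_le_mul_of_nonneg_right ?_ (by positivity)
    refine le_trans (Nat.cast_le.2 (Finset.card_le_univ _)) ?_
    simp
  have h1 : δ' * A ≤ δ := by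
    rw [← le_div_iff₀ hA0]; exact min_le_right _ _
  have h2 : 2 ^ n * (|B| * (δ' * c ^ n)) * √C₁ ^ n = δ' * (A - 1) := by rw [hA]; ring
  have h3 : δ' * (A - 1) ≤ δ := by nlinarith
  rw [← h2] at h3
  exact ⟨(hC₁.kerNorm_le (by positivity) hdiff).trans h3,
    (hC₁'.kerNorm_le (by positivity) hdiff).trans h3⟩

/-- Two norms appear because two candidates for the same Appell kernel may be continuous with
respect to different norms, and the lemma is applied to their difference. -/
theorem eq_zero_of_forall_symTensor (T : NuclearTriple H N) {p p' n : ℕ} {C C' : ℝ}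
    {L : T.SymPow n →ₗ[ℂ] ℂ} (hL : ∀ φ, ‖L φ‖ ≤ C * T.kerNorm p φ + C' * T.kerNorm p' φ)
    (h : ∀ θ, L (T.symTensor n θ) = 0) : L = 0 := by
  ext φ
  rw [LinearMap.zero_apply, ← norm_le_zero_iff]
  refine le_of_forall_pos_le_add fun δ hδ => ?_
  obtain ⟨ψ, hψ, hle, hle'⟩ := T.exists_span_kerNorm_sub_le p p' φ
    (δ := δ / (|C| + |C'| + 1)) (by positivity)
  have h0 : L ψ = 0 := by
    have : Submodule.span ℂ (Set.range (T.symTensor n)) ≤ LinearMap.ker L := by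
      rw [Submodule.span_le]
      rintro _ ⟨θ, rfl⟩
      exact h θ
    exact this hψ
  have h1 : L φ = L (φ - ψ) := by rw [map_sub, h0, sub_zero]
  rw [h1, zero_add]
  calc ‖L (φ - ψ)‖ ≤ C * T.kerNorm p (φ - ψ) + C' * T.kerNorm p' (φ - ψ) := hL _
    _ ≤ |C| * (δ / (|C| + |C'| + 1)) + |C'| * (δ / (|C| + |C'| + 1)) := by
        have h2 := T.kerNorm_nonneg p (φ - ψ)
        have h3 := T.kerNorm_nonneg p' (φ - ψ)
        gcongr <;> exact le_abs_self _
    _ ≤ (|C| + |C'| + 1) * (δ / (|C| + |C'| + 1)) := by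
        have : 0 ≤ δ / (|C| + |C'| + 1) := by positivity
        linarith
    _ = δ := by field_simp

/-! ## Polarization of bounded homogeneous polynomials -/

theorem cnrm_eq_norm (T : NuclearTriple H N) (p : ℕ) (θ : Cx N) :
    T.cnrm p θ = ‖(⟨T.nrm p θ.1, T.nrm p θ.2⟩ : ℂ)‖ := by
  rw [Complex.norm_eq_sqrt_sq_add_sq, cnrm_eq]

theorem cnrm_add_le (T : NuclearTriple H N) (p : ℕ) (θ ζ : Cx N) :
    T.cnrm p (θ + ζ) ≤ T.cnrm p θ + T.cnrm p ζ := by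
  rw [T.cnrm_eq_norm p θ, T.cnrm_eq_norm p ζ]
  refine le_trans ?_ (norm_add_le _ _)
  rw [Complex.norm_eq_sqrt_sq_add_sq, cnrm_eq]
  apply Real.sqrt_le_sqrt
  exact add_le_add (pow_le_pow_left₀ (T.nrm_nonneg _ _) (T.nrm_add_le _ _ _) 2)
    (pow_le_pow_left₀ (T.nrm_nonneg _ _) (T.nrm_add_le _ _ _) 2)

theorem cnrm_sum_le (T : NuclearTriple H N) (p : ℕ) {ι : Type*} (s : Finset ι) (θ : ι → Cx N) :
    T.cnrm p (∑ i ∈ s, θ i) ≤ ∑ i ∈ s, T.cnrm p (θ i) := by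
  classical
  induction s using Finset.induction_on with
  | empty => simp [cnrm_zero]
  | insert i s hi ih =>
    rw [Finset.sum_insert hi, Finset.sum_insert hi]
    exact (T.cnrm_add_le _ _ _).trans (add_le_add le_rfl ih)

theorem cnrm_mk_zero (T : NuclearTriple H N) (p : ℕ) (ξ : N) :
    T.cnrm p (Cx.mk ξ 0) = T.nrm p ξ := by
  simp [cnrm, nrm]

/-- `lin e` as a linear map. -/
def linL {m : ℕ} (e : Fin m → N) : (Fin m → ℂ) →ₗ[ℂ] Cx N where
  toFun := lin e
  map_add' := lin_add e
  map_smul' := lin_smul e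

theorem linL_apply {m : ℕ} (e : Fin m → N) (w : Fin m → ℂ) : linL e w = lin e w := rfl

theorem lin_single {m : ℕ} (e : Fin m → N) (k : Fin m) :
    lin e (Pi.single k 1) = Cx.mk (e k) 0 := by
  classical
  apply Cx.ext
  · rw [lin_fst, Finset.sum_eq_single k] <;> simp +contextual
  · rw [lin_snd, Finset.sum_eq_single k] <;> simp +contextual

/-- A homogeneous polynomial that is bounded with respect to `|·|_{p₀}` has a finite
Hilbert-Schmidt norm with respect to `|·|_p` if the embedding of `H_p` in `H_{p₀}` is
Hilbert-Schmidt. -/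
theorem HSPoly.of_bound {T : NuclearTriple H N} {p p₀ n : ℕ} {a : Cx N → ℂ} {K b C : ℝ}
    (hK : T.HSPoly p n a K) (hb : 0 ≤ b) (ha : ∀ θ, ‖a θ‖ ≤ b * T.cnrm p₀ θ ^ n)
    (h : T.HSBound p p₀ C) :
    T.HSPoly p n a (b * (Real.exp 1 * √C) ^ n) := by
  classical
  intro m e he
  obtain ⟨c, hc, -⟩ := hK m e he
  have hn0 : (n.factorial : ℂ) ≠ 0 := by exact_mod_cast n.factorial_ne_zero
  let A : MultilinearMap ℂ (fun _ : Fin n => (Fin m → ℂ)) ℂ :=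
    ∑ κ : Fin n → Fin m, c κ • (MultilinearMap.mkPiAlgebra ℂ (Fin n) ℂ).compLinearMap
      (fun i => LinearMap.proj (κ i))
  have hA : ∀ x, A x = ∑ κ, c κ * ∏ i, x i (κ i) := fun x => by
    simp [A, sum_apply]
  have hdiag : ∀ w, A (fun _ => w) = a (lin e w) := fun w => by rw [hA, hc]
  -- The assumption `hK` serves only to make `a` a polynomial in coordinates. The coefficients with
  -- the good bound are those of the symmetrization `S`, evaluated on basis vectors normalized in
  -- `|·|_{p₀}`.
  let S : (Fin n → Fin m → ℂ) → ℂ := fun x =>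
    (n.factorial : ℂ)⁻¹ * ∑ σ : Equiv.Perm (Fin n), A (fun i => x (σ i))
  let u : Fin m → Fin m → ℂ := fun k => ((T.nrm p₀ (e k))⁻¹ : ℂ) • Pi.single k 1
  have hpos : ∀ k, 0 < T.nrm p₀ (e k) := fun k =>
    lt_of_le_of_ne (T.nrm_nonneg _ _) fun h0 => by
      have := he.nrm_eq_one k
      rw [T.nrm_eq_zero h0.symm] at this
      simp [nrm] at this
  have hu : ∀ k, T.cnrm p₀ (lin e (u k)) = 1 := fun k => by
    rw [lin_smul, cnrm_csmul, lin_single, cnrm_mk_zero, norm_inv, Complex.norm_real,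
      Real.norm_of_nonneg (hpos k).le, inv_mul_cancel₀ (hpos k).ne']
  have hSsmul : ∀ κ : Fin n → Fin m, S (fun i => Pi.single (κ i) 1) =
      (∏ i, (T.nrm p₀ (e (κ i)) : ℂ)) * S (fun i => u (κ i)) := by
    intro κ
    have h1 : ∀ k, (Pi.single k 1 : Fin m → ℂ) = (T.nrm p₀ (e k) : ℂ) • u k := fun k => by
      simp only [u, smul_smul]
      rw [mul_inv_cancel₀ (by exact_mod_cast (hpos k).ne'), one_smul]
    simp only [S, Finset.mul_sum]
    refine Finset.sum_congr rfl fun σ _ => ?_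
    simp only [h1]
    rw [A.map_smul_univ (fun i => (T.nrm p₀ (e (κ (σ i))) : ℂ)),
      Equiv.prod_comp σ (fun i => (T.nrm p₀ (e (κ i)) : ℂ)), smul_eq_mul]
    ring
  have hSu : ∀ κ : Fin n → Fin m, ‖S (fun i => u (κ i))‖ ≤ b * Real.exp 1 ^ n := by
    intro κ
    have h1 := A.polarization (fun i => u (κ i))
    have h2 : S (fun i => u (κ i)) = (2 ^ n * (n.factorial : ℂ))⁻¹ *
        ∑ ε : Fin n → ℤˣ, (∏ i, ((ε i : ℤ) : ℂ)) *
          A (fun _ => ∑ i, ((ε i : ℤ) : ℂ) • u (κ i)) := by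
      rw [h1]
      simp only [S]
      field_simp
    have hε : ∀ u : ℤˣ, ‖((u : ℤ) : ℂ)‖ = 1 := fun u => by
      rcases Int.units_eq_one_or u with h | h <;> simp [h]
    have h3 : ∀ ε : Fin n → ℤˣ, ‖(∏ i, ((ε i : ℤ) : ℂ)) *
        A (fun _ => ∑ i, ((ε i : ℤ) : ℂ) • u (κ i))‖ ≤ b * (n : ℝ) ^ n := by
      intro ε
      rw [norm_mul, norm_prod, Finset.prod_congr rfl fun i _ => hε (ε i), Finset.prod_const_one,
        one_mul, hdiag]
      refine (ha _).trans ?_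
      refine mul_le_mul_of_nonneg_left (pow_le_pow_left₀ (T.cnrm_nonneg _ _) ?_ n) hb
      rw [← linL_apply, map_sum]
      refine (T.cnrm_sum_le _ _ _).trans_eq ?_
      simp only [map_smul, cnrm_csmul, hε, linL_apply, hu]
      simp
    rw [h2, norm_mul]
    have h4 := norm_sum_le_of_le Finset.univ fun ε _ => h3 ε
    rw [Finset.sum_const, nsmul_eq_mul] at h4
    have h5 : ((Finset.univ : Finset (Fin n → ℤˣ)).card : ℝ) = 2 ^ n := by simp
    rw [h5] at h4
    -- The polarization constant: the signed sums have norm at most `n`, and division by `n!` leaves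
    -- `n^n / n! ≤ e^n`.
    have h6 : (n : ℝ) ^ n / n.factorial ≤ Real.exp 1 ^ n := by
      rw [← Real.exp_nat_mul, mul_one]
      exact Real.pow_div_factorial_le_exp _ (Nat.cast_nonneg n) n
    calc _ ≤ ‖(2 ^ n * (n.factorial : ℂ))⁻¹‖ * (2 ^ n * (b * n ^ n)) := by gcongr
      _ = b * (n ^ n / n.factorial) := by
          rw [norm_inv, norm_mul, norm_pow, Complex.norm_two, Complex.norm_natCast]
          field_simp
      _ ≤ _ := by gcongr
  refine ⟨fun κ => S (fun i => Pi.single (κ i) 1), fun w => ?_, ?_⟩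
  · have hw : w = ∑ k, w k • (Pi.single k 1 : Fin m → ℂ) := by
      funext j
      simp [Finset.sum_apply, Pi.single_apply]
    have h1 : ∀ σ : Equiv.Perm (Fin n),
        ∑ κ : Fin n → Fin m, (∏ i, w (κ i)) * A (fun i => Pi.single (κ (σ i)) 1) =
          a (lin e w) := by
      intro σ
      rw [← hdiag w]
      conv_rhs => rw [hw]
      rw [A.map_sum (fun _ k => w k • (Pi.single k 1 : Fin m → ℂ)),
        ← (Equiv.arrowCongr σ (Equiv.refl (Fin m))).sum_comp]
      refine Finset.sum_congr rfl fun κ _ => ?_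
      rw [A.map_smul_univ, smul_eq_mul]
      congr 1
      · exact Equiv.prod_comp σ.symm (fun i => w (κ i))
      · congr 1; funext i; simp
    simp only [S, mul_assoc, Finset.sum_mul, Finset.mul_sum]
    rw [Finset.sum_comm]
    have h2 : ∀ σ : Equiv.Perm (Fin n), ∑ κ : Fin n → Fin m, (n.factorial : ℂ)⁻¹ *
        (A (fun i => Pi.single (κ (σ i)) 1) * ∏ i, w (κ i)) =
          (n.factorial : ℂ)⁻¹ * a (lin e w) := fun σ => by
      rw [← h1 σ, Finset.mul_sum]
      exact Finset.sum_congr rfl fun κ _ => by ring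
    simp only [h2, Finset.sum_const, Finset.card_univ, Fintype.card_perm, Fintype.card_fin,
      nsmul_eq_mul]
    rw [mul_inv_cancel_left₀ hn0]
  · refine Real.sqrt_le_iff.2 ⟨by positivity, ?_⟩
    calc ∑ κ : Fin n → Fin m, ‖S (fun i => Pi.single (κ i) 1)‖ ^ 2
        ≤ ∑ κ : Fin n → Fin m, (b * Real.exp 1 ^ n) ^ 2 * ∏ i, T.nrm p₀ (e (κ i)) ^ 2 := by
          refine Finset.sum_le_sum fun κ _ => ?_
          rw [hSsmul, norm_mul, norm_prod, mul_pow, mul_comm, ← Finset.prod_pow]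
          simp only [Complex.norm_real, Real.norm_of_nonneg (T.nrm_nonneg _ _)]
          exact mul_le_mul_of_nonneg_right (pow_le_pow_left₀ (norm_nonneg _) (hSu κ) 2)
            (Finset.prod_nonneg fun _ _ => sq_nonneg _)
      _ = (b * Real.exp 1 ^ n) ^ 2 * (∑ k, T.nrm p₀ (e k) ^ 2) ^ n := by
          rw [← Finset.mul_sum, Finset.sum_pow', Fintype.piFinset_univ]
      _ ≤ (b * Real.exp 1 ^ n) ^ 2 * C ^ n := by
          gcongr
          exact h m e he
      _ = (b * (Real.exp 1 * √C) ^ n) ^ 2 := by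
          have : C ^ n = (√C ^ n) ^ 2 := by
            rw [← pow_mul, mul_comm n 2, pow_mul, Real.sq_sqrt h.nonneg]
          rw [this]; ring

end NuclearTriple

/-! ### Derivatives at zero of sums of power series -/

theorem hasFPowerSeriesOnBall_ofScalars_of_hasSum {c : ℕ → ℂ} {f : ℂ → ℂ} {r : ℝ} (hr : 0 < r)
    (h : ∀ t : ℂ, ‖t‖ < r → HasSum (fun k => c k * t ^ k) (f t)) :
    HasFPowerSeriesOnBall f (.ofScalars ℂ c) 0 (ENNReal.ofReal r) := by
  have h' : ∀ t : ℂ, ‖t‖ < r →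
      HasSum (fun k => (FormalMultilinearSeries.ofScalars ℂ c k) fun _ => t) (f t) := by
    intro t ht
    simpa [mul_comm] using h t ht
  refine ⟨?_, by simpa using hr, fun {y} hy => ?_⟩
  · refine le_of_forall_lt_imp_le_of_dense fun s hs => ?_
    lift s to NNReal using hs.ne_top
    apply FormalMultilinearSeries.le_radius_of_summable
    have hs' : ‖((s : ℝ) : ℂ)‖ < r := by
      rw [Complex.norm_real, NNReal.norm_eq]
      have := (ENNReal.lt_ofReal_iff_toReal_lt hs.ne_top).1 hs
      simpa using this
    simpa using (h _ hs').summable.norm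
  · rw [zero_add]
    refine h' y ?_
    rw [Metric.mem_eball, edist_zero_right, ← ofReal_norm] at hy
    exact (ENNReal.ofReal_lt_ofReal_iff hr).1 hy

theorem iteratedDeriv_of_hasSum {c : ℕ → ℂ} {f : ℂ → ℂ} {r : ℝ} (hr : 0 < r)
    (h : ∀ t : ℂ, ‖t‖ < r → HasSum (fun k => c k * t ^ k) (f t)) (n : ℕ) :
    iteratedDeriv n f 0 = n.factorial * c n := by
  have h1 := (hasFPowerSeriesOnBall_ofScalars_of_hasSum hr h).factorial_smul 1 n
  rw [← iteratedDeriv_eq_iteratedFDeriv] at h1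
  rw [← h1]
  simp

namespace NuclearTriple

variable {H N : Type*} [NormedAddCommGroup H] [InnerProductSpace ℝ H]
  [AddCommGroup N] [Module ℝ N] [TopologicalSpace N] [IsTopologicalAddGroup N]

attribute [local instance] cylinder

theorem measurable_dual_apply (ξ : N) : Measurable fun x : N →L[ℝ] ℝ => x ξ :=
  Measurable.of_comap_le (le_iSup (fun ξ : N =>
    MeasurableSpace.comap (fun x : N →L[ℝ] ℝ => x ξ) (borel ℝ)) ξ)

theorem pair_ofRealDual (x : N →L[ℝ] ℝ) (θ : Cx N) :
    pair (ofRealDual x) θ = x θ.1 + Complex.I * x θ.2 := rfl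

theorem measurable_pair_ofRealDual (θ : Cx N) :
    Measurable fun x : N →L[ℝ] ℝ => pair (ofRealDual x) θ := by
  simp only [pair_ofRealDual]
  exact (Complex.measurable_ofReal.comp (measurable_dual_apply _)).add
    ((Complex.measurable_ofReal.comp (measurable_dual_apply _)).const_mul _)

theorem pair_lin_ofRealDual {m : ℕ} (e : Fin m → N) (w : Fin m → ℂ) (x : N →L[ℝ] ℝ) :
    pair (ofRealDual x) (lin e w) = ∑ i, w i * x (e i) := pair_lin e w _

/-! ## Moments of an admissible measure -/

/-- The moments `∫ ⟨x, θ⟩^k dμ(x)`. -/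
def moment (μ : DualMeasure N) (k : ℕ) (θ : Cx N) : ℂ := ∫ x, pair (ofRealDual x) θ ^ k ∂μ

/-- The norm `|x|_{-p}` of `x ∈ N'`, as a real number. -/
def realDualNorm (T : NuclearTriple H N) (p : ℕ) (x : N →L[ℝ] ℝ) : ℝ :=
  (T.dualNorm p (ofRealDual x)).toReal

theorem realDualNorm_nonneg (T : NuclearTriple H N) (p : ℕ) (x : N →L[ℝ] ℝ) :
    0 ≤ T.realDualNorm p x := ENNReal.toReal_nonneg

namespace IsAdmissible

variable {T : NuclearTriple H N} {μ : DualMeasure N} {p₀ q₀ : ℕ}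

theorem ae_norm_pair_le (h : T.IsAdmissible μ p₀ q₀) : ∀ᵐ x ∂μ, ∀ θ : Cx N,
    ‖pair (ofRealDual x) θ‖ ≤ T.realDualNorm p₀ x * T.cnrm p₀ θ := by
  filter_upwards [h.1] with x hx θ using T.norm_pair_le_mul hx θ

theorem integrable_exp_norm (h : T.IsAdmissible μ p₀ q₀) :
    Integrable (fun x => Real.exp (((2 : ℝ) ^ q₀)⁻¹ * T.realDualNorm p₀ x)) μ := h.2.1

/-- Admissibility only asserts integrability of the exponential, and the norm is recovered from it
by a logarithm. -/
theorem aestronglyMeasurable_norm (h : T.IsAdmissible μ p₀ q₀) :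
    AEStronglyMeasurable (fun x => T.realDualNorm p₀ x) μ := by
  have h1 : AEMeasurable (fun x => ((2 : ℝ) ^ q₀) *
      Real.log (Real.exp (((2 : ℝ) ^ q₀)⁻¹ * T.realDualNorm p₀ x))) μ :=
    (Real.measurable_log.comp_aemeasurable
      h.integrable_exp_norm.aestronglyMeasurable.aemeasurable).const_mul _
  refine (h1.congr (Eventually.of_forall fun x => ?_)).aestronglyMeasurable
  simp only [Real.log_exp]
  rw [mul_inv_cancel_left₀ (by positivity)]

theorem integrable_norm_pow (h : T.IsAdmissible μ p₀ q₀) (k : ℕ) :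
    Integrable (fun x => T.realDualNorm p₀ x ^ k) μ := by
  refine (h.integrable_exp_norm.const_mul (k.factorial * ((2 : ℝ) ^ q₀) ^ k)).mono'
    (h.aestronglyMeasurable_norm.pow k) (Eventually.of_forall fun x => ?_)
  rw [Real.norm_of_nonneg (pow_nonneg (T.realDualNorm_nonneg _ _) _)]
  have h1 := Real.pow_div_factorial_le_exp (((2 : ℝ) ^ q₀)⁻¹ * T.realDualNorm p₀ x)
    (mul_nonneg (by positivity) (T.realDualNorm_nonneg _ _)) k
  rw [div_le_iff₀ (by positivity), mul_pow, inv_pow, inv_mul_le_iff₀ (by positivity)] at h1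
  linarith

/-- Termwise integration of the exponential series is dominated by the series of `exp(2^{-q₀}
|x|_{-p₀})`, which is integrable; this is why the closed ball is allowed. -/
theorem hasSum_laplace (h : T.IsAdmissible μ p₀ q₀) {θ : Cx N}
    (hθ : T.cnrm p₀ θ ≤ ((2 : ℝ) ^ q₀)⁻¹) :
    HasSum (fun k => ((k.factorial : ℂ))⁻¹ * moment μ k θ) (laplace μ θ) := by
  simp only [moment, ← integral_const_mul]
  refine hasSum_integral_of_dominated_convergence
    (fun k x => ((k.factorial : ℝ))⁻¹ * (((2 : ℝ) ^ q₀)⁻¹ * T.realDualNorm p₀ x) ^ k)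
    (fun k => ((measurable_pair_ofRealDual θ).pow_const k).const_mul _ |>.aestronglyMeasurable)
    (fun k => ?_) (Eventually.of_forall fun x => ?_) ?_ (Eventually.of_forall fun x => ?_)
  · filter_upwards [h.ae_norm_pair_le] with x hx
    rw [norm_mul, norm_inv, Complex.norm_natCast, norm_pow]
    gcongr
    refine (hx θ).trans ?_
    rw [mul_comm]
    exact mul_le_mul_of_nonneg_right hθ (T.realDualNorm_nonneg _ _)
  · simpa [div_eq_inv_mul] using Real.summable_pow_div_factorial _
  · refine h.integrable_exp_norm.congr (Eventually.of_forall fun x => ?_)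
    simp only [Real.exp_eq_exp_ℝ, NormedSpace.exp_eq_tsum_div, div_eq_inv_mul]
  · have := NormedSpace.expSeries_div_hasSum_exp (pair (ofRealDual x) θ)
    rw [← Complex.exp_eq_exp_ℂ] at this
    simpa [div_eq_inv_mul] using this

theorem moment_smul (μ : DualMeasure N) (k : ℕ) (t : ℂ) (θ : Cx N) :
    moment μ k (t • θ) = t ^ k * moment μ k θ := by
  simp only [moment, pair_smul, mul_pow, integral_const_mul]

theorem hasSum_laplace_smul (h : T.IsAdmissible μ p₀ q₀) {θ : Cx N} {t : ℂ}
    (ht : ‖t‖ * T.cnrm p₀ θ ≤ ((2 : ℝ) ^ q₀)⁻¹) :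
    HasSum (fun k => (((k.factorial : ℂ))⁻¹ * moment μ k θ) * t ^ k) (laplace μ (t • θ)) := by
  refine (h.hasSum_laplace (θ := t • θ) (by rwa [cnrm_csmul])).congr_fun fun k => ?_
  rw [moment_smul]; ring

theorem exists_radius (T : NuclearTriple H N) (p₀ q₀ : ℕ) (θ : Cx N) :
    ∃ r : ℝ, 0 < r ∧ ∀ t : ℂ, ‖t‖ < r → ‖t‖ * T.cnrm p₀ θ < ((2 : ℝ) ^ q₀)⁻¹ := by
  -- The summand `1` covers `θ = 0`.
  refine ⟨((2 : ℝ) ^ q₀)⁻¹ / (T.cnrm p₀ θ + 1), ?_, fun t ht => ?_⟩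
  · have := T.cnrm_nonneg p₀ θ
    positivity
  · have := T.cnrm_nonneg p₀ θ
    rw [lt_div_iff₀ (by positivity)] at ht
    nlinarith [norm_nonneg t]

theorem iteratedDeriv_laplace (h : T.IsAdmissible μ p₀ q₀) (θ : Cx N) (k : ℕ) :
    iteratedDeriv k (fun t : ℂ => laplace μ (t • θ)) 0 = moment μ k θ := by
  obtain ⟨r, hr, hr'⟩ := exists_radius T p₀ q₀ θ
  rw [iteratedDeriv_of_hasSum hr fun t ht => h.hasSum_laplace_smul (hr' t ht).le,
    mul_inv_cancel_left₀ (by exact_mod_cast k.factorial_ne_zero)]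

theorem isOpen_disc (T : NuclearTriple H N) (p₀ q₀ : ℕ) (θ : Cx N) :
    IsOpen {t : ℂ | ‖t‖ * T.cnrm p₀ θ < ((2 : ℝ) ^ q₀)⁻¹} :=
  isOpen_lt (by fun_prop) continuous_const

theorem differentiableAt_laplace (h : T.IsAdmissible μ p₀ q₀) {θ : Cx N} {t : ℂ}
    (ht : ‖t‖ * T.cnrm p₀ θ < ((2 : ℝ) ^ q₀)⁻¹) :
    DifferentiableAt ℂ (fun t : ℂ => laplace μ (t • θ)) t := by
  -- A slightly larger disc puts `t` in the interior of the domain of convergence.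
  obtain ⟨r, htr, hr⟩ : ∃ r : ℝ, ‖t‖ < r ∧ r * T.cnrm p₀ θ < ((2 : ℝ) ^ q₀)⁻¹ := by
    have hc : Tendsto (fun r : ℝ => r * T.cnrm p₀ θ) (𝓝[>] ‖t‖) (𝓝 (‖t‖ * T.cnrm p₀ θ)) :=
      ((continuous_id.mul continuous_const).tendsto _).mono_left nhdsWithin_le_nhds
    exact ((eventually_mem_nhdsWithin).and (hc.eventually (gt_mem_nhds ht))).exists
  have h0 : 0 < r := (norm_nonneg t).trans_lt htr
  have h1 : HasFPowerSeriesOnBall (fun t : ℂ => laplace μ (t • θ)) _ 0 (ENNReal.ofReal r) :=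
    hasFPowerSeriesOnBall_ofScalars_of_hasSum h0 fun s hs => h.hasSum_laplace_smul
      ((mul_le_mul_of_nonneg_right hs.le (T.cnrm_nonneg _ _)).trans hr.le)
  refine (h1.analyticAt_of_mem ?_).differentiableAt
  rw [Metric.mem_eball, edist_zero_right, ← ofReal_norm]
  exact (ENNReal.ofReal_lt_ofReal_iff h0).2 htr

theorem le_norm_laplace {c : ℝ} (hc : ∀ θ : Cx N, 2 ^ q₀ * T.cnrm p₀ θ < 1 → c ≤ ‖laplace μ θ‖)
    {θ : Cx N} {t : ℂ} (ht : ‖t‖ * T.cnrm p₀ θ < ((2 : ℝ) ^ q₀)⁻¹) :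
    c ≤ ‖laplace μ (t • θ)‖ := by
  refine hc _ ?_
  rw [cnrm_csmul, mul_comm]
  rw [← one_div, lt_div_iff₀ (by positivity)] at ht
  linarith

theorem laplace_ne_zero (h : T.IsAdmissible μ p₀ q₀) {θ : Cx N} {t : ℂ}
    (ht : ‖t‖ * T.cnrm p₀ θ < ((2 : ℝ) ^ q₀)⁻¹) : laplace μ (t • θ) ≠ 0 := by
  obtain ⟨c, hc0, hc⟩ := h.2.2
  exact norm_pos_iff.1 (hc0.trans_le (le_norm_laplace hc ht))

theorem differentiableAt_inv_laplace (h : T.IsAdmissible μ p₀ q₀) {θ : Cx N} {t : ℂ}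
    (ht : ‖t‖ * T.cnrm p₀ θ < ((2 : ℝ) ^ q₀)⁻¹) :
    DifferentiableAt ℂ (fun t : ℂ => (laplace μ (t • θ))⁻¹) t :=
  (h.differentiableAt_laplace ht).inv (h.laplace_ne_zero ht)

theorem analyticAt_inv_laplace (h : T.IsAdmissible μ p₀ q₀) (θ : Cx N) :
    AnalyticAt ℂ (fun t : ℂ => (laplace μ (t • θ))⁻¹) 0 := by
  have h0 : (0 : ℂ) ∈ {t : ℂ | ‖t‖ * T.cnrm p₀ θ < ((2 : ℝ) ^ q₀)⁻¹} := by simp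
  exact DifferentiableOn.analyticAt
    (fun t ht => (h.differentiableAt_inv_laplace ht).differentiableWithinAt)
    ((isOpen_disc T p₀ q₀ θ).mem_nhds h0)

theorem analyticAt_laplace (h : T.IsAdmissible μ p₀ q₀) (θ : Cx N) :
    AnalyticAt ℂ (fun t : ℂ => laplace μ (t • θ)) 0 := by
  have h0 : (0 : ℂ) ∈ {t : ℂ | ‖t‖ * T.cnrm p₀ θ < ((2 : ℝ) ^ q₀)⁻¹} := by simp
  exact DifferentiableOn.analyticAt
    (fun t ht => (h.differentiableAt_laplace ht).differentiableWithinAt)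
    ((isOpen_disc T p₀ q₀ θ).mem_nhds h0)

end IsAdmissible

/-- The derivatives of `t ↦ 1 / l_μ(tθ)` at zero. -/
def invDeriv (μ : DualMeasure N) (n : ℕ) (θ : Cx N) : ℂ :=
  iteratedDeriv n (fun t : ℂ => (laplace μ (t • θ))⁻¹) 0

/-! ### Derivatives of the reciprocal Laplace transform -/

namespace IsAdmissible

variable {T : NuclearTriple H N} {μ : DualMeasure N} {p₀ q₀ : ℕ}

theorem norm_invDeriv_le (h : T.IsAdmissible μ p₀ q₀) {c : ℝ} (hc0 : 0 < c)
    (hc : ∀ θ : Cx N, 2 ^ q₀ * T.cnrm p₀ θ < 1 → c ≤ ‖laplace μ θ‖) (n : ℕ) (θ : Cx N) :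
    ‖invDeriv μ n θ‖ ≤ n.factorial * c⁻¹ * (2 ^ q₀) ^ n * T.cnrm p₀ θ ^ n := by
  have hθ := T.cnrm_nonneg p₀ θ
  -- Cauchy's estimate on the circle of radius `(2^{q₀} |θ|_{p₀} + δ)⁻¹`. A positive `δ` keeps the
  -- closed disc inside the admissible region and covers `θ = 0`; it tends to zero afterwards.
  have key : ∀ δ : ℝ, 0 < δ →
      ‖invDeriv μ n θ‖ ≤ n.factorial * c⁻¹ * (2 ^ q₀ * T.cnrm p₀ θ + δ) ^ n := by
    intro δ hδ
    have hA : 0 < 2 ^ q₀ * T.cnrm p₀ θ + δ := by positivity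
    have hr : 0 < (2 ^ q₀ * T.cnrm p₀ θ + δ)⁻¹ := inv_pos.2 hA
    have hdisc : ∀ t : ℂ, ‖t‖ ≤ (2 ^ q₀ * T.cnrm p₀ θ + δ)⁻¹ →
        ‖t‖ * T.cnrm p₀ θ < ((2 : ℝ) ^ q₀)⁻¹ := by
      intro t ht
      refine (mul_le_mul_of_nonneg_right ht hθ).trans_lt ?_
      rw [inv_mul_lt_iff₀ hA, ← div_eq_mul_inv, lt_div_iff₀ (by positivity)]
      linarith
    have h1 := Complex.norm_iteratedDeriv_le_of_forall_mem_sphere_norm_le (c := 0)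
      (f := fun t : ℂ => (laplace μ (t • θ))⁻¹) n hr (C := c⁻¹)
      (DifferentiableOn.diffContOnCl fun t ht => by
        rw [closure_ball _ hr.ne'] at ht
        exact (h.differentiableAt_inv_laplace
          (hdisc t (by simpa using ht))).differentiableWithinAt)
      (fun t ht => by
        rw [norm_inv]
        exact inv_anti₀ hc0 (le_norm_laplace hc (hdisc t (by simpa using ht.le))))
    refine h1.trans_eq ?_
    rw [inv_pow, div_inv_eq_mul]
  have hlim : Tendsto (fun δ : ℝ => n.factorial * c⁻¹ * (2 ^ q₀ * T.cnrm p₀ θ + δ) ^ n) (𝓝[>] 0)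
      (𝓝 (n.factorial * c⁻¹ * (2 ^ q₀ * T.cnrm p₀ θ + 0) ^ n)) :=
    (Continuous.tendsto (by fun_prop) 0).mono_left nhdsWithin_le_nhds
  refine (ge_of_tendsto hlim ?_).trans_eq ?_
  · filter_upwards [self_mem_nhdsWithin] with δ hδ using key δ hδ
  · rw [add_zero, mul_pow]; ring

/-- The coefficients are the mixed moments `∫ ∏ x(e_{κᵢ}) dμ`, each bounded by `∫ |x|_{-p₀}^k dμ`
times the product of the norms `|e_{κᵢ}|_{p₀}`; the Hilbert-Schmidt bound sums these squares. -/
theorem hsPoly_moment (h : T.IsAdmissible μ p₀ q₀) {p : ℕ} {C : ℝ} (hC : T.HSBound p p₀ C)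
    (k : ℕ) : ∃ K, T.HSPoly p k (moment μ k) K := by
  refine ⟨(∫ x, T.realDualNorm p₀ x ^ k ∂μ) * √C ^ k, fun m e he => ?_⟩
  have hbound : ∀ κ : Fin k → Fin m, ∀ᵐ x ∂μ, ‖∏ i, ((x (e (κ i)) : ℝ) : ℂ)‖ ≤
      T.realDualNorm p₀ x ^ k * ∏ i, T.nrm p₀ (e (κ i)) := by
    intro κ
    filter_upwards [h.ae_norm_pair_le] with x hx
    rw [norm_prod]
    calc ∏ i, ‖((x (e (κ i)) : ℝ) : ℂ)‖ ≤ ∏ i, (T.realDualNorm p₀ x * T.nrm p₀ (e (κ i))) := by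
          refine Finset.prod_le_prod (fun _ _ => norm_nonneg _) fun i _ => ?_
          have := hx (Cx.mk (e (κ i)) 0)
          rw [cnrm_mk_zero] at this
          simpa [pair_ofRealDual] using this
      _ = _ := by simp [Finset.prod_mul_distrib]
  have hint : ∀ κ : Fin k → Fin m, Integrable (fun x => ∏ i, ((x (e (κ i)) : ℝ) : ℂ)) μ :=
    fun κ => ((h.integrable_norm_pow k).mul_const _).mono'
      (Finset.measurable_prod _ fun i _ => Complex.measurable_ofReal.comp
        (measurable_dual_apply _)).aestronglyMeasurable (hbound κ)
  refine ⟨fun κ => ∫ x, ∏ i, ((x (e (κ i)) : ℝ) : ℂ) ∂μ, fun w => ?_, ?_⟩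
  · simp only [moment, pair_lin_ofRealDual, ← integral_mul_const]
    rw [← integral_finsetSum _ fun κ _ => (hint κ).mul_const _]
    refine integral_congr_ae (Eventually.of_forall fun x => ?_)
    simp only
    rw [Finset.sum_pow', Fintype.piFinset_univ]
    refine Finset.sum_congr rfl fun κ _ => ?_
    rw [Finset.prod_mul_distrib, mul_comm]
  · have hI : 0 ≤ ∫ x, T.realDualNorm p₀ x ^ k ∂μ :=
      integral_nonneg fun x => pow_nonneg (T.realDualNorm_nonneg _ _) _
    refine Real.sqrt_le_iff.2 ⟨by positivity, ?_⟩
    calc ∑ κ : Fin k → Fin m, ‖∫ x, ∏ i, ((x (e (κ i)) : ℝ) : ℂ) ∂μ‖ ^ 2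
        ≤ ∑ κ : Fin k → Fin m, (∫ x, T.realDualNorm p₀ x ^ k ∂μ) ^ 2 *
            ∏ i, T.nrm p₀ (e (κ i)) ^ 2 := by
          refine Finset.sum_le_sum fun κ _ => ?_
          rw [Finset.prod_pow, ← mul_pow, ← integral_mul_const]
          exact pow_le_pow_left₀ (norm_nonneg _) (norm_integral_le_of_norm_le
            ((h.integrable_norm_pow k).mul_const _) (hbound κ)) 2
      _ = (∫ x, T.realDualNorm p₀ x ^ k ∂μ) ^ 2 * (∑ k, T.nrm p₀ (e k) ^ 2) ^ k := by
          rw [← Finset.mul_sum, Finset.sum_pow', Fintype.piFinset_univ]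
      _ ≤ (∫ x, T.realDualNorm p₀ x ^ k ∂μ) ^ 2 * C ^ k := by
          gcongr
          exact hC m e he
      _ = _ := by
          rw [mul_pow, ← pow_mul, mul_comm k 2, pow_mul, Real.sq_sqrt hC.nonneg]

theorem laplace_zero (μ : DualMeasure N) [IsProbabilityMeasure μ] : laplace μ 0 = 1 := by
  simp [laplace, pair]

/-- Differentiate `l_μ · (1 / l_μ) = 1` by Leibniz' rule and solve for the top term, whose factor is
the zeroth moment 1. -/
theorem invDeriv_succ (h : T.IsAdmissible μ p₀ q₀) [IsProbabilityMeasure μ] (n : ℕ)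
    (θ : Cx N) : invDeriv μ (n + 1) θ = ∑ i ∈ Finset.range (n + 1),
      (-((n + 1).choose i : ℂ)) * (invDeriv μ i θ * moment μ (n + 1 - i) θ) := by
  have h1 := iteratedDeriv_mul (n := n + 1) (h.analyticAt_inv_laplace θ).contDiffAt
    (h.analyticAt_laplace θ).contDiffAt
  have h2 : ((fun t : ℂ => (laplace μ (t • θ))⁻¹) * fun t : ℂ => laplace μ (t • θ)) =ᶠ[𝓝 0]
      fun _ => 1 := by
    have h0 : (0 : ℂ) ∈ {t : ℂ | ‖t‖ * T.cnrm p₀ θ < ((2 : ℝ) ^ q₀)⁻¹} := by simp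
    filter_upwards [(isOpen_disc T p₀ q₀ θ).mem_nhds h0] with t ht
    exact inv_mul_cancel₀ (h.laplace_ne_zero ht)
  rw [h2.iteratedDeriv_eq, iteratedDeriv_const, if_neg (Nat.succ_ne_zero n),
    Finset.sum_range_succ] at h1
  simp only [h.iteratedDeriv_laplace, Nat.choose_self, Nat.cast_one, one_mul, Nat.sub_self] at h1
  have h3 : moment μ 0 θ = 1 := by simp [moment]
  rw [h3, mul_one] at h1
  simp only [invDeriv, neg_mul, Finset.sum_neg_distrib, ← mul_assoc]
  linear_combination -h1

/-- The recursion is used only for polynomiality: the constants it yields are too large and are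
replaced in `hsPoly_invDeriv`. -/
theorem exists_hsPoly_invDeriv (h : T.IsAdmissible μ p₀ q₀) [IsProbabilityMeasure μ] {p : ℕ}
    {C : ℝ} (hC : T.HSBound p p₀ C) (n : ℕ) : ∃ K, T.HSPoly p n (invDeriv μ n) K := by
  induction n using Nat.strong_induction_on with
  | _ n ih =>
    rcases n with _ | n
    · refine ⟨1, ?_⟩
      have : (invDeriv μ 0 : Cx N → ℂ) = fun _ => 1 := by
        funext θ; simp [invDeriv, laplace_zero]
      rw [this]
      exact HSPoly.one
    · have h1 : ∀ i ∈ Finset.range (n + 1), ∃ K, T.HSPoly p (n + 1)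
          (fun θ => (-((n + 1).choose i : ℂ)) * (invDeriv μ i θ * moment μ (n + 1 - i) θ)) K := by
        intro i hi
        have hi' := Finset.mem_range.1 hi
        obtain ⟨K₁, hK₁⟩ := ih i hi'
        obtain ⟨K₂, hK₂⟩ := h.hsPoly_moment hC (n + 1 - i)
        have h2 := (hK₁.mul hK₂).const_mul (-((n + 1).choose i : ℂ))
        rw [Nat.add_sub_cancel' hi'.le] at h2
        exact ⟨_, h2⟩
      choose! K hK using h1
      refine ⟨∑ i ∈ Finset.range (n + 1), K i, ?_⟩
      rw [show invDeriv μ (n + 1) = _ from funext fun θ => h.invDeriv_succ n θ]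
      exact HSPoly.sum _ hK

/-- Cauchy's estimate supplies the factor `(2^{q₀})^n` and `HSPoly.of_bound` the factor `(e √C)^n`;
the condition on `ε` says that their product is at most `ε^{-n}`. -/
theorem hsPoly_invDeriv (h : T.IsAdmissible μ p₀ q₀) [IsProbabilityMeasure μ] {p : ℕ} {C : ℝ}
    (hC : T.HSBound p p₀ C) {c : ℝ} (hc0 : 0 < c)
    (hc : ∀ θ : Cx N, 2 ^ q₀ * T.cnrm p₀ θ < 1 → c ≤ ‖laplace μ θ‖) {ε : ℝ} (hε : 0 < ε)
    (hεC : ε * (Real.exp 1 * √C) ≤ ((2 : ℝ) ^ q₀)⁻¹) (n : ℕ) :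
    T.HSPoly p n (invDeriv μ n) (n.factorial * c⁻¹ * ε⁻¹ ^ n) := by
  obtain ⟨K, hK⟩ := h.exists_hsPoly_invDeriv hC n
  refine (hK.of_bound (b := n.factorial * c⁻¹ * (2 ^ q₀) ^ n) (by positivity)
    (h.norm_invDeriv_le hc0 hc n) hC).mono ?_
  rw [mul_assoc _ ((2 ^ q₀ : ℝ) ^ n), ← mul_pow]
  gcongr
  rw [← one_div, le_div_iff₀ hε]
  rw [← one_div, le_div_iff₀ (by positivity)] at hεC
  linarith

end IsAdmissible

/-! ## The Appell kernels -/

/-- The `n`-th derivative of `t ↦ e_μ(tθ; z)` at zero. -/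
def appellPoly (μ : DualMeasure N) (n : ℕ) (z : N →L[ℝ] ℂ) (θ : Cx N) : ℂ :=
  iteratedDeriv n (fun t : ℂ => muExp μ (t • θ) z) 0

namespace IsAdmissible

variable {T : NuclearTriple H N} {μ : DualMeasure N} {p₀ q₀ : ℕ}

theorem analyticAt_muExp (h : T.IsAdmissible μ p₀ q₀) (θ : Cx N) (z : N →L[ℝ] ℂ) :
    AnalyticAt ℂ (fun t : ℂ => muExp μ (t • θ) z) 0 := by
  simp only [muExp, div_eq_mul_inv, pair_smul]
  exact AnalyticAt.mul (by fun_prop) (h.analyticAt_inv_laplace θ)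

theorem appellPoly_zero (μ : DualMeasure N) (n : ℕ) (θ : Cx N) :
    appellPoly μ n 0 θ = invDeriv μ n θ := by
  simp [appellPoly, invDeriv, muExp, pair]

/-- Leibniz' rule for `e_μ(tθ; z + w) = exp(t ⟨w, θ⟩) e_μ(tθ; z)`. With `z = 0` it reduces the
kernels to the derivatives of `1 / l_μ`; along complex lines it shows that they are polynomials. -/
theorem appellPoly_add (h : T.IsAdmissible μ p₀ q₀) (n : ℕ) (z w : N →L[ℝ] ℂ) (θ : Cx N) :
    appellPoly μ n (z + w) θ = ∑ i ∈ Finset.range (n + 1),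
      (n.choose i : ℂ) * (pair w θ ^ i * appellPoly μ (n - i) z θ) := by
  have h1 : (fun t : ℂ => muExp μ (t • θ) (z + w)) =
      (fun t : ℂ => Complex.exp (pair w θ * t)) * fun t : ℂ => muExp μ (t • θ) z := by
    funext t
    simp only [muExp, Pi.mul_apply, pair_add_left, pair_smul, mul_add, Complex.exp_add,
      mul_comm (pair w θ) t]
    ring
  have h2 : AnalyticAt ℂ (fun t : ℂ => Complex.exp (pair w θ * t)) 0 := by fun_prop
  rw [appellPoly, h1, iteratedDeriv_mul h2.contDiffAt (h.analyticAt_muExp θ z).contDiffAt]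
  refine Finset.sum_congr rfl fun i _ => ?_
  rw [iteratedDeriv_cexp_const_mul]
  simp [appellPoly, mul_assoc]

theorem hsPoly_appellPoly_add {p n i : ℕ} (hi : i ≤ n)
    {z w : N →L[ℝ] ℂ} {K : ℝ} (hw : w ∈ T.Hneg p)
    (hK : T.HSPoly p (n - i) (appellPoly μ (n - i) z) K) :
    T.HSPoly p n (fun θ => (n.choose i : ℂ) * (pair w θ ^ i * appellPoly μ (n - i) z θ))
      (n.choose i * ((T.dualNorm p w).toReal ^ i * K)) := by
  have h1 := ((HSPoly.pair_pow hw i).mul hK).const_mul (n.choose i : ℂ)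
  rw [Nat.add_sub_cancel' hi, Complex.norm_natCast] at h1
  exact h1

theorem hsPoly_appellPoly (h : T.IsAdmissible μ p₀ q₀) [IsProbabilityMeasure μ] {p : ℕ} {C : ℝ}
    (hC : T.HSBound p p₀ C) {c : ℝ} (hc0 : 0 < c)
    (hc : ∀ θ : Cx N, 2 ^ q₀ * T.cnrm p₀ θ < 1 → c ≤ ‖laplace μ θ‖) {ε : ℝ} (hε : 0 < ε)
    (hεC : ε * (Real.exp 1 * √C) ≤ ((2 : ℝ) ^ q₀)⁻¹) (n : ℕ) {z : N →L[ℝ] ℂ}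
    (hz : z ∈ T.Hneg p) : T.HSPoly p n (appellPoly μ n z)
      (n.factorial * c⁻¹ * ε⁻¹ ^ n * Real.exp (ε * (T.dualNorm p z).toReal)) := by
  set D := (T.dualNorm p z).toReal with hD
  have hD0 : 0 ≤ D := ENNReal.toReal_nonneg
  have h1 : ∀ i ∈ Finset.range (n + 1), T.HSPoly p n
      (fun θ => (n.choose i : ℂ) * (pair z θ ^ i * appellPoly μ (n - i) 0 θ))
      (n.choose i * (D ^ i * ((n - i).factorial * c⁻¹ * ε⁻¹ ^ (n - i)))) := fun i hi => by
    refine hsPoly_appellPoly_add (Nat.lt_succ_iff.1 (Finset.mem_range.1 hi)) hz ?_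
    rw [funext (appellPoly_zero μ (n - i))]
    exact h.hsPoly_invDeriv hC hc0 hc hε hεC (n - i)
  have h2 := HSPoly.sum _ h1
  have h3 : appellPoly μ n z = fun θ => ∑ i ∈ Finset.range (n + 1),
      (n.choose i : ℂ) * (pair z θ ^ i * appellPoly μ (n - i) 0 θ) := by
    funext θ
    rw [← h.appellPoly_add, zero_add]
  rw [h3]
  refine h2.mono ?_
  -- Since `C(n,i) (n-i)! = n! / i!`, the sum is `n! c⁻¹ ε^{-n}` times a partial sum of the
  -- exponential series at `ε |z|_{-p}`.
  have h4 : ∀ i ∈ Finset.range (n + 1),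
      (n.choose i : ℝ) * (D ^ i * ((n - i).factorial * c⁻¹ * ε⁻¹ ^ (n - i))) =
        n.factorial * c⁻¹ * ε⁻¹ ^ n * ((ε * D) ^ i / i.factorial) := by
    intro i hi
    have hi' : i ≤ n := Nat.lt_succ_iff.1 (Finset.mem_range.1 hi)
    have h5 : (n.factorial : ℝ) = n.choose i * i.factorial * (n - i).factorial := by
      exact_mod_cast (Nat.choose_mul_factorial_mul_factorial hi').symm
    have h6 : ε⁻¹ ^ n = ε⁻¹ ^ i * ε⁻¹ ^ (n - i) := by rw [← pow_add, Nat.add_sub_cancel' hi']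
    have h7 : ε⁻¹ ^ i * ε ^ i = 1 := by rw [← mul_pow, inv_mul_cancel₀ hε.ne', one_pow]
    have h8 : (i.factorial : ℝ) ≠ 0 := by exact_mod_cast i.factorial_ne_zero
    have h9 := mul_inv_cancel₀ h8
    rw [h5, h6, mul_pow, div_eq_mul_inv]
    linear_combination (-((n.choose i : ℝ) * (n - i).factorial * c⁻¹ * ε⁻¹ ^ (n - i) * D ^ i) *
      (ε⁻¹ ^ i * ε ^ i)) * h9 -
      ((n.choose i : ℝ) * (n - i).factorial * c⁻¹ * ε⁻¹ ^ (n - i) * D ^ i) * h7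
  rw [Finset.sum_congr rfl h4, ← Finset.mul_sum]
  gcongr
  exact Real.sum_le_exp_of_nonneg (by positivity) _

end IsAdmissible

theorem isAppell_unique {T : NuclearTriple H N} {μ : DualMeasure N} {n : ℕ} {z : N →L[ℝ] ℂ}
    {L L' : T.SymPow n →ₗ[ℂ] ℂ} (h : T.IsAppell μ n z L) (h' : T.IsAppell μ n z L') :
    L = L' := by
  obtain ⟨⟨p, C, hC⟩, hL⟩ := h
  obtain ⟨⟨p', C', hC'⟩, hL'⟩ := h'
  rw [← sub_eq_zero]
  refine T.eq_zero_of_forall_symTensor (p := p) (p' := p') (C := C) (C' := C') (fun φ => ?_)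
    fun θ => ?_
  · rw [LinearMap.sub_apply]
    exact (norm_sub_le _ _).trans (add_le_add (hC φ) (hC' φ))
  · rw [LinearMap.sub_apply, hL, hL', sub_self]

theorem IsAppell.eq_appell {T : NuclearTriple H N} {μ : DualMeasure N} {n : ℕ}
    {z : N →L[ℝ] ℂ} {L : T.SymPow n →ₗ[ℂ] ℂ} (h : T.IsAppell μ n z L) :
    T.appell μ n z = L := by
  have hex : ∃ L, T.IsAppell μ n z L := ⟨L, h⟩
  rw [appell, dif_pos hex]
  exact isAppell_unique hex.choose_spec h

/-- Existence and estimate come together: the functional built from the polynomial is an Appell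
kernel, and uniqueness identifies it with `appell`. -/
theorem HSPoly.norm_appell_le {T : NuclearTriple H N} {μ : DualMeasure N} {p n : ℕ}
    {z : N →L[ℝ] ℂ} {K : ℝ} (h : T.HSPoly p n (appellPoly μ n z) K) :
    T.IsAppell μ n z (T.appell μ n z) ∧ ∀ φ, ‖T.appell μ n z φ‖ ≤ K * T.kerNorm p φ := by
  obtain ⟨L, hL, hL'⟩ := h.exists_functional
  have h1 : T.IsAppell μ n z L := ⟨⟨p, K, hL⟩, hL'⟩
  rw [h1.eq_appell]
  exact ⟨h1, hL⟩

namespace IsAdmissible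

variable {T : NuclearTriple H N} {μ : DualMeasure N} {p₀ q₀ : ℕ}

/-- There is a space `H_{-p}`, as large as desired, on which the Appell kernels satisfy an
exponential estimate of arbitrarily small type. -/
theorem exists_hsPoly_appellPoly (h : T.IsAdmissible μ p₀ q₀) [IsProbabilityMeasure μ] (p₁ : ℕ)
    {η : ℝ} (hη : 0 < η) : ∃ (p : ℕ) (A ε C : ℝ), 0 < A ∧ 0 < ε ∧ 0 ≤ C ∧
      (∀ ξ, T.nrm p₁ ξ ≤ C * T.nrm p ξ) ∧ ε * C ≤ η ∧
      ∀ n, ∀ z ∈ T.Hneg p, T.HSPoly p n (appellPoly μ n z)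
        (n.factorial * A * ε⁻¹ ^ n * Real.exp (ε * (T.dualNorm p z).toReal)) := by
  obtain ⟨c, hc0, hc⟩ := h.2.2
  obtain ⟨p, C, hC1, hC, hC'⟩ := T.exists_HSBound p₀ p₁
  have hCpos : 0 < √C := Real.sqrt_pos.2 (by linarith)
  -- The first bound makes the type small after passing from `H_{-p₁}` to `H_{-p}`; the second is
  -- the condition of `hsPoly_appellPoly`.
  set ε := min (η / √C) (((2 : ℝ) ^ q₀)⁻¹ / (Real.exp 1 * √C)) with hε
  have hε0 : 0 < ε := by positivity
  refine ⟨p, c⁻¹, ε, √C, by positivity, hε0, hCpos.le, hC'.nrm_le, ?_, fun n z hz =>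
    h.hsPoly_appellPoly hC hc0 hc hε0 ?_ n hz⟩
  · rw [← le_div_iff₀ hCpos]; exact min_le_left _ _
  · rw [← le_div_iff₀ (by positivity)]; exact min_le_right _ _

theorem isAppell_appell (h : T.IsAdmissible μ p₀ q₀) [IsProbabilityMeasure μ] (n : ℕ)
    (z : N →L[ℝ] ℂ) : T.IsAppell μ n z (T.appell μ n z) := by
  obtain ⟨p₁, hz⟩ := T.exists_mem_Hneg z
  obtain ⟨p, A, ε, C, -, -, hC0, hC, -, hp⟩ := h.exists_hsPoly_appellPoly p₁ one_pos
  exact (hp n z (T.mem_Hneg_of_nrm_le hC0 hC hz).1).norm_appell_le.1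

theorem exists_hsPoly_appellPoly_of_mem (h : T.IsAdmissible μ p₀ q₀) [IsProbabilityMeasure μ]
    (z w : N →L[ℝ] ℂ) : ∃ p, w ∈ T.Hneg p ∧ ∀ n, ∃ K, T.HSPoly p n (appellPoly μ n z) K := by
  obtain ⟨p₁, hz⟩ := T.exists_mem_Hneg z
  obtain ⟨p₂, hw⟩ := T.exists_mem_Hneg w
  obtain ⟨p, A, ε, C, -, -, hC0, hC, -, hp⟩ :=
    h.exists_hsPoly_appellPoly (max p₁ p₂) one_pos
  exact ⟨p, (T.mem_Hneg_of_nrm_le hC0 hC (T.Hneg_mono (le_max_right _ _) hw)).1,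
    fun n => ⟨_, hp n z (T.mem_Hneg_of_nrm_le hC0 hC (T.Hneg_mono (le_max_left _ _) hz)).1⟩⟩

/-- The Appell kernels are polynomials along complex lines. -/
theorem differentiable_appell (h : T.IsAdmissible μ p₀ q₀) [IsProbabilityMeasure μ] {n : ℕ}
    (φ : T.SymPow n) (z w : N →L[ℝ] ℂ) :
    Differentiable ℂ fun t : ℂ => T.appell μ n (z + t • w) φ := by
  obtain ⟨p, hw, hK⟩ := h.exists_hsPoly_appellPoly_of_mem z w
  choose K hK using hK
  have hL : ∀ i ∈ Finset.range (n + 1), ∃ L : T.SymPow n →ₗ[ℂ] ℂ,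
      (∃ K : ℝ, ∀ φ, ‖L φ‖ ≤ K * T.kerNorm p φ) ∧ ∀ θ, L (T.symTensor n θ) =
        (n.choose i : ℂ) * (pair w θ ^ i * appellPoly μ (n - i) z θ) := fun i hi => by
    obtain ⟨L, h1, h2⟩ := (hsPoly_appellPoly_add (Nat.lt_succ_iff.1 (Finset.mem_range.1 hi)) hw
      (hK (n - i))).exists_functional
    exact ⟨L, ⟨_, h1⟩, h2⟩
  choose! L hLb hLθ using hL
  choose! B hB using hLb
  -- The terms of the Leibniz expansion are represented by functionals that do not depend on `t`;
  -- uniqueness of the Appell kernel turns the expansion on tensor powers into one on all of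
  -- `SymPow`.
  have key : ∀ t : ℂ, T.appell μ n (z + t • w) = ∑ i ∈ Finset.range (n + 1), t ^ i • L i := by
    intro t
    refine IsAppell.eq_appell ⟨⟨p, ∑ i ∈ Finset.range (n + 1), ‖t‖ ^ i * B i, fun φ => ?_⟩,
      fun θ => ?_⟩
    · rw [LinearMap.sum_apply, Finset.sum_mul]
      refine norm_sum_le_of_le _ fun i hi => ?_
      rw [LinearMap.smul_apply, norm_smul, norm_pow, mul_assoc]
      exact mul_le_mul_of_nonneg_left (hB i hi φ) (by positivity)
    · change _ = appellPoly μ n (z + t • w) θ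
      rw [h.appellPoly_add, LinearMap.sum_apply]
      refine Finset.sum_congr rfl fun i hi => ?_
      rw [LinearMap.smul_apply, hLθ i hi, pair_smul_left, smul_eq_mul]
      ring
  simp only [key, LinearMap.sum_apply, LinearMap.smul_apply, smul_eq_mul]
  fun_prop

end IsAdmissible

end NuclearTriple

/-- Jensen's inequality for the convex function `u ↦ cosh √u`. -/
theorem Real.cosh_sqrt_sum_le {ι : Type*} (s : Finset ι) (w u : ι → ℝ) (hw : ∀ i ∈ s, 0 ≤ w i)
    (hw1 : ∑ i ∈ s, w i = 1) (hu : ∀ i ∈ s, 0 ≤ u i) :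
    Real.cosh √(∑ i ∈ s, w i * u i) ≤ ∑ i ∈ s, w i * Real.cosh √(u i) := by
  have hpow : ∀ (a : ℝ) (n : ℕ), 0 ≤ a → √a ^ (2 * n) = a ^ n := fun a n ha => by
    rw [pow_mul, Real.sq_sqrt ha]
  have h2 := hasSum_sum (s := s) fun i _ => (Real.hasSum_cosh √(u i)).mul_left (w i)
  refine hasSum_le (fun n => ?_) (Real.hasSum_cosh _) h2
  rw [hpow _ _ (Finset.sum_nonneg fun i hi => mul_nonneg (hw i hi) (hu i hi))]
  -- The series `cosh √u = ∑ u^n / (2n)!` has nonnegative coefficients, so the power mean inequality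
  -- applies term by term.
  rw [div_le_iff₀ (by positivity), Finset.sum_mul]
  refine (Real.pow_arith_mean_le_arith_mean_pow s w u hw hw1 hu n).trans_eq ?_
  refine Finset.sum_congr rfl fun i hi => ?_
  rw [hpow _ _ (hu i hi)]
  field_simp

namespace NuclearTriple

variable {H N : Type*} [NormedAddCommGroup H] [InnerProductSpace ℝ H]
  [AddCommGroup N] [Module ℝ N] [TopologicalSpace N] [IsTopologicalAddGroup N]

attribute [local instance] cylinder

/-! ## Existence of admissible pairs -/

/-- Local boundedness of `l_μ` at zero, at the real points `ξ` and `-ξ`. The normalization `1 ≤ C`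
is for the empty system in `lintegral_cosh_sysNorm_le`. -/
theorem IsAnalytic.exists_lintegral_cosh_le {T : NuclearTriple H N} {μ : DualMeasure N}
    (hμ : T.IsAnalytic μ) : ∃ (p : ℕ) (ρ C : ℝ), 0 < ρ ∧ 1 ≤ C ∧ ∀ ξ, T.nrm p ξ < ρ →
      ∫⁻ x, ENNReal.ofReal (Real.cosh (x ξ)) ∂μ ≤ ENNReal.ofReal C := by
  obtain ⟨p, r, hr, h⟩ := hμ
  obtain ⟨-, -, p', δ, C, hδ, hC⟩ := h 0 (by simpa [cnrm] using hr)
  refine ⟨max p p', min r δ, max C 1, lt_min hr hδ, le_max_right _ _, fun ξ hξ => ?_⟩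
  have key : ∀ ξ, T.nrm (max p p') ξ < min r δ →
      Integrable (fun x : N →L[ℝ] ℝ => Real.exp (x ξ)) μ ∧
        ∫ x : N →L[ℝ] ℝ, Real.exp (x ξ) ∂μ ≤ C := by
    intro ξ hξ
    have hexp : ∀ x : N →L[ℝ] ℝ, Complex.exp (pair (ofRealDual x) (Cx.mk ξ 0)) =
        ((Real.exp (x ξ) : ℝ) : ℂ) := fun x => by
      rw [pair_ofRealDual]; simp
    have h1 := (h (Cx.mk ξ 0) (by
      rw [cnrm_mk_zero]
      exact (T.nrm_mono (le_max_left p p') ξ).trans_lt (hξ.trans_le (min_le_left _ _)))).1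
    have h2 := hC (Cx.mk ξ 0) (by
      rw [cnrm_mk_zero]
      exact (T.nrm_mono (le_max_right p p') ξ).trans_lt (hξ.trans_le (min_le_right _ _)))
    rw [zero_add, laplace] at h2
    simp only [hexp] at h1 h2
    rw [integral_complex_ofReal, Complex.norm_real] at h2
    refine ⟨?_, (le_abs_self _).trans h2⟩
    exact h1.re.congr (Eventually.of_forall fun x => Complex.ofReal_re _)
  have h1 := key ξ hξ
  have h2 := key (-ξ) (by rwa [nrm_neg])
  have h3 : (fun x : N →L[ℝ] ℝ => Real.cosh (x ξ)) =
      fun x => (Real.exp (x ξ) + Real.exp (x (-ξ))) / 2 := by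
    funext x; rw [Real.cosh_eq, map_neg]
  have hint : Integrable (fun x : N →L[ℝ] ℝ => Real.cosh (x ξ)) μ := by
    rw [h3]; exact (h1.1.add h2.1).div_const 2
  rw [← ofReal_integral_eq_lintegral_ofReal hint
    (Eventually.of_forall fun x => (Real.cosh_pos _).le)]
  refine ENNReal.ofReal_le_ofReal ((le_max_left C 1).trans' ?_)
  rw [h3, integral_div, integral_add h1.1 h2.1]
  linarith [h1.2, h2.2]

/-- The norm of the restriction of `x` to the span of the orthonormal system `e`. -/
def sysNorm {m : ℕ} (e : Fin m → N) (x : N →L[ℝ] ℝ) : ℝ := √(∑ i, x (e i) ^ 2)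

theorem sysNorm_nonneg {m : ℕ} (e : Fin m → N) (x : N →L[ℝ] ℝ) : 0 ≤ sysNorm e x :=
  Real.sqrt_nonneg _

theorem measurable_sysNorm {m : ℕ} (e : Fin m → N) :
    Measurable fun x : N →L[ℝ] ℝ => sysNorm e x :=
  (Finset.measurable_sum _ fun i _ => (measurable_dual_apply (e i)).pow_const 2).sqrt

/-- Jensen with weights proportional to `|e_i|_p²`: the vectors `ζ i` are scaled so that the
weighted sum of `x(ζ i)²` is `(ε sysNorm e x)²`, and all have the norm `ε √σ`, which the
Hilbert-Schmidt bound keeps below `ρ` whatever the dimension. -/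
theorem Orthon.lintegral_cosh_sysNorm_le {T : NuclearTriple H N} {μ : DualMeasure N}
    [IsProbabilityMeasure μ] {p p₀ m : ℕ} {ρ C S ε : ℝ} (hC1 : 1 ≤ C)
    (hC : ∀ ξ, T.nrm p ξ < ρ →
      ∫⁻ x, ENNReal.ofReal (Real.cosh (x ξ)) ∂μ ≤ ENNReal.ofReal C)
    (hS : T.HSBound p₀ p S) (hε : 0 < ε) (hερ : ε * √S < ρ) {e : Fin m → N}
    (he : T.Orthon p₀ e) :
    ∫⁻ x, ENNReal.ofReal (Real.cosh (ε * sysNorm e x)) ∂μ ≤ ENNReal.ofReal C := by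
  rcases Nat.eq_zero_or_pos m with rfl | hm
  · simpa [sysNorm] using hC1
  have hpos : ∀ i, 0 < T.nrm p (e i) := fun i =>
    lt_of_le_of_ne (T.nrm_nonneg _ _) fun h0 => by
      have := he.nrm_eq_one i
      rw [T.nrm_eq_zero h0.symm] at this
      simp [nrm] at this
  set σ := ∑ i, T.nrm p (e i) ^ 2 with hσ
  have hσ0 : 0 < σ := Finset.sum_pos (fun i _ => pow_pos (hpos i) 2) ⟨⟨0, hm⟩, Finset.mem_univ _⟩
  let w : Fin m → ℝ := fun i => T.nrm p (e i) ^ 2 / σ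
  have hw0 : ∀ i, 0 ≤ w i := fun i => by positivity
  have hw1 : ∑ i, w i = 1 := by
    simp only [w]
    rw [← Finset.sum_div, ← hσ, div_self hσ0.ne']
  let ζ : Fin m → N := fun i => (ε * √σ / T.nrm p (e i)) • e i
  have hζ : ∀ i, T.nrm p (ζ i) < ρ := fun i => by
    have := hpos i
    simp only [ζ, nrm_smul]
    rw [abs_of_pos (by positivity), div_mul_cancel₀ _ this.ne']
    refine lt_of_le_of_lt ?_ hερ
    exact mul_le_mul_of_nonneg_left (Real.sqrt_le_sqrt (hS m e he)) hε.le
  have hpt : ∀ x : N →L[ℝ] ℝ, Real.cosh (ε * sysNorm e x) ≤ ∑ i, w i * Real.cosh (x (ζ i)) := by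
    intro x
    have h1 := Real.cosh_sqrt_sum_le Finset.univ w (fun i => x (ζ i) ^ 2) (fun i _ => hw0 i) hw1
      (fun i _ => sq_nonneg _)
    simp only [Real.sqrt_sq_eq_abs, Real.cosh_abs] at h1
    refine le_trans (le_of_eq ?_) h1
    congr 1
    rw [sysNorm, ← Real.sqrt_sq hε.le, ← Real.sqrt_mul (sq_nonneg _), Finset.mul_sum]
    congr 1
    refine Finset.sum_congr rfl fun i _ => ?_
    have := (hpos i).ne'
    simp only [w, ζ, map_smul, smul_eq_mul, mul_pow, div_pow, Real.sq_sqrt hσ0.le]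
    field_simp
  calc ∫⁻ x, ENNReal.ofReal (Real.cosh (ε * sysNorm e x)) ∂μ
      ≤ ∫⁻ x, ∑ i, ENNReal.ofReal (w i) * ENNReal.ofReal (Real.cosh (x (ζ i))) ∂μ := by
        refine lintegral_mono fun x => ?_
        refine (ENNReal.ofReal_le_ofReal (hpt x)).trans_eq ?_
        rw [ENNReal.ofReal_sum_of_nonneg fun i _ => mul_nonneg (hw0 i) (Real.cosh_pos _).le]
        exact Finset.sum_congr rfl fun i _ => ENNReal.ofReal_mul (hw0 i)
    _ = ∑ i, ENNReal.ofReal (w i) * ∫⁻ x, ENNReal.ofReal (Real.cosh (x (ζ i))) ∂μ := by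
        have hm : ∀ i, Measurable fun x : N →L[ℝ] ℝ => ENNReal.ofReal (Real.cosh (x (ζ i))) :=
          fun i => (Real.measurable_cosh.comp (measurable_dual_apply _)).ennreal_ofReal
        rw [lintegral_finsetSum _ fun i _ => (hm i).const_mul _]
        exact Finset.sum_congr rfl fun i _ => lintegral_const_mul _ (hm i)
    _ ≤ ∑ i, ENNReal.ofReal (w i) * ENNReal.ofReal C := by
        gcongr with i
        exact hC _ (hζ i)
    _ = ENNReal.ofReal C := by
        rw [← Finset.sum_mul, ← ENNReal.ofReal_sum_of_nonneg fun i _ => hw0 i, hw1]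
        simp

/-- `N` is separable. -/
theorem exists_monotone_finset (T : NuclearTriple H N) : ∃ S : ℕ → Finset N, Monotone S ∧
    ∀ (p : ℕ) (ξ : N) (δ : ℝ), 0 < δ → ∃ j, ∃ η ∈ Submodule.span ℝ (S j : Set N),
      T.nrm p (ξ - η) ≤ δ := by
  classical
  choose p₂ C _ hC _ using fun p => T.exists_HSBound p p
  -- Finite-rank approximations with error `1 / (k + 1)` in each norm; `Nat.pair` enumerates all
  -- `(p, k)`, and unions make the sets increase.
  choose m e he hproj using fun p (k : ℕ) =>
    (hC p).exists_proj (δ := 1 / ((k : ℝ) + 1)) (by positivity)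
  refine ⟨fun j => (Finset.range (j + 1)).biUnion fun i =>
    Finset.univ.image (e i.unpair.1 i.unpair.2), fun i j hij => ?_, fun p ξ δ hδ => ?_⟩
  · exact Finset.biUnion_subset_biUnion_of_subset_left _
      (Finset.range_subset_range.2 (by omega))
  · obtain ⟨k, hk⟩ := exists_nat_gt (T.nrm (p₂ p) ξ / δ)
    refine ⟨Nat.pair p k, T.proj (p₂ p) (e p k) ξ, ?_, ?_⟩
    · refine Submodule.sum_mem _ fun i _ => Submodule.smul_mem _ _ (Submodule.subset_span ?_)
      refine Finset.mem_biUnion.2 ⟨Nat.pair p k, by simp, ?_⟩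
      rw [Nat.unpair_pair]
      exact Finset.mem_image_of_mem _ (Finset.mem_univ i)
    · refine (hproj p k ξ).trans ?_
      rw [div_lt_iff₀ hδ] at hk
      rw [div_mul_eq_mul_div, one_mul, div_le_iff₀ (by positivity)]
      nlinarith

theorem Orthon.abs_le_sysNorm {T : NuclearTriple H N} {p m : ℕ} {e : Fin m → N}
    (he : T.Orthon p e) {ξ : N} (hξ : ∑ i, T.ip p (e i) ξ • e i = ξ) (x : N →L[ℝ] ℝ) :
    |x ξ| ≤ sysNorm e x * T.nrm p ξ := by
  have h1 : x ξ = ∑ i, x (e i) * T.ip p (e i) ξ := by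
    conv_lhs => rw [← hξ]
    simp [mul_comm]
  refine abs_le_of_sq_le_sq ?_ (mul_nonneg (Real.sqrt_nonneg _) (T.nrm_nonneg _ _))
  rw [h1, mul_pow, sysNorm, Real.sq_sqrt (Finset.sum_nonneg fun _ _ => sq_nonneg _), sq_nrm]
  exact (Finset.sum_mul_sq_le_sq_mul_sq _ _ _).trans (mul_le_mul_of_nonneg_left (T.bessel p he ξ)
    (Finset.sum_nonneg fun _ _ => sq_nonneg _))

theorem Orthon.sysNorm_le {T : NuclearTriple H N} {p m : ℕ} {e : Fin m → N}
    (he : T.Orthon p e) {x : N →L[ℝ] ℝ} {K : ℝ} {V : Submodule ℝ N} (hK : 0 ≤ K) (heV : ∀ i, e i ∈ V)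
    (h : ∀ ξ ∈ V, |x ξ| ≤ K * T.nrm p ξ) : sysNorm e x ≤ K := by
  have h0 : 0 ≤ ∑ i, x (e i) ^ 2 := Finset.sum_nonneg fun _ _ => sq_nonneg _
  by_cases hs : sysNorm e x = 0
  · rwa [hs]
  have hpos : 0 < sysNorm e x := lt_of_le_of_ne (Real.sqrt_nonneg _) (Ne.symm hs)
  have h1 := h (∑ i, x (e i) • e i) (V.sum_mem fun i _ => V.smul_mem _ (heV i))
  have h2 : T.nrm p (∑ i, x (e i) • e i) = sysNorm e x := by
    rw [nrm, he.ip_sum_smul, sysNorm]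
  have h3 : x (∑ i, x (e i) • e i) = sysNorm e x * sysNorm e x := by
    rw [sysNorm, Real.mul_self_sqrt h0]
    simp [pow_two]
  rw [h2, h3, abs_of_pos (mul_pos hpos hpos)] at h1
  exact le_of_mul_le_mul_right h1 hpos

/-- The dual norm is the supremum of the norms on an exhausting sequence of finite-dimensional
subspaces. -/
theorem dualNorm_eq_iSup (T : NuclearTriple H N) {p : ℕ} {S : ℕ → Finset N}
    (hS : ∀ (p : ℕ) (ξ : N) (δ : ℝ), 0 < δ → ∃ j, ∃ η ∈ Submodule.span ℝ (S j : Set N),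
      T.nrm p (ξ - η) ≤ δ) {m : ℕ → ℕ} {e : ∀ j, Fin (m j) → N} (he : ∀ j, T.Orthon p (e j))
    (heS : ∀ j i, e j i ∈ Submodule.span ℝ (S j : Set N))
    (hspan : ∀ j, ∀ ξ ∈ Submodule.span ℝ (S j : Set N), ∑ i, T.ip p (e j i) ξ • e j i = ξ)
    (x : N →L[ℝ] ℝ) :
    T.dualNorm p (ofRealDual x) = ⨆ j, ENNReal.ofReal (sysNorm (e j) x) := by
  have hreal : ∀ {q}, ofRealDual x ∈ T.Hneg q → ∀ ξ, |x ξ| ≤ T.realDualNorm q x * T.nrm q ξ := by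
    intro q hq ξ
    have := T.norm_pair_le_mul hq (Cx.mk ξ 0)
    rw [cnrm_mk_zero] at this
    simpa [pair_ofRealDual, realDualNorm] using this
  apply le_antisymm
  · by_cases htop : (⨆ j, ENNReal.ofReal (sysNorm (e j) x)) = ∞
    · rw [htop]; exact le_top
    set K := (⨆ j, ENNReal.ofReal (sysNorm (e j) x)).toReal with hK
    have hK0 : 0 ≤ K := ENNReal.toReal_nonneg
    have hle : ∀ j, sysNorm (e j) x ≤ K := fun j =>
      (ENNReal.ofReal_le_iff_le_toReal htop).1 (le_iSup (fun j => ENNReal.ofReal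
        (sysNorm (e j) x)) j)
    rw [← ENNReal.ofReal_toReal htop]
    refine T.dualNorm_le hK0 (T.norm_pair_le_of_real (fun ξ => rfl) hK0 fun ξ => ?_)
    obtain ⟨p₁, hp₁⟩ := T.exists_mem_Hneg (ofRealDual x)
    -- The bound `K` holds only on the spans. To reach `ξ`, approximation takes place in a norm `q`
    -- that dominates `p` and for which `x` is already known to be continuous.
    set q := max p p₁
    have hq := hreal (T.Hneg_mono (le_max_right p p₁) hp₁)
    set D := T.realDualNorm q x
    have key : ∀ δ : ℝ, 0 < δ → |x ξ| ≤ K * (T.nrm p ξ + δ) + D * δ := by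
      intro δ hδ
      obtain ⟨j, η, hη, hle'⟩ := hS q ξ δ hδ
      have h1 : |x ξ| ≤ |x η| + |x (ξ - η)| := by
        have : x ξ = x η + x (ξ - η) := by rw [← map_add]; congr 1; abel
        rw [this]; exact abs_add_le _ _
      have h2 : |x η| ≤ K * T.nrm p η := ((he j).abs_le_sysNorm (hspan j η hη) x).trans
        (mul_le_mul_of_nonneg_right (hle j) (T.nrm_nonneg _ _))
      have h3 : |x (ξ - η)| ≤ D * δ := (hq _).trans
        (mul_le_mul_of_nonneg_left hle' (T.realDualNorm_nonneg _ _))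
      have h4 : T.nrm p η ≤ T.nrm p ξ + δ := by
        have h5 : T.nrm p (-(ξ - η)) ≤ δ := by
          rw [nrm_neg]
          exact (T.nrm_mono (le_max_left p p₁) _).trans hle'
        have h6 : η = ξ + -(ξ - η) := by abel
        rw [h6]
        exact (T.nrm_add_le _ _ _).trans (by linarith)
      have h7 := mul_le_mul_of_nonneg_left h4 hK0
      linarith
    have hlim : Tendsto (fun δ : ℝ => K * (T.nrm p ξ + δ) + D * δ) (𝓝[>] 0)
        (𝓝 (K * (T.nrm p ξ + 0) + D * 0)) :=
      (Continuous.tendsto (by fun_prop) 0).mono_left nhdsWithin_le_nhds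
    refine (ge_of_tendsto hlim ?_).trans_eq (by ring)
    filter_upwards [self_mem_nhdsWithin] with δ hδ using key δ hδ
  · refine iSup_le fun j => ?_
    by_cases htop : T.dualNorm p (ofRealDual x) = ∞
    · rw [htop]; exact le_top
    refine ENNReal.ofReal_le_of_le_toReal ((he j).sysNorm_le ENNReal.toReal_nonneg (heS j)
      fun ξ _ => hreal (lt_top_iff_ne_top.2 htop) ξ)

/-- Along an exhausting sequence of subspaces the restricted norms increase to `|x|_{-p}`. Monotone
convergence keeps the uniform bound on the integrals of `cosh`, and where the limit is finite, `x`
lies in `H_{-p}`. -/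
theorem IsAnalytic.exists_integrable_exp_norm {T : NuclearTriple H N} {μ : DualMeasure N}
    [IsProbabilityMeasure μ] (hμ : T.IsAnalytic μ) : ∃ (p : ℕ) (ε : ℝ), 0 < ε ∧
      (∀ᵐ x ∂μ, ofRealDual x ∈ T.Hneg p) ∧ Measurable (T.realDualNorm p) ∧
      Integrable (fun x => Real.exp (ε * T.realDualNorm p x)) μ := by
  obtain ⟨p₁, ρ, C, hρ, hC1, hC⟩ := hμ.exists_lintegral_cosh_le
  obtain ⟨p, B, hB1, hB, -⟩ := T.exists_HSBound p₁ p₁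
  obtain ⟨S, hSmono, hS⟩ := T.exists_monotone_finset
  choose m e he heS hspan using fun j => T.exists_orthon p (S j)
  have hBpos : 0 < √B := Real.sqrt_pos.2 (by linarith)
  set ε := ρ / (2 * √B) with hε
  have hε0 : 0 < ε := by positivity
  have hερ : ε * √B < ρ := by
    have : ε * √B = ρ / 2 := by rw [hε]; field_simp
    rw [this]; linarith
  have hdual := T.dualNorm_eq_iSup hS he heS hspan
  have hsmono : ∀ x, Monotone fun j => sysNorm (e j) x := fun x i j hij =>
    (he i).sysNorm_le (Real.sqrt_nonneg _) (heS i) fun ξ hξ =>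
      (he j).abs_le_sysNorm (hspan j ξ (Submodule.span_mono (Finset.coe_subset.2 (hSmono hij)) hξ))
        x
  let Φ : (N →L[ℝ] ℝ) → ℝ≥0∞ := fun x => ⨆ j, ENNReal.ofReal (Real.cosh (ε * sysNorm (e j) x))
  have hmeas : ∀ j, Measurable fun x : N →L[ℝ] ℝ =>
      ENNReal.ofReal (Real.cosh (ε * sysNorm (e j) x)) := fun j =>
    (Real.measurable_cosh.comp ((measurable_sysNorm (e j)).const_mul ε)).ennreal_ofReal
  have hΦm : Measurable Φ := Measurable.iSup hmeas
  have hΦ : ∫⁻ x, Φ x ∂μ ≠ ∞ := by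
    have h1 : ∫⁻ x, Φ x ∂μ = ⨆ j, ∫⁻ x, ENNReal.ofReal (Real.cosh (ε * sysNorm (e j) x)) ∂μ :=
      lintegral_iSup hmeas fun i j hij x => ENNReal.ofReal_le_ofReal (by
        rw [Real.cosh_le_cosh, abs_of_nonneg (mul_nonneg hε0.le (sysNorm_nonneg _ _)),
          abs_of_nonneg (mul_nonneg hε0.le (sysNorm_nonneg _ _))]
        exact mul_le_mul_of_nonneg_left (hsmono x hij) hε0.le)
    rw [h1]
    exact ((iSup_le fun j => (he j).lintegral_cosh_sysNorm_le hC1 hC hB hε0 hερ).trans_lt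
      ENNReal.ofReal_lt_top).ne
  have hkey : ∀ x, Φ x < ∞ → ofRealDual x ∈ T.Hneg p ∧
      Real.exp (ε * T.realDualNorm p x) ≤ 2 * (Φ x).toReal := by
    intro x hx
    have h1 : ∀ j, Real.exp (ε * sysNorm (e j) x) ≤ 2 * (Φ x).toReal := fun j => by
      have h2 : Real.cosh (ε * sysNorm (e j) x) ≤ (Φ x).toReal :=
        (ENNReal.ofReal_le_iff_le_toReal hx.ne).1
          (le_iSup (fun j => ENNReal.ofReal (Real.cosh (ε * sysNorm (e j) x))) j)
      rw [Real.cosh_eq] at h2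
      linarith [Real.exp_pos (-(ε * sysNorm (e j) x))]
    have hR : 0 < 2 * (Φ x).toReal := (Real.exp_pos _).trans_le (h1 0)
    have h3 : ∀ j, sysNorm (e j) x ≤ Real.log (2 * (Φ x).toReal) / ε := fun j => by
      rw [le_div_iff₀ hε0, mul_comm]
      exact (Real.le_log_iff_exp_le hR).2 (h1 j)
    have h4 : T.dualNorm p (ofRealDual x) ≤
        ENNReal.ofReal (Real.log (2 * (Φ x).toReal) / ε) := by
      rw [hdual]
      exact iSup_le fun j => ENNReal.ofReal_le_ofReal (h3 j)
    refine ⟨h4.trans_lt ENNReal.ofReal_lt_top, ?_⟩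
    have h5 : T.realDualNorm p x ≤ Real.log (2 * (Φ x).toReal) / ε :=
      ENNReal.toReal_le_of_le_ofReal ((Real.sqrt_nonneg _).trans (h3 0)) h4
    rw [← Real.le_log_iff_exp_le hR]
    rwa [le_div_iff₀ hε0, mul_comm] at h5
  have hae : ∀ᵐ x ∂μ, Φ x < ∞ := ae_lt_top hΦm hΦ
  have hnm : Measurable (T.realDualNorm p) := by
    have : T.realDualNorm p = fun x => (⨆ j, ENNReal.ofReal (sysNorm (e j) x)).toReal := by
      funext x; rw [realDualNorm, hdual]
    rw [this]
    exact (Measurable.iSup fun j => (measurable_sysNorm (e j)).ennreal_ofReal).ennreal_toReal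
  refine ⟨p, ε, hε0, hae.mono fun x hx => (hkey x hx).1, hnm, ?_⟩
  refine ((integrable_toReal_of_lintegral_ne_top hΦm.aemeasurable hΦ).const_mul 2).mono'
    (Real.measurable_exp.comp (hnm.const_mul ε)).aestronglyMeasurable ?_
  filter_upwards [hae] with x hx
  rw [Real.norm_of_nonneg (Real.exp_pos _).le]
  exact (hkey x hx).2

theorem IsAnalytic.exists_isAdmissible {T : NuclearTriple H N} {μ : DualMeasure N}
    [IsProbabilityMeasure μ] (hμ : T.IsAnalytic μ) : ∃ p₀ q₀, T.IsAdmissible μ p₀ q₀ := by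
  obtain ⟨p, ε, hε, hae, hmeas, hint⟩ := hμ.exists_integrable_exp_norm
  set I := ∫ x, Real.exp (ε * T.realDualNorm p x) ∂μ with hI
  have hI0 : 0 ≤ I := integral_nonneg fun x => (Real.exp_pos _).le
  -- The bound `r ≤ ε / 2` provides an integrable majorant; `r ≤ ε / (4 (I + 1))` makes `|l_μ(θ) -
  -- 1| ≤ 2 r I / ε ≤ 1 / 2`, so that `l_μ` stays away from zero.
  obtain ⟨q, hq⟩ := exists_pow_lt_of_lt_one (y := (1 / 2 : ℝ))
    (show 0 < min (ε / 2) (ε / (4 * (I + 1))) by positivity) (by norm_num)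
  rw [one_div, inv_pow] at hq
  set r := ((2 : ℝ) ^ q)⁻¹ with hr
  have hr0 : 0 < r := by positivity
  have hr1 : r ≤ ε / 2 := hq.le.trans (min_le_left _ _)
  have hr2 : r ≤ ε / (4 * (I + 1)) := hq.le.trans (min_le_right _ _)
  refine ⟨p, q, hae, ?_, 1 / 2, by norm_num, fun θ hθ => ?_⟩
  · refine hint.mono' (Real.measurable_exp.comp (hmeas.const_mul _)).aestronglyMeasurable
      (Eventually.of_forall fun x => ?_)
    rw [Real.norm_of_nonneg (Real.exp_pos _).le, Real.exp_le_exp]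
    exact mul_le_mul_of_nonneg_right (by linarith) (T.realDualNorm_nonneg p x)
  · have hθ' : T.cnrm p θ ≤ r := by
      rw [hr, ← one_div, le_div_iff₀ (by positivity)]
      linarith
    have hpair : ∀ᵐ x ∂μ, ‖pair (ofRealDual x) θ‖ ≤ r * T.realDualNorm p x := by
      filter_upwards [hae] with x hx
      refine (T.norm_pair_le_mul hx θ).trans ?_
      rw [mul_comm]
      exact mul_le_mul_of_nonneg_right hθ' (T.realDualNorm_nonneg p x)
    have hb : ∀ᵐ x ∂μ, ‖Complex.exp (pair (ofRealDual x) θ) - 1‖ ≤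
        (2 * r / ε) * Real.exp (ε * T.realDualNorm p x) := by
      filter_upwards [hpair] with x hx
      set D := T.realDualNorm p x
      have hD0 : 0 ≤ D := T.realDualNorm_nonneg p x
      have h1 := Complex.norm_exp_sub_sum_le_norm_mul_exp (pair (ofRealDual x) θ) 1
      simp only [Finset.range_one, Finset.sum_singleton, pow_zero, Nat.factorial_zero,
        Nat.cast_one, div_one, pow_one] at h1
      have h2 : ε / 2 * D ≤ Real.exp (ε / 2 * D) := by
        linarith [Real.add_one_le_exp (ε / 2 * D)]
      calc _ ≤ ‖pair (ofRealDual x) θ‖ * Real.exp ‖pair (ofRealDual x) θ‖ := h1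
        _ ≤ (r * D) * Real.exp (ε / 2 * D) := by
            gcongr
            exact hx.trans (mul_le_mul_of_nonneg_right hr1 hD0)
        _ = (2 * r / ε) * ((ε / 2 * D) * Real.exp (ε / 2 * D)) := by field_simp
        -- The linear factor is absorbed by `u ≤ exp u`, which uses up the other half of the
        -- exponent.
        _ ≤ (2 * r / ε) * (Real.exp (ε / 2 * D) * Real.exp (ε / 2 * D)) := by gcongr
        _ = _ := by rw [← Real.exp_add]; ring_nf
    have hm : AEStronglyMeasurable (fun x => Complex.exp (pair (ofRealDual x) θ)) μ :=
      (Complex.measurable_exp.comp (measurable_pair_ofRealDual θ)).aestronglyMeasurable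
    have hi1 : Integrable (fun x => Complex.exp (pair (ofRealDual x) θ) - 1) μ :=
      (hint.const_mul _).mono' (hm.sub aestronglyMeasurable_const) hb
    have hi2 : Integrable (fun x => Complex.exp (pair (ofRealDual x) θ)) μ := by
      refine (hi1.add (integrable_const (1 : ℂ))).congr (Eventually.of_forall fun x => ?_)
      simp
    have h1 : laplace μ θ - 1 = ∫ x, (Complex.exp (pair (ofRealDual x) θ) - 1) ∂μ := by
      rw [integral_sub hi2 (integrable_const 1)]
      simp [laplace]
    have h2 : ‖laplace μ θ - 1‖ ≤ 1 / 2 := by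
      rw [h1]
      refine (norm_integral_le_of_norm_le (hint.const_mul _) hb).trans ?_
      rw [integral_const_mul, ← hI]
      rw [le_div_iff₀ (by positivity)] at hr2
      rw [div_mul_eq_mul_div, div_le_iff₀ hε]
      nlinarith
    have h3 := norm_sub_norm_le (1 : ℂ) (1 - laplace μ θ)
    rw [sub_sub_cancel, norm_one, ← norm_sub_rev (laplace μ θ)] at h3
    linarith

/-! ## Convergence of the Appell series -/

theorem IsTest.hasSum_sq {T : NuclearTriple H N} {φ : ∀ n, T.SymPow n} (hφ : T.IsTest φ)
    (p q : ℕ) : HasSum (fun n => (n.factorial * √((2 : ℝ) ^ q) ^ n * T.kerNorm p (φ n)) ^ 2)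
      (T.testNorm p q φ ^ 2) := by
  rw [testNorm, Real.sq_sqrt ENNReal.toReal_nonneg]
  have h1 : T.testNormSq p q φ = ∑' n, ENNReal.ofReal
      ((n.factorial * √((2 : ℝ) ^ q) ^ n * T.kerNorm p (φ n)) ^ 2) := by
    refine tsum_congr fun n => ?_
    have h0 : (√((2 : ℝ) ^ q) ^ n) ^ 2 = 2 ^ (n * q) := by
      rw [← pow_mul, mul_comm, pow_mul, Real.sq_sqrt (by positivity), ← pow_mul, mul_comm]
    rw [mul_pow, mul_pow, h0, ENNReal.ofReal_mul (by positivity),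
      ENNReal.ofReal_mul (by positivity),
      ENNReal.ofReal_pow (n.factorial.cast_nonneg : (0 : ℝ) ≤ n.factorial),
      ENNReal.ofReal_natCast, ENNReal.ofReal_pow zero_le_two, ENNReal.ofReal_ofNat]
  have h2 : ∑' n, ENNReal.ofReal ((n.factorial * √((2 : ℝ) ^ q) ^ n * T.kerNorm p (φ n)) ^ 2) ≠
      ∞ := h1 ▸ (hφ p q).ne
  have h3 := ENNReal.summable_toReal h2
  rw [h1, ENNReal.tsum_toReal_eq fun _ => ENNReal.ofReal_ne_top]
  simpa only [ENNReal.toReal_ofReal (sq_nonneg _)] using h3.hasSum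

/-- Cauchy-Schwarz between the weighted coefficients `n! 2^{nq/2} |φ^{(n)}|_p` and the geometric
sequence `(ε^{-1} 2^{-q/2})^n`, whose squares have ratio `2^{-q} ε^{-2} < 1`. -/
theorem IsTest.sum_le {T : NuclearTriple H N} {φ : ∀ n, T.SymPow n} (hφ : T.IsTest φ)
    (p : ℕ) {q : ℕ} {ε : ℝ} (hε : 0 < ε) (hq : (ε ^ 2)⁻¹ < 2 ^ q) (M : ℕ) :
    ∑ n ∈ Finset.range M, n.factorial * ε⁻¹ ^ n * T.kerNorm p (φ n) ≤
      (√(1 - ((2 : ℝ) ^ q)⁻¹ * (ε ^ 2)⁻¹))⁻¹ * T.testNorm p q φ := by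
  set s := √((2 : ℝ) ^ q) with hs
  have hs0 : 0 < s := Real.sqrt_pos.2 (by positivity)
  have hs2 : s ^ 2 = 2 ^ q := Real.sq_sqrt (by positivity)
  set x : ℕ → ℝ := fun n => n.factorial * s ^ n * T.kerNorm p (φ n) with hx
  set y : ℕ → ℝ := fun n => (ε⁻¹ * s⁻¹) ^ n with hy
  set ρ := ((2 : ℝ) ^ q)⁻¹ * (ε ^ 2)⁻¹ with hρ
  have hρ0 : 0 ≤ ρ := by positivity
  have hρ1 : ρ < 1 := by
    rw [hρ, inv_mul_lt_iff₀ (by positivity), mul_one]; exact hq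
  have hxy : ∀ n, n.factorial * ε⁻¹ ^ n * T.kerNorm p (φ n) = x n * y n := fun n => by
    simp only [hx, hy, mul_pow]
    have : s ^ n * s⁻¹ ^ n = 1 := by rw [← mul_pow, mul_inv_cancel₀ hs0.ne', one_pow]
    linear_combination (-(n.factorial * ε⁻¹ ^ n * T.kerNorm p (φ n) : ℝ)) * this
  have hy2 : ∀ n, y n ^ 2 = ρ ^ n := fun n => by
    simp only [hy]
    rw [← pow_mul, mul_comm n 2, pow_mul, mul_pow, inv_pow, inv_pow, hs2, hρ, mul_comm]
  have h1 : ∑ n ∈ Finset.range M, x n ^ 2 ≤ T.testNorm p q φ ^ 2 :=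
    sum_le_hasSum _ (fun _ _ => sq_nonneg _) (hφ.hasSum_sq p q)
  have h2 : ∑ n ∈ Finset.range M, y n ^ 2 ≤ (1 - ρ)⁻¹ := by
    simp only [hy2]
    exact sum_le_hasSum _ (fun _ _ => pow_nonneg hρ0 _) (hasSum_geometric_of_lt_one hρ0 hρ1)
  simp only [hxy]
  refine (Real.sum_mul_le_sqrt_mul_sqrt _ _ _).trans ?_
  rw [mul_comm, ← Real.sqrt_inv]
  refine mul_le_mul (Real.sqrt_le_sqrt h2) ?_ (Real.sqrt_nonneg _) (Real.sqrt_nonneg _)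
  exact Real.sqrt_le_iff.2 ⟨Real.sqrt_nonneg _, h1⟩

theorem IsTest.summable {T : NuclearTriple H N} {φ : ∀ n, T.SymPow n} (hφ : T.IsTest φ)
    (p : ℕ) {ε : ℝ} (hε : 0 < ε) :
    Summable fun n => n.factorial * ε⁻¹ ^ n * T.kerNorm p (φ n) := by
  obtain ⟨q, hq⟩ := pow_unbounded_of_one_lt (ε ^ 2)⁻¹ (one_lt_two : (1 : ℝ) < 2)
  have hnn : ∀ n, 0 ≤ n.factorial * ε⁻¹ ^ n * T.kerNorm p (φ n) := fun n =>
    mul_nonneg (by positivity) (T.kerNorm_nonneg _ _)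
  exact summable_of_sum_range_le hnn (hφ.sum_le p hε hq)

variable {T : NuclearTriple H N} {μ : DualMeasure N} {p₀ q₀ : ℕ}

/-- The majorant `b` does not depend on `z`, and `η` is arbitrary: all convergence and growth
statements follow from it. The weight `(n!)²` compensates the factorial of the kernel, and q is free
to beat `ε^{-n}`. -/
theorem IsAdmissible.exists_norm_appell_le (h : T.IsAdmissible μ p₀ q₀) [IsProbabilityMeasure μ]
    {φ : ∀ n, T.SymPow n} (hφ : T.IsTest φ) (p : ℕ) {η : ℝ} (hη : 0 < η) :
    ∃ b : ℕ → ℝ, Summable b ∧ (∀ n, 0 ≤ b n) ∧ ∀ n, ∀ z ∈ T.Hneg p,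
      ‖T.appell μ n z (φ n)‖ ≤ b n * Real.exp (η * (T.dualNorm p z).toReal) := by
  obtain ⟨p', A, ε, C, hA, hε, hC0, hC, hεC, hp⟩ := h.exists_hsPoly_appellPoly p hη
  have hk := fun n => T.kerNorm_nonneg p' (φ n)
  refine ⟨fun n => A * (n.factorial * ε⁻¹ ^ n * T.kerNorm p' (φ n)),
    (hφ.summable p' hε).mul_left A, fun n => ?_, fun n z hz => ?_⟩
  · have := hk n
    positivity
  · have hz' := T.mem_Hneg_of_nrm_le hC0 hC hz
    refine ((hp n z hz'.1).norm_appell_le.2 (φ n)).trans ?_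
    have h1 : Real.exp (ε * (T.dualNorm p' z).toReal) ≤
        Real.exp (η * (T.dualNorm p z).toReal) := by
      apply Real.exp_le_exp.2
      calc ε * (T.dualNorm p' z).toReal ≤ ε * (C * (T.dualNorm p z).toReal) := by
            gcongr; exact hz'.2
        _ = ε * C * (T.dualNorm p z).toReal := by ring
        _ ≤ _ := mul_le_mul_of_nonneg_right hεC ENNReal.toReal_nonneg
    have := hk n
    calc _ = A * (n.factorial * ε⁻¹ ^ n * T.kerNorm p' (φ n)) *
          Real.exp (ε * (T.dualNorm p' z).toReal) := by ring
      _ ≤ _ := mul_le_mul_of_nonneg_left h1 (by positivity)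

/-- The sum of the series `∑ ⟨P_n^μ(z), φ^{(n)}⟩`. -/
def appellSum (T : NuclearTriple H N) (μ : DualMeasure N) (φ : ∀ n, T.SymPow n)
    (z : N →L[ℝ] ℂ) : ℂ := ∑' n, T.appell μ n z (φ n)

theorem IsAdmissible.summable_norm_appell (h : T.IsAdmissible μ p₀ q₀) [IsProbabilityMeasure μ]
    {φ : ∀ n, T.SymPow n} (hφ : T.IsTest φ) (z : N →L[ℝ] ℂ) :
    Summable fun n => ‖T.appell μ n z (φ n)‖ := by
  obtain ⟨p, hz⟩ := T.exists_mem_Hneg z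
  obtain ⟨b, hb, -, hle⟩ := h.exists_norm_appell_le hφ p one_pos
  exact Summable.of_nonneg_of_le (fun _ => norm_nonneg _) (fun n => hle n z hz) (hb.mul_right _)

theorem IsAdmissible.hasSum_appell (h : T.IsAdmissible μ p₀ q₀) [IsProbabilityMeasure μ]
    {φ : ∀ n, T.SymPow n} (hφ : T.IsTest φ) (z : N →L[ℝ] ℂ) :
    HasSum (fun n => T.appell μ n z (φ n)) (T.appellSum μ φ z) :=
  (h.summable_norm_appell hφ z).of_norm.hasSum

theorem IsAdmissible.isEmin_appellSum (h : T.IsAdmissible μ p₀ q₀) [IsProbabilityMeasure μ]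
    {φ : ∀ n, T.SymPow n} (hφ : T.IsTest φ) : T.IsEmin (T.appellSum μ φ) := by
  have hbound : ∀ p, ∀ {η : ℝ}, 0 < η → ∃ B : ℝ, 0 ≤ B ∧ ∀ z ∈ T.Hneg p,
      ‖T.appellSum μ φ z‖ ≤ B * Real.exp (η * (T.dualNorm p z).toReal) := by
    intro p η hη
    obtain ⟨b, hb, hb0, hle⟩ := h.exists_norm_appell_le hφ p hη
    refine ⟨∑' n, b n, tsum_nonneg hb0, fun z hz => ?_⟩
    exact tsum_of_norm_bounded (hb.hasSum.mul_right _) fun n => hle n z hz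
  intro p l
  refine ⟨fun z hz => ⟨fun w hw => ?_, ?_⟩, ?_⟩
  · obtain ⟨b, hb, hb0, hle⟩ := h.exists_norm_appell_le hφ p one_pos
    -- On a disc in `t` the exponential factor is bounded, so the Weierstrass theorem applies to the
    -- series of polynomials.
    have hball : ∀ R : ℝ, DifferentiableOn ℂ (fun t : ℂ => T.appellSum μ φ (z + t • w))
        (Metric.ball 0 R) := by
      intro R
      refine Complex.differentiableOn_tsum_of_summable_norm (u := fun n => b n *
        Real.exp (1 * ((T.dualNorm p z).toReal + R * (T.dualNorm p w).toReal)))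
        (hb.mul_right _) (fun n => (h.differentiable_appell (φ n) z w).differentiableOn)
        Metric.isOpen_ball fun n t ht => ?_
      have htw := T.smul_mem_Hneg t hw
      refine (hle n _ (T.add_mem_Hneg hz htw)).trans ?_
      refine mul_le_mul_of_nonneg_left (Real.exp_le_exp.2 ?_) (hb0 n)
      rw [one_mul, one_mul]
      refine (T.toReal_dualNorm_add_le hz htw).trans ?_
      have h1 := T.toReal_dualNorm_smul_le t hw
      have h2 : ‖t‖ * (T.dualNorm p w).toReal ≤ R * (T.dualNorm p w).toReal :=
        mul_le_mul_of_nonneg_right (by simpa using (Metric.mem_ball.1 ht).le)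
          ENNReal.toReal_nonneg
      linarith
    intro t
    exact (hball (‖t‖ + 1)).differentiableAt (Metric.isOpen_ball.mem_nhds (by simp))
  · obtain ⟨B, hB0, hB⟩ := hbound p one_pos
    refine ⟨1, B * Real.exp (1 * ((T.dualNorm p z).toReal + 1)), one_pos, fun w hw => ?_⟩
    have hw' : w ∈ T.Hneg p := hw.trans ENNReal.ofReal_lt_top
    refine (hB _ (T.add_mem_Hneg hz hw')).trans ?_
    have h1 := T.toReal_dualNorm_add_le hz hw'
    have h2 : (T.dualNorm p w).toReal ≤ 1 := ENNReal.toReal_le_of_le_ofReal zero_le_one hw.le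
    gcongr
    linarith
  · obtain ⟨B, hB0, hB⟩ := hbound p (η := ((2 : ℝ) ^ l)⁻¹) (by positivity)
    refine lt_of_le_of_lt (iSup₂_le fun z hz => ENNReal.ofReal_le_ofReal (q := B) ?_)
      ENNReal.ofReal_lt_top
    have h1 := mul_le_mul_of_nonneg_right (hB z hz)
      (Real.exp_pos (-((2 : ℝ) ^ l)⁻¹ * (T.dualNorm p z).toReal)).le
    rwa [mul_assoc, ← Real.exp_add, neg_mul, add_neg_cancel, Real.exp_zero, mul_one,
      ← neg_mul] at h1

theorem IsAdmissible.extends_appellSum (h : T.IsAdmissible μ p₀ q₀) [IsProbabilityMeasure μ]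
    {φ : ∀ n, T.SymPow n} (hφ : T.IsTest φ) : T.Extends μ φ (T.appellSum μ φ) :=
  fun x => h.hasSum_appell hφ (ofRealDual x)

/-! ## Entire functions of order one and minimal type -/

theorem exists_mem_Hneg_pair (T : NuclearTriple H N) (z w : N →L[ℝ] ℂ) :
    ∃ p, z ∈ T.Hneg p ∧ w ∈ T.Hneg p := by
  obtain ⟨p₁, h₁⟩ := T.exists_mem_Hneg z
  obtain ⟨p₂, h₂⟩ := T.exists_mem_Hneg w
  exact ⟨max p₁ p₂, T.Hneg_mono (le_max_left _ _) h₁, T.Hneg_mono (le_max_right _ _) h₂⟩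

theorem IsEmin.differentiable {F : (N →L[ℝ] ℂ) → ℂ} (hF : T.IsEmin F) (z w : N →L[ℝ] ℂ) :
    Differentiable ℂ fun t : ℂ => F (z + t • w) := by
  obtain ⟨p, hz, hw⟩ := T.exists_mem_Hneg_pair z w
  exact ((hF p 0).1 z hz).1 w hw

theorem eq_zero_of_forall_real {f : ℂ → ℂ} (hf : Differentiable ℂ f) (h : ∀ t : ℝ, f t = 0) :
    f = 0 := by
  have h1 : AnalyticOnNhd ℂ f Set.univ := fun z _ => hf.analyticAt z
  have h2 : Tendsto (fun t : ℝ => (t : ℂ)) (𝓝[≠] 0) (𝓝[≠] 0) := by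
    refine tendsto_nhdsWithin_iff.2 ⟨?_, ?_⟩
    · exact (Complex.continuous_ofReal.tendsto' 0 0 (by simp)).mono_left nhdsWithin_le_nhds
    · filter_upwards [self_mem_nhdsWithin] with t ht
      simpa using ht
  have h3 : ∃ᶠ z in 𝓝[≠] (0 : ℂ), f z = 0 :=
    h2.frequently (Eventually.of_forall fun t => h t).frequently
  funext z
  exact h1.eqOn_zero_of_preconnected_of_frequently_eq_zero isPreconnected_univ (Set.mem_univ 0) h3
    (Set.mem_univ z)

/-- For `z = x + i y`, the functions `t ↦ F(x + t y)` and `t ↦ G(x + t y)` agree for real `t`, hence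
at `t = i`. -/
theorem IsEmin.ext_of_real {F G : (N →L[ℝ] ℂ) → ℂ} (hF : T.IsEmin F) (hG : T.IsEmin G)
    (h : ∀ x, F (ofRealDual x) = G (ofRealDual x)) : F = G := by
  funext z
  let x : N →L[ℝ] ℝ := Complex.reCLM.comp z
  let y : N →L[ℝ] ℝ := Complex.imCLM.comp z
  have hz : z = ofRealDual x + Complex.I • ofRealDual y := by
    ext ξ
    change z ξ = ((z ξ).re : ℂ) + Complex.I * ((z ξ).im : ℂ)
    rw [mul_comm, Complex.re_add_im]
  have h1 := eq_zero_of_forall_real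
    ((hF.differentiable (ofRealDual x) (ofRealDual y)).sub
      (hG.differentiable (ofRealDual x) (ofRealDual y))) fun t => by
    have h2 : ofRealDual x + (t : ℂ) • ofRealDual y = ofRealDual (x + t • y) := by
      ext ξ
      change (x ξ : ℂ) + (t : ℂ) * (y ξ : ℂ) = ((x ξ + t * y ξ : ℝ) : ℂ)
      push_cast; rfl
    simp only [Pi.sub_apply, h2, h, sub_self]
  have h3 := congrFun h1 Complex.I
  simp only [Pi.sub_apply, ← hz, Pi.zero_apply, sub_eq_zero] at h3
  exact h3

theorem dualNorm_anti (T : NuclearTriple H N) {p q : ℕ} (h : p ≤ q) (z : N →L[ℝ] ℂ) :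
    T.dualNorm q z ≤ T.dualNorm p z := by
  refine iSup_le fun θ => iSup_le fun hθ => le_iSup_of_le θ (le_iSup_of_le (le_trans ?_ hθ) le_rfl)
  simpa using T.cnrm_le_of_nrm_le zero_le_one (fun ξ => by simpa using T.nrm_mono h ξ) θ

theorem IsEmin.exists_norm_le {F : (N →L[ℝ] ℂ) → ℂ} (hF : T.IsEmin F) (p : ℕ) :
    ∃ M : ℝ, 0 ≤ M ∧ ∀ z ∈ T.Hneg p, ‖F z‖ ≤ M * Real.exp (T.dualNorm p z).toReal := by
  refine ⟨(T.growthNorm p 0 F).toReal, ENNReal.toReal_nonneg, fun z hz => ?_⟩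
  have h1 : ENNReal.ofReal (‖F z‖ * Real.exp (-((2 : ℝ) ^ 0)⁻¹ * (T.dualNorm p z).toReal)) ≤
      T.growthNorm p 0 F := le_iSup₂_of_le z hz le_rfl
  rw [ENNReal.ofReal_le_iff_le_toReal (hF p 0).2.ne] at h1
  simp only [pow_zero, inv_one, neg_mul, one_mul, Real.exp_neg] at h1
  rwa [← div_eq_mul_inv, div_le_iff₀ (Real.exp_pos _)] at h1

/-- Entire functions on `H_{-p}` that are bounded on bounded sets are uniformly continuous on
bounded sets. -/
theorem IsEmin.exists_norm_sub_le {F : (N →L[ℝ] ℂ) → ℂ} (hF : T.IsEmin F) (p : ℕ) (R : ℝ)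
    {η : ℝ} (hη : 0 < η) : ∃ δ : ℝ, 0 < δ ∧ δ ≤ 1 ∧ ∀ u ∈ T.Hneg p,
      (T.dualNorm p u).toReal ≤ R → ∀ v, T.dualNorm p v < ENNReal.ofReal δ →
        ‖F (u + v) - F u‖ ≤ η := by
  obtain ⟨M, hM0, hM⟩ := hF.exists_norm_le p
  set B := M * Real.exp (R + 1) with hB
  have hB0 : 0 ≤ B := by positivity
  set δ := min (1 / 2) (η / (2 * B + 1)) with hδ
  have hδ0 : 0 < δ := by positivity
  have hδ1 : δ ≤ 1 / 2 := min_le_left _ _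
  refine ⟨δ, hδ0, by linarith, fun u hu hR v hv => ?_⟩
  have hv' : v ∈ T.Hneg p := hv.trans ENNReal.ofReal_lt_top
  have hvδ : (T.dualNorm p v).toReal ≤ δ := ENNReal.toReal_le_of_le_ofReal hδ0.le hv.le
  have hle : ∀ s : ℂ, ‖s‖ < δ⁻¹ → ‖F (u + s • v)‖ ≤ B := by
    intro s hs
    have hsv := T.smul_mem_Hneg s hv'
    refine (hM _ (T.add_mem_Hneg hu hsv)).trans ?_
    rw [hB]
    gcongr
    refine (T.toReal_dualNorm_add_le hu hsv).trans (add_le_add hR ?_)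
    refine (T.toReal_dualNorm_smul_le s hv').trans ?_
    calc ‖s‖ * (T.dualNorm p v).toReal ≤ δ⁻¹ * δ := by gcongr
      _ = 1 := inv_mul_cancel₀ hδ0.ne'
  -- Schwarz' lemma for `s ↦ F(u + s v)` on the disc of radius `δ⁻¹`, where `|s v|_{-p} ≤ 1` and the
  -- oscillation is below `2B + 1`; at `s = 1` it gives the bound `δ (2B + 1)`.
  have h1 := Complex.dist_le_div_mul_dist_of_mapsTo_ball (f := fun s : ℂ => F (u + s • v))
    (c := 0) (R₁ := δ⁻¹) (R₂ := 2 * B + 1) (z := 1)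
    (hF.differentiable u v).differentiableOn (fun s hs => by
      have h2 := hle s (by simpa using hs)
      have h3 := hle 0 (by simpa using hδ0)
      rw [Metric.mem_closedBall, dist_eq_norm]
      exact (norm_sub_le _ _).trans (by linarith)) (by
      rw [Metric.mem_ball, dist_zero_right, norm_one, one_lt_inv₀ hδ0]
      linarith)
  have h0 : u + (0 : ℂ) • v = u := by ext ξ; simp
  simp only [one_smul, h0, dist_zero_right, norm_one, mul_one] at h1
  rw [dist_eq_norm, div_inv_eq_mul] at h1
  refine h1.trans ?_
  rw [mul_comm, ← le_div_iff₀ (by positivity)]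
  exact min_le_right _ _

/-- A ball in one `H_{-p}` is not a neighbourhood in the inductive limit. The neighbourhood consists
of finite sums of vectors from small balls of successively larger spaces, with radii such that the
i-th vector changes `F` by at most `2^{-i}`. -/
theorem IsEmin.entireOnDual {F : (N →L[ℝ] ℂ) → ℂ} (hF : T.IsEmin F) : T.EntireOnDual F := by
  intro z
  refine ⟨fun w => hF.differentiable z w, ?_⟩
  obtain ⟨p₀, hz⟩ := T.exists_mem_Hneg z
  choose δ hδ0 hδ1 hδ using fun k : ℕ => hF.exists_norm_sub_le (p₀ + k)
    ((T.dualNorm p₀ z).toReal + k) (η := (1 / 2) ^ k) (by positivity)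
  -- Sums that are constant from some length on: this form lets sums of different lengths be
  -- combined.
  refine ⟨{w | ∃ v : ℕ → (N →L[ℝ] ℂ), (∀ i, T.dualNorm (p₀ + i) (v i) < ENNReal.ofReal (δ i)) ∧
    ∃ k, ∀ K ≥ k, w = ∑ i ∈ Finset.range K, v i}, ‖F z‖ + 2, ?_, ?_, ?_⟩
  · rintro u ⟨u', hu', k, hk⟩ v ⟨v', hv', l, hl⟩ a b hab
    refine ⟨fun i => a • u' i + b • v' i, fun i => ?_, max k l, fun K hK => ?_⟩
    · set m := max (T.dualNorm (p₀ + i) (u' i)) (T.dualNorm (p₀ + i) (v' i)) with hm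
      refine lt_of_le_of_lt (b := m) ?_ (max_lt (hu' i) (hv' i))
      refine (T.dualNorm_add_le _ _ _).trans ((add_le_add (T.dualNorm_smul_le _ _ _)
        (T.dualNorm_smul_le _ _ _)).trans ?_)
      calc ‖a‖ₑ * T.dualNorm (p₀ + i) (u' i) + ‖b‖ₑ * T.dualNorm (p₀ + i) (v' i)
          ≤ ‖a‖ₑ * m + ‖b‖ₑ * m := by
            gcongr
            · exact le_max_left _ _
            · exact le_max_right _ _
        _ = (‖a‖ₑ + ‖b‖ₑ) * m := (add_mul _ _ _).symm
        _ ≤ 1 * m := by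
            gcongr
            rw [← ofReal_norm, ← ofReal_norm, ← ENNReal.ofReal_add (norm_nonneg _) (norm_nonneg _)]
            exact ENNReal.ofReal_le_one.2 hab
        _ = m := one_mul m
    · rw [Finset.sum_add_distrib, ← Finset.smul_sum, ← Finset.smul_sum,
        ← hk K ((le_max_left _ _).trans hK), ← hl K ((le_max_right _ _).trans hK)]
  · intro p
    -- A vector of the ball in `H_{-p}` is placed in slot `p`, where the larger space `H_{-(p₀+p)}`
    -- gives it a smaller norm.
    refine ⟨δ p, hδ0 p, fun w hw => ⟨Pi.single p w, fun i => ?_, p + 1, fun K hK => ?_⟩⟩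
    · rcases eq_or_ne i p with rfl | hi
      · rw [Pi.single_eq_same]
        exact (T.dualNorm_anti (Nat.le_add_left _ _) w).trans_lt hw
      · rw [Pi.single_eq_of_ne hi, dualNorm_zero]
        simpa using hδ0 i
    · rw [Finset.sum_pi_single', if_pos (Finset.mem_range.2 (by omega))]
  · rintro w ⟨v, hv, k, hk⟩
    have hv' : ∀ i, v i ∈ T.Hneg (p₀ + i) := fun i => (hv i).trans ENNReal.ofReal_lt_top
    have hsum : ∀ K, z + ∑ i ∈ Finset.range K, v i ∈ T.Hneg (p₀ + K) ∧
        (T.dualNorm (p₀ + K) (z + ∑ i ∈ Finset.range K, v i)).toReal ≤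
          (T.dualNorm p₀ z).toReal + K := by
      intro K
      induction K with
      | zero => simpa using hz
      | succ K ih =>
        have h1 : ∀ {y} , y ∈ T.Hneg (p₀ + K) → y ∈ T.Hneg (p₀ + (K + 1)) ∧
            (T.dualNorm (p₀ + (K + 1)) y).toReal ≤ (T.dualNorm (p₀ + K) y).toReal :=
          fun {y} hy => ⟨T.Hneg_mono (by omega) hy,
            ENNReal.toReal_mono hy.ne (T.dualNorm_anti (by omega) y)⟩
        have h2 := h1 ih.1
        have h3 := h1 (hv' K)
        have h5 : z + ∑ i ∈ Finset.range (K + 1), v i =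
            z + ∑ i ∈ Finset.range K, v i + v K := by rw [Finset.sum_range_succ, add_assoc]
        rw [h5]
        refine ⟨T.add_mem_Hneg h2.1 h3.1, (T.toReal_dualNorm_add_le h2.1 h3.1).trans ?_⟩
        have h4 : (T.dualNorm (p₀ + K) (v K)).toReal ≤ 1 :=
          (ENNReal.toReal_le_of_le_ofReal (hδ0 K).le (hv K).le).trans (hδ1 K)
        push_cast
        linarith [ih.2, h2.2, h3.2]
    -- Telescoping; the preceding bound keeps each partial sum in the ball on which the next radius
    -- was chosen.
    have hF' : ∀ K, ‖F (z + ∑ i ∈ Finset.range K, v i)‖ ≤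
        ‖F z‖ + ∑ i ∈ Finset.range K, (1 / 2 : ℝ) ^ i := by
      intro K
      induction K with
      | zero => simp
      | succ K ih =>
        have h1 := hδ K _ (hsum K).1 (hsum K).2 (v K) (hv K)
        rw [add_assoc, ← Finset.sum_range_succ] at h1
        rw [Finset.sum_range_succ (fun i => (1 / 2 : ℝ) ^ i)]
        have h2 := norm_le_norm_add_norm_sub' (F (z + ∑ i ∈ Finset.range (K + 1), v i))
          (F (z + ∑ i ∈ Finset.range K, v i))
        linarith
    rw [hk k le_rfl]
    refine (hF' k).trans (add_le_add le_rfl ?_)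
    exact sum_le_hasSum _ (fun _ _ => by positivity) hasSum_geometric_two

variable {T : NuclearTriple H N} {μ : DualMeasure N} {p₀ q₀ : ℕ}

/-! ## Convergence in `L²(μ)` and the growth estimate -/

/-- On a tensor power the kernel is a polynomial in `⟨x, θ⟩`, hence a cylinder function. -/
theorem IsAdmissible.measurable_appell_of_mem_span (h : T.IsAdmissible μ p₀ q₀)
    [IsProbabilityMeasure μ] {n : ℕ} {ψ : T.SymPow n}
    (hψ : ψ ∈ Submodule.span ℂ (Set.range (T.symTensor n))) :
    Measurable fun x => T.appell μ n (ofRealDual x) ψ := by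
  induction hψ using Submodule.span_induction with
  | mem ψ hψ =>
    obtain ⟨θ, rfl⟩ := hψ
    have h1 : ∀ x, T.appell μ n (ofRealDual x) (T.symTensor n θ) =
        ∑ i ∈ Finset.range (n + 1), (n.choose i : ℂ) *
          (pair (ofRealDual x) θ ^ i * appellPoly μ (n - i) 0 θ) := fun x => by
      rw [(h.isAppell_appell n (ofRealDual x)).2 θ, ← h.appellPoly_add, zero_add, appellPoly]
    simp only [h1]
    exact Finset.measurable_sum _ fun i _ =>
      (((measurable_pair_ofRealDual θ).pow_const i).mul_const _).const_mul _
  | zero => simp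
  | add ψ ψ' _ _ h1 h2 => simp only [map_add]; exact h1.add h2
  | smul c ψ _ h1 => simp only [map_smul, smul_eq_mul]; exact h1.const_mul c

/-- A general `φ` is a limit of combinations of tensor powers, and for almost every `x` the kernel
is continuous in one norm that is independent of `x`. -/
theorem IsAdmissible.aestronglyMeasurable_appell (h : T.IsAdmissible μ p₀ q₀)
    [IsProbabilityMeasure μ] {n : ℕ} (φ : T.SymPow n) :
    AEStronglyMeasurable (fun x => T.appell μ n (ofRealDual x) φ) μ := by
  obtain ⟨p, A, ε, C, -, -, hC0, hC, -, hp⟩ := h.exists_hsPoly_appellPoly p₀ one_pos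
  choose ψ hψ hle _ using fun k : ℕ => T.exists_span_kerNorm_sub_le p p φ
    (δ := 1 / ((k : ℝ) + 1)) (by positivity)
  refine aestronglyMeasurable_of_tendsto_ae atTop (fun k =>
    (h.measurable_appell_of_mem_span (hψ k)).aestronglyMeasurable) ?_
  filter_upwards [h.1] with x hx
  have hb := (hp n _ (T.mem_Hneg_of_nrm_le hC0 hC hx).1).norm_appell_le.2
  set K := n.factorial * A * ε⁻¹ ^ n * Real.exp (ε * (T.dualNorm p (ofRealDual x)).toReal)
  rw [tendsto_iff_norm_sub_tendsto_zero]
  refine squeeze_zero (g := fun k : ℕ => |K| * (1 / ((k : ℝ) + 1))) (fun _ => norm_nonneg _)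
    (fun k => ?_) ?_
  · rw [norm_sub_rev, ← map_sub]
    refine (hb _).trans ?_
    exact mul_le_mul (le_abs_self K) (hle k) (T.kerNorm_nonneg _ _) (abs_nonneg K)
  · simpa using (tendsto_one_div_add_atTop_nhds_zero_nat (𝕜 := ℝ)).const_mul |K|

theorem IsAdmissible.aestronglyMeasurable_partialSum (h : T.IsAdmissible μ p₀ q₀)
    [IsProbabilityMeasure μ] (φ : ∀ n, T.SymPow n) (M : ℕ) :
    AEStronglyMeasurable (fun x => T.partialSum μ φ M (ofRealDual x)) μ :=
  Finset.aestronglyMeasurable_fun_sum _ fun n _ => h.aestronglyMeasurable_appell (φ n)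

theorem IsAdmissible.aestronglyMeasurable_appellSum (h : T.IsAdmissible μ p₀ q₀)
    [IsProbabilityMeasure μ] {φ : ∀ n, T.SymPow n} (hφ : T.IsTest φ) :
    AEStronglyMeasurable (fun x => T.appellSum μ φ (ofRealDual x)) μ :=
  aestronglyMeasurable_of_tendsto_ae atTop (fun M => h.aestronglyMeasurable_partialSum φ M)
    (Eventually.of_forall fun x => (h.hasSum_appell hφ (ofRealDual x)).tendsto_sum_nat)

/-- Half the admissible exponent, so that the square is the integrable exponential. -/
theorem IsAdmissible.memLp_exp (h : T.IsAdmissible μ p₀ q₀) :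
    MemLp (fun x => Real.exp (((2 : ℝ) ^ q₀)⁻¹ / 2 * T.realDualNorm p₀ x)) 2 μ := by
  rw [memLp_two_iff_integrable_sq
    (Real.continuous_exp.comp_aestronglyMeasurable (h.aestronglyMeasurable_norm.const_mul _))]
  refine h.integrable_exp_norm.congr (Eventually.of_forall fun x => ?_)
  simp only [← Real.exp_nat_mul]
  congr 1
  push_cast
  ring

theorem IsAdmissible.exists_norm_appellSum_sub_le (h : T.IsAdmissible μ p₀ q₀)
    [IsProbabilityMeasure μ] {φ : ∀ n, T.SymPow n} (hφ : T.IsTest φ) (p : ℕ) {η : ℝ}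
    (hη : 0 < η) : ∃ τ : ℕ → ℝ, Tendsto τ atTop (𝓝 0) ∧ ∀ M, ∀ z ∈ T.Hneg p,
      ‖T.partialSum μ φ M z - T.appellSum μ φ z‖ ≤
        τ M * Real.exp (η * (T.dualNorm p z).toReal) := by
  obtain ⟨b, hb, -, hle⟩ := h.exists_norm_appell_le hφ p hη
  refine ⟨fun M => ∑' n, b (n + M), tendsto_sum_nat_add b, fun M z hz => ?_⟩
  rw [norm_sub_rev, partialSum, appellSum,
    ← (h.hasSum_appell hφ z).summable.sum_add_tsum_nat_add M, add_sub_cancel_left]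
  exact tsum_of_norm_bounded (((summable_nat_add_iff M).2 hb).hasSum.mul_right _)
    fun n => hle (n + M) z hz

theorem IsAdmissible.tendstoUniformlyOn_partialSum (h : T.IsAdmissible μ p₀ q₀)
    [IsProbabilityMeasure μ] {φ : ∀ n, T.SymPow n} (hφ : T.IsTest φ) (p : ℕ) (R : ℝ) :
    TendstoUniformlyOn (T.partialSum μ φ) (T.appellSum μ φ) atTop
      {z | T.dualNorm p z ≤ ENNReal.ofReal R} := by
  obtain ⟨τ, hτ, hle⟩ := h.exists_norm_appellSum_sub_le hφ p one_pos
  have h1 := (hτ.abs.mul_const (Real.exp (1 * max R 0)))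
  rw [abs_zero, zero_mul] at h1
  rw [Metric.tendstoUniformlyOn_iff]
  intro ε hε
  filter_upwards [h1.eventually_lt_const hε] with M hM z hz
  have hz' : T.dualNorm p z ≤ ENNReal.ofReal R := hz
  have h2 : (T.dualNorm p z).toReal ≤ max R 0 :=
    ENNReal.toReal_le_of_le_ofReal (le_max_right _ _)
      (hz'.trans (ENNReal.ofReal_le_ofReal (le_max_left _ _)))
  rw [dist_comm, dist_eq_norm]
  refine lt_of_le_of_lt ((hle M z (hz'.trans_lt ENNReal.ofReal_lt_top)).trans ?_) hM
  exact mul_le_mul (le_abs_self _) (Real.exp_le_exp.2 (by linarith)) (Real.exp_pos _).le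
    (abs_nonneg _)

theorem IsAdmissible.tendsto_eLpNorm (h : T.IsAdmissible μ p₀ q₀)
    [IsProbabilityMeasure μ] {φ : ∀ n, T.SymPow n} (hφ : T.IsTest φ) :
    Tendsto (fun M => eLpNorm (fun x => T.partialSum μ φ M (ofRealDual x) -
      T.appellSum μ φ (ofRealDual x)) 2 μ) atTop (𝓝 0) := by
  obtain ⟨τ, hτ, hle⟩ := h.exists_norm_appellSum_sub_le hφ p₀
    (η := ((2 : ℝ) ^ q₀)⁻¹ / 2) (by positivity)
  have h1 : Tendsto (fun M => ENNReal.ofReal (τ M) *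
      eLpNorm (fun x => Real.exp (((2 : ℝ) ^ q₀)⁻¹ / 2 * T.realDualNorm p₀ x)) 2 μ)
      atTop (𝓝 0) := by
    have h2 := ENNReal.Tendsto.mul_const (ENNReal.tendsto_ofReal hτ)
      (Or.inr (h.memLp_exp).eLpNorm_ne_top)
    rwa [ENNReal.ofReal_zero, zero_mul] at h2
  refine tendsto_of_tendsto_of_tendsto_of_le_of_le tendsto_const_nhds h1 (fun _ => bot_le)
    fun M => ?_
  refine eLpNorm_le_mul_eLpNorm_of_ae_le_mul ?_ _
  filter_upwards [h.1] with x hx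
  rw [Real.norm_of_nonneg (Real.exp_pos _).le]
  exact hle M _ hx

theorem IsAdmissible.memLp_appellSum (h : T.IsAdmissible μ p₀ q₀)
    [IsProbabilityMeasure μ] {φ : ∀ n, T.SymPow n} (hφ : T.IsTest φ) :
    MemLp (fun x => T.appellSum μ φ (ofRealDual x)) 2 μ := by
  obtain ⟨τ, -, hle⟩ := h.exists_norm_appellSum_sub_le hφ p₀
    (η := ((2 : ℝ) ^ q₀)⁻¹ / 2) (by positivity)
  refine h.memLp_exp.of_le_mul (c := τ 0) (h.aestronglyMeasurable_appellSum hφ) ?_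
  filter_upwards [h.1] with x hx
  rw [Real.norm_of_nonneg (Real.exp_pos _).le]
  have h1 := hle 0 _ hx
  rwa [partialSum, Finset.sum_range_zero, zero_sub, norm_neg] at h1

/-- Here p and ε are prescribed, so the kernel estimate is used directly with the Hilbert-Schmidt
norm itself; the constant is the reciprocal of the lower bound of `|l_μ|`. -/
theorem IsAdmissible.exists_norm_appellSum_le (h : T.IsAdmissible μ p₀ q₀)
    [IsProbabilityMeasure μ] {p : ℕ} (hp : T.hsInclSq p p₀ < ∞) {ε : ℝ} (hε : 0 < ε)
    (hεp : ε * (Real.exp 1 * T.hsIncl p p₀) ≤ ((2 : ℝ) ^ q₀)⁻¹) :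
    ∃ C : ℝ, 0 < C ∧ ∀ q : ℕ, (ε ^ 2)⁻¹ < 2 ^ q → ∀ φ : ∀ n, T.SymPow n, T.IsTest φ →
      ∀ z ∈ T.Hneg p, ‖T.appellSum μ φ z‖ ≤
        C * (√(1 - ((2 : ℝ) ^ q)⁻¹ * (ε ^ 2)⁻¹))⁻¹ * T.testNorm p q φ *
          Real.exp (ε * (T.dualNorm p z).toReal) := by
  obtain ⟨c, hc0, hc⟩ := h.2.2
  refine ⟨c⁻¹, inv_pos.2 hc0, fun q hq φ hφ z hz => ?_⟩
  have hle : ∀ n, ‖T.appell μ n z (φ n)‖ ≤ c⁻¹ * Real.exp (ε * (T.dualNorm p z).toReal) *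
      (n.factorial * ε⁻¹ ^ n * T.kerNorm p (φ n)) := fun n => by
    refine ((h.hsPoly_appellPoly (T.hsBound_hsIncl hp) hc0 hc hε
      (by rwa [Real.sqrt_sq (x := T.hsIncl p p₀) (Real.sqrt_nonneg _)]) n hz).norm_appell_le.2 (φ n)).trans_eq ?_
    ring
  refine (tsum_of_norm_bounded ((hφ.summable p hε).hasSum.mul_left _) hle).trans ?_
  have hnn : ∀ n, 0 ≤ n.factorial * ε⁻¹ ^ n * T.kerNorm p (φ n) := fun n =>
    mul_nonneg (by positivity) (T.kerNorm_nonneg _ _)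
  have h1 := Real.tsum_le_of_sum_range_le hnn (hφ.sum_le p hε hq)
  refine (mul_le_mul_of_nonneg_left h1 (by positivity)).trans_eq ?_
  ring

theorem IsAdmissible.eq_appellSum (h : T.IsAdmissible μ p₀ q₀) [IsProbabilityMeasure μ]
    {φ : ∀ n, T.SymPow n} (hφ : T.IsTest φ) {F : (N →L[ℝ] ℂ) → ℂ} (hF : T.IsEmin F)
    (hF' : T.Extends μ φ F) : F = T.appellSum μ φ :=
  hF.ext_of_real (h.isEmin_appellSum hφ) fun x => (hF' x).unique (h.extends_appellSum hφ x)

end NuclearTriple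

end

/-! ### The proposition -/

theorem mainTheorem8 {H N : Type*} [NormedAddCommGroup H] [InnerProductSpace ℝ H]
    [CompleteSpace H] [TopologicalSpace.SeparableSpace H]
    [AddCommGroup N] [Module ℝ N] [TopologicalSpace N] [IsTopologicalAddGroup N]
    (T : NuclearTriple H N) (μ : NuclearTriple.DualMeasure N) [IsProbabilityMeasure μ]
    (hμ : T.IsAnalytic μ) :
    (∀ (n : ℕ) (z : N →L[ℝ] ℂ), (∃! L, T.IsAppell μ n z L) ∧
      T.IsAppell μ n z (T.appell μ n z)) ∧
    (∀ φ : ∀ n, T.SymPow n, T.IsTest φ →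
      ∃! F : (N →L[ℝ] ℂ) → ℂ, T.IsEmin F ∧ T.Extends μ φ F) ∧
    (∀ φ : ∀ n, T.SymPow n, T.IsTest φ →
      ∀ F : (N →L[ℝ] ℂ) → ℂ, T.IsEmin F → T.Extends μ φ F →
        T.EntireOnDual F ∧
        (∀ z, Summable (fun n => ‖T.appell μ n z (φ n)‖) ∧
          HasSum (fun n => T.appell μ n z (φ n)) (F z)) ∧
        (∀ (p : ℕ) (R : ℝ), TendstoUniformlyOn (T.partialSum μ φ) F atTop
          {z | T.dualNorm p z ≤ ENNReal.ofReal R}) ∧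
        MemLp (fun x => F (NuclearTriple.ofRealDual x)) 2 μ ∧
        Tendsto (fun M => eLpNorm (fun x => T.partialSum μ φ M (NuclearTriple.ofRealDual x) -
          F (NuclearTriple.ofRealDual x)) 2 μ) atTop (𝓝 0)) ∧
    (∃ p₀ q₀, T.IsAdmissible μ p₀ q₀) ∧
    (∀ p₀ q₀, T.IsAdmissible μ p₀ q₀ → ∀ p, p₀ < p → T.hsInclSq p p₀ < ∞ →
      ∀ ε : ℝ, 0 < ε → ε * (Real.exp 1 * T.hsIncl p p₀) ≤ ((2 : ℝ) ^ q₀)⁻¹ →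
      ∃ C : ℝ, 0 < C ∧ ∀ q : ℕ, (ε ^ 2)⁻¹ < 2 ^ q →
        ∀ φ : ∀ n, T.SymPow n, T.IsTest φ →
        ∀ F : (N →L[ℝ] ℂ) → ℂ, T.IsEmin F → T.Extends μ φ F →
        ∀ z ∈ T.Hneg p, ‖F z‖ ≤
          C * (√(1 - ((2 : ℝ) ^ q)⁻¹ * (ε ^ 2)⁻¹))⁻¹ * T.testNorm p q φ *
            Real.exp (ε * (T.dualNorm p z).toReal)) := by
  obtain ⟨p₀, q₀, h⟩ := hμ.exists_isAdmissible
  refine ⟨fun n z => ⟨⟨_, h.isAppell_appell n z, fun L hL => hL.eq_appell.symm⟩,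
    h.isAppell_appell n z⟩, fun φ hφ => ?_, fun φ hφ F hF hF' => ?_, ⟨p₀, q₀, h⟩, ?_⟩
  · exact ⟨T.appellSum μ φ, ⟨h.isEmin_appellSum hφ, h.extends_appellSum hφ⟩,
      fun F hF => h.eq_appellSum hφ hF.1 hF.2⟩
  · obtain rfl := h.eq_appellSum hφ hF hF'
    exact ⟨hF.entireOnDual, fun z => ⟨h.summable_norm_appell hφ z, h.hasSum_appell hφ z⟩,
      h.tendstoUniformlyOn_partialSum hφ, h.memLp_appellSum hφ, h.tendsto_eLpNorm hφ⟩
  · intro p₁ q₁ h' p _ hp ε hε hεp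
    obtain ⟨C, hC, hle⟩ := h'.exists_norm_appellSum_le hp hε hεp
    refine ⟨C, hC, fun q hq φ hφ F hF hF' z hz => ?_⟩
    -- The extension is the Appell sum whichever admissible pair is used, so the estimate for `(p₁,
    -- q₁)` applies to it.
    rw [h.eq_appellSum hφ hF hF']
    exact hle q hq φ hφ z hz
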